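/- **Notation.** Let $\mathbb{N}=\{1,2,\dots\}$. For a prime $p$ and $y\in\mathbb{Q}^{+}$ put $\iota(y)=\max(0,\operatorname{ord}_p(y^{-1}))$, $\iota'(y)=\max(0,\operatorname{ord}_p y)$, $\rho_p=1/(p-1)$, and $\rho_p(y)=\rho_p$ if $\operatorname{ord}_p y\neq0$, $\rho_p(y)=0$ otherwise; write $\iota=\iota(y)$, $\iota'=\iota'(y)$ (so $\iota'(m)=\operatorname{ord}_p m$ for an integer $m\ge 1$). Let $e$ denote the $\mathbb{Z}_p$-periodic extension of $x\mapsto e^{2\pi i x}$ from $\mathbb{Z}[1/p]$ to $\mathbb{Q}_p$. Let $\mathbf{I}_0(\mathbb{Z}_p)$ be the set of power series with coefficients $a_k\in\mathbb{Z}_p$, $a_k\to0$, and $\mathbf{I}_0[\lambda](\mathbb{Z}_p)$ the subset with $\operatorname{ord}_p a_k\geq\lceil k\lambda\rceil$ for all $k\ge 0$. **The class $\mathbf{F}$.** For $w\in\mathbb{Z}$, $y\in\mathbb{Q}^+$, $\kappa\in\mathbb{N}$ with $\kappa\geq1+\iota'(2)$, $\lambda\in\rho_p\mathbb{N}$, $u\in\mathbb{N}$,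 the class $\mathbf{F}(w,y,\kappa,\lambda,u)$ consists of the $f\in\mathbb{Q}_p^\times\mathbf{I}_0(\mathbb{Z}_p)$ with $$f'(t)=p^w\omega'(1+p^{\iota+\kappa}\omega t)^{-y}+p^w\gamma_0+p^{u+w}g(t)$$ for some $\omega,\omega'\in\mathbb{Z}_p^\times$, $\gamma_0\in\mathbb{Z}_p$, $g\in\mathbf{I}_0[\lambda](\mathbb{Z}_p)$. **Exponent data.** Consider quintuples $q=(k,\ell,r,\delta,(n_0,u_0,\kappa_0,\lambda_0))$ where $k,\ell\in\mathbb{R}$, $0\le k\le\frac12\le\ell\le1$, $\delta\geq0$ is real, $r$ is a real-valued and $n_0,u_0$ are $\mathbb{N}$-valued functions of $(y,p,\kappa,\lambda)$, $\kappa_0$ is an $\mathbb{N}$-valued and $\lambda_0$ an $\mathbb{R}_{\ge0}$-valued function of $(y,p)$ (with $y\in\mathbb{Q}^+$, $p$ prime, $\kappa\ge1+\iota'(2)$ an integer, $\lambda\in\rho_p\mathbb{N}$), such that $n_0(y,p,\kappa,\lambda)>\kappa+\iota'(y)$. Each of these functions $h$ is required to be generically independent of $y$: there is a function $h_0$ not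 depending on $y$ such that, for each $y$, there is a finite set $P_0(y)$ of primes such that $h(y,p,\cdot)=h_0(p,\cdot)$ for all primes $p\notin P_0(y)$. Such a $q$ is a *$p$-adic exponent datum* if there is a constant $C$, depending only on $q$, such that for all primes $p$ and all $y\in\mathbb{Q}^+$, $w\in\mathbb{Z}$, $\kappa\geq1+\iota'(2)$, $\lambda\in\rho_p\mathbb{N}$, $n,u\in\mathbb{N}$ with $$\kappa\ge\kappa_0(y,p),\quad\lambda\ge\lambda_0(y,p),\quad n\ge w+n_0(y,p,\kappa,\lambda),\quad u\geq u_0(y,p,\kappa,\lambda),$$ and all $f\in\mathbf{F}(w,y,\kappa,\lambda,u)$, $M\in\mathbb{Z}$ and real $0<B\le p^{n-w-\kappa-\iota'}$, $$\Big|\sum_{M<m\le M+B}e\Big(\frac{f(m)}{p^n}\Big)\Big|\le C\,p^{r(y,p,\kappa,\lambda)}\Big(\frac{p^{n-w-\kappa-\iota'}}{B}\Big)^kB^\ell\big(\log p^{n-w-\kappa-\iota'}\big)^\delta .$$ **Theorem ($B$-process).** If $q=(k,\ell,r,\delta,(n_0,u_0,\kappa_0,\lambda_0))$ is a $p$-adic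 exponent datum, then so is $$B(q)=\big(\ell-\tfrac12,\;k+\tfrac12,\;\tilde r,\;\delta+\delta_{01},\;(\tilde n_0,\tilde u_0,\tilde\kappa_0,\tilde\lambda_0)\big),$$ where $\delta_{01}=1$ if $(k,\ell)=(0,1)$ and $\delta_{01}=0$ otherwise, and, with $\tilde\lambda=\min(\kappa-\rho_p(y),\lambda)$, $$\begin{aligned} \tilde r(y,p,\kappa,\lambda)&=r(y^{-1},p,\kappa,\tilde\lambda),\\ \tilde\kappa_0(y,p)&=\max\big(1+\iota'(4),\ \kappa_0(y^{-1},p),\ \lceil\lambda_0(y^{-1},p)+\rho_p(y)\rceil\big),\\ \tilde\lambda_0(y,p)&=\lambda_0(y^{-1},p),\\ \tilde n_0(y,p,\kappa,\lambda)&=\max\big(\kappa+\iota'+1+\iota'(12),\ \operatorname{ord}_py+n_0(y^{-1},p,\kappa,\tilde\lambda)\big),\\ \tilde u_0(y,p,\kappa,\lambda)&=\max\big(\kappa-\lfloor\lambda\rfloor+\iota'+1,\ \operatorname{ord}_py+u_0(y^{-1},p,\kappa,\tilde\lambda)+\lceil\tilde\lambda\rceil-\lfloor\lambda\rfloor,\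 1\big). \end{aligned}$$ In particular, $\omega_{01}=(0,1,0,0,(\kappa+\iota'+1,\,1,\,1+\iota'(2),\,\rho_p))$ is a $p$-adic exponent datum, and $B(\omega_{01})$ equals $$\omega_{1/2}=\big(\tfrac12,\tfrac12,0,1,(\kappa+\iota'+1+\iota'(12),\ \max(\kappa-\lfloor\lambda\rfloor+\iota'+1,1),\ 1+\iota'(4),\ \rho_p)\big),$$ which is therefore a $p$-adic exponent datum. -/

import Mathlib

/-! ### Notation attached to a prime `p` and a positive rational `y` -/

/-- `ι(y) = max(0, ord_p(y⁻¹))`. -/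
def iotaP (p : ℕ) (y : ℚ) : ℕ := (padicValRat p y⁻¹).toNat

/-- `ι'(y) = max(0, ord_p y)`. -/
def iotaP' (p : ℕ) (y : ℚ) : ℕ := (padicValRat p y).toNat

/-- `ρ_p = 1 / (p - 1)`. -/
noncomputable def rhoP (p : ℕ) : ℝ := 1 / ((p : ℝ) - 1)

/-- `ρ_p(y)`, which is `ρ_p` if `ord_p y ≠ 0` and `0` otherwise. -/
noncomputable def rhoAt (p : ℕ) (y : ℚ) : ℝ := if padicValRat p y = 0 then 0 else rhoP p

/-- `λ ∈ ρ_p ℕ`, where `ℕ = {1, 2, 3, …}`. -/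
def IsRhoMultiple (p : ℕ) (lam : ℝ) : Prop := ∃ j : ℕ, 1 ≤ j ∧ lam = j * rhoP p

/-! ### The additive character of `ℚ_p` -/

theorem exists_padicFrac (p : ℕ) [Fact p.Prime] (x : ℚ_[p]) :
    ∃ q : ℚ, (∃ (a : ℤ) (k : ℕ), q = a / (p : ℚ) ^ k) ∧ ‖x - (q : ℚ_[p])‖ ≤ 1 := by
  have hp : (p : ℚ_[p]) ≠ 0 := Nat.cast_ne_zero.mpr (Fact.out : p.Prime).ne_zero
  have hp1 : (1 : ℝ) < p := by exact_mod_cast (Fact.out : p.Prime).one_lt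
  obtain ⟨k, hk⟩ := pow_unbounded_of_one_lt ‖x‖ hp1
  have hz : ‖(p : ℚ_[p]) ^ k * x‖ ≤ 1 := by
    rw [norm_mul, norm_pow, Padic.norm_p, inv_pow, inv_mul_le_iff₀ (by positivity), mul_one]
    exact hk.le
  let z : ℤ_[p] := ⟨(p : ℚ_[p]) ^ k * x, hz⟩
  have hs := (PadicInt.norm_le_pow_iff_mem_span_pow _ k).2 (PadicInt.appr_spec k z)
  refine ⟨(z.appr k : ℤ) / (p : ℚ) ^ k, ⟨z.appr k, k, rfl⟩, ?_⟩
  have e : x - (((z.appr k : ℤ) / (p : ℚ) ^ k : ℚ) : ℚ_[p]) =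
      ((p : ℚ_[p]) ^ k)⁻¹ * ((z - (z.appr k : ℤ_[p]) : ℤ_[p]) : ℚ_[p]) := by
    have hzx : (z : ℚ_[p]) = (p : ℚ_[p]) ^ k * x := rfl
    push_cast
    rw [hzx]
    field_simp
  rw [e, norm_mul, norm_inv, norm_pow, Padic.norm_p, inv_pow, inv_inv]
  rw [PadicInt.norm_def] at hs
  calc (p : ℝ) ^ k * ‖((z - (z.appr k : ℤ_[p]) : ℤ_[p]) : ℚ_[p])‖
      ≤ (p : ℝ) ^ k * (p : ℝ) ^ (-(k : ℤ)) := by gcongr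
    _ = 1 := by rw [zpow_neg, zpow_natCast]; field_simp

/-- The `ℤ_p`-periodic extension to `ℚ_p` of `e(q) = exp(2πiq)`, `q ∈ ℤ[1/p]`:
`e(x) = exp(2πiq)` for any `q ∈ ℤ[1/p]` with `x - q ∈ ℤ_p`. -/
noncomputable def padicE (p : ℕ) [Fact p.Prime] (x : ℚ_[p]) : ℂ :=
  Complex.exp (2 * Real.pi * Complex.I * ((exists_padicFrac p x).choose : ℂ))

/-- The value of `padicE` does not depend on the choice of `q`. -/
theorem padicE_eq (p : ℕ) [Fact p.Prime] (x : ℚ_[p]) (q : ℚ)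
    (hq : ∃ (a : ℤ) (k : ℕ), q = a / (p : ℚ) ^ k) (hx : ‖x - (q : ℚ_[p])‖ ≤ 1) :
    padicE p x = Complex.exp (2 * Real.pi * Complex.I * (q : ℂ)) := by
  obtain ⟨⟨b, l, hb⟩, hb'⟩ := (exists_padicFrac p x).choose_spec
  unfold padicE
  generalize (exists_padicFrac p x).choose = q' at hb hb'
  obtain ⟨a, k, ha⟩ := hq
  have hp : (p : ℚ) ≠ 0 := Nat.cast_ne_zero.mpr (Fact.out : p.Prime).ne_zero
  have hp' : (p : ℝ) ≠ 0 := Nat.cast_ne_zero.mpr (Fact.out : p.Prime).ne_zero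
  have hd : ‖((q' - q : ℚ) : ℚ_[p])‖ ≤ 1 := by
    have : ((q' - q : ℚ) : ℚ_[p]) = (x - q) - (x - q') := by push_cast; ring
    rw [this, sub_eq_add_neg]
    refine (Padic.nonarchimedean (x - (q : ℚ_[p])) (-(x - (q' : ℚ_[p])))).trans ?_
    rw [norm_neg]
    exact max_le hx hb'
  have hc : (q' - q) * (p : ℚ) ^ (k + l) = ((b * p ^ k - a * p ^ l : ℤ) : ℚ) := by
    rw [ha, hb]; push_cast; field_simp; ring
  have hdvd : ((p : ℤ) ^ (k + l)) ∣ (b * p ^ k - a * p ^ l : ℤ) := by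
    have h := Padic.norm_int_le_pow_iff_dvd (p := p) (b * p ^ k - a * p ^ l : ℤ) (k + l)
    refine h.1 ?_
    have hc' : (((b * p ^ k - a * p ^ l : ℤ)) : ℚ_[p]) =
        ((q' - q : ℚ) : ℚ_[p]) * (p : ℚ_[p]) ^ (k + l) := by
      have := congrArg (fun t : ℚ => (t : ℚ_[p])) hc
      push_cast at this ⊢
      exact this.symm
    rw [hc', norm_mul, norm_pow, Padic.norm_p, zpow_neg, zpow_natCast, inv_pow]
    exact mul_le_of_le_one_left (by positivity) hd
  obtain ⟨c, hc2⟩ := hdvd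
  have hqq : q' = q + c := by
    have h3 : (q' - q) * (p : ℚ) ^ (k + l) = c * (p : ℚ) ^ (k + l) := by
      rw [hc, hc2]; push_cast; ring
    have := mul_right_cancel₀ (pow_ne_zero _ hp) h3
    linarith
  rw [hqq]
  push_cast
  rw [mul_add, Complex.exp_add, mul_comm (2 * (Real.pi : ℂ) * Complex.I) (c : ℂ),
    Complex.exp_int_mul_two_pi_mul_I, mul_one]

/-! ### Classes of power series -/

/-- `I₀(ℤ_p)`: power series with coefficients in `ℤ_p` which tend to `0`. -/
def IZero (p : ℕ) [Fact p.Prime] : Set (PowerSeries ℚ_[p]) :=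
  {a | (∀ k, ‖PowerSeries.coeff k a‖ ≤ 1) ∧
    Filter.Tendsto (fun k => PowerSeries.coeff k a) Filter.atTop (nhds 0)}

/-- `I₀[λ](ℤ_p)`: the series in `I₀(ℤ_p)` with `ord_p a_k ≥ ⌈kλ⌉` for all `k ≥ 0`. -/
def IZeroDecay (p : ℕ) [Fact p.Prime] (lam : ℝ) : Set (PowerSeries ℚ_[p]) :=
  {a | a ∈ IZero p ∧ ∀ k : ℕ, ‖PowerSeries.coeff k a‖ ≤ (p : ℝ) ^ (-⌈(k : ℝ) * lam⌉)}

/-- The series `(1 + c t)^s = ∑ (s choose k) c^k t^k`, for rational `s`. -/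
noncomputable def onePlusPow (p : ℕ) [Fact p.Prime] (c : ℚ_[p]) (s : ℚ) : PowerSeries ℚ_[p] :=
  PowerSeries.rescale c (PowerSeries.binomialSeries ℚ_[p] s)

/-- The class `F(w, y, κ, λ, u)`: the series `f ∈ ℚ_p^× I₀(ℤ_p)` with
`f'(t) = p^w ω' (1 + p^(ι+κ) ω t)^(-y) + p^w γ₀ + p^(u+w) g(t)` for some
`ω, ω' ∈ ℤ_p^×`, `γ₀ ∈ ℤ_p` and `g ∈ I₀[λ](ℤ_p)`. -/
def ClassF (p : ℕ) [Fact p.Prime] (w : ℤ) (y : ℚ) (κ : ℕ) (lam : ℝ) (u : ℕ) :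
    Set (PowerSeries ℚ_[p]) :=
  {f | (∃ c : ℚ_[p], c ≠ 0 ∧ ∃ a ∈ IZero p, f = PowerSeries.C c * a) ∧
    ∃ (ω ω' : ℤ_[p]ˣ) (γ₀ : ℤ_[p]), ∃ g ∈ IZeroDecay p lam,
      PowerSeries.derivative ℚ_[p] f =
        PowerSeries.C ((p : ℚ_[p]) ^ w * ((ω' : ℤ_[p]) : ℚ_[p])) *
            onePlusPow p ((p : ℚ_[p]) ^ (iotaP p y + κ) * ((ω : ℤ_[p]) : ℚ_[p])) (-y)
          + PowerSeries.C ((p : ℚ_[p]) ^ w * (γ₀ : ℚ_[p]))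
          + PowerSeries.C ((p : ℚ_[p]) ^ ((u : ℤ) + w)) * g}

/-- The value `f(x) = ∑ a_k x^k` of a power series. -/
noncomputable def psEval (p : ℕ) [Fact p.Prime] (f : PowerSeries ℚ_[p]) (x : ℚ_[p]) : ℚ_[p] :=
  ∑' k : ℕ, PowerSeries.coeff k f * x ^ k

/-- The exponential sum `∑_{M < m ≤ M + B} e(f(m) / p^n)` over integers `m`. -/
noncomputable def expSum (p : ℕ) [Fact p.Prime] (f : PowerSeries ℚ_[p]) (n : ℕ) (M : ℤ) (B : ℝ) :
    ℂ :=
  ∑ m ∈ Finset.Ioc M (M + ⌊B⌋), padicE p (psEval p f (m : ℚ_[p]) / (p : ℚ_[p]) ^ n)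

/-! ### Exponent data -/

/-- The class `J(X_p; Y)`: functions `g(y, p, x)`, of which only the values at `y ∈ ℚ⁺`, `p` prime
and `x ∈ X_p` matter, such that for each `y` and all primes `p` outside a finite set depending
on `y` the value is `g₀(p, x)`, where `g₀` does not depend on `y`. -/
def MemJ {X Y : Type*} (D : ℕ → Set X) (g : ℚ → ℕ → X → Y) : Prop :=
  ∃ g₀ : ℕ → X → Y, ∀ y : ℚ, 0 < y → ∃ P₀ : Finset ℕ, ∀ p : ℕ, p.Prime → p ∉ P₀ →
    ∀ x ∈ D p, g y p x = g₀ p x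

/-- The pairs `(κ, λ)` with `κ ≥ 1 + ι'(2)` and `λ ∈ ρ_p ℕ`. -/
def kappaLambdaDomain (p : ℕ) : Set (ℕ × ℝ) := {x | 1 + iotaP' p 2 ≤ x.1 ∧ IsRhoMultiple p x.2}

/-- A quintuple `(k, ℓ, r, δ, (n₀, u₀, κ₀, λ₀))`. The arguments of `r`, `n₀`, `u₀` are `y`, `p`, `κ`,
`λ`, and those of `κ₀`, `λ₀` are `y`, `p`; only values at `y > 0`, `p` prime,
`(κ, λ) ∈ kappaLambdaDomain p` are relevant. -/
structure Quintuple where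
  k : ℝ
  l : ℝ
  r : ℚ → ℕ → ℕ → ℝ → ℝ
  δ : ℝ
  n₀ : ℚ → ℕ → ℕ → ℝ → ℤ
  u₀ : ℚ → ℕ → ℕ → ℝ → ℤ
  κ₀ : ℚ → ℕ → ℤ
  lam₀ : ℚ → ℕ → ℝ

/-- Membership of a quintuple in the set of admissible quintuples. -/
structure Quintuple.Admissible (q : Quintuple) : Prop where
  k_nonneg : 0 ≤ q.k
  k_le : q.k ≤ 1 / 2
  le_l : 1 / 2 ≤ q.l
  l_le : q.l ≤ 1
  δ_nonneg : 0 ≤ q.δ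
  r_mem : MemJ kappaLambdaDomain fun y p x => q.r y p x.1 x.2
  n₀_mem : MemJ kappaLambdaDomain fun y p x => q.n₀ y p x.1 x.2
  u₀_mem : MemJ kappaLambdaDomain fun y p x => q.u₀ y p x.1 x.2
  κ₀_mem : MemJ (fun _ => Set.univ) fun y p (_ : Unit) => q.κ₀ y p
  lam₀_mem : MemJ (fun _ => Set.univ) fun y p (_ : Unit) => q.lam₀ y p
  n₀_gt : ∀ (y : ℚ) (p κ : ℕ) (lam : ℝ), 0 < y → p.Prime → (κ, lam) ∈ kappaLambdaDomain p →
    (κ : ℤ) + iotaP' p y < q.n₀ y p κ lam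
  u₀_pos : ∀ (y : ℚ) (p κ : ℕ) (lam : ℝ), 0 < y → p.Prime → (κ, lam) ∈ kappaLambdaDomain p →
    1 ≤ q.u₀ y p κ lam
  κ₀_pos : ∀ (y : ℚ) (p : ℕ), 0 < y → p.Prime → 1 ≤ q.κ₀ y p
  lam₀_nonneg : ∀ (y : ℚ) (p : ℕ), 0 < y → p.Prime → 0 ≤ q.lam₀ y p

/-- The number `p^(n - w - κ - ι'(y))`. -/
noncomputable def dualLength (p n : ℕ) (w : ℤ) (κ : ℕ) (y : ℚ) : ℝ :=
  (p : ℝ) ^ ((n : ℤ) - w - κ - iotaP' p y)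

/-- The quintuple `q` is a `p`-adic exponent datum. The constant `C` depends only on `q`. -/
def IsExponentDatum (q : Quintuple) : Prop :=
  q.Admissible ∧
  ∃ C : ℝ, ∀ (p : ℕ) [Fact p.Prime] (y : ℚ) (w : ℤ) (κ : ℕ) (lam : ℝ) (n u : ℕ),
    0 < y → 1 + iotaP' p 2 ≤ κ → IsRhoMultiple p lam → 1 ≤ n → 1 ≤ u →
    q.κ₀ y p ≤ κ → q.lam₀ y p ≤ lam → w + q.n₀ y p κ lam ≤ n → q.u₀ y p κ lam ≤ u →
    ∀ f ∈ ClassF p w y κ lam u, ∀ (M : ℤ) (B : ℝ), 0 < B → B ≤ dualLength p n w κ y →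
      ‖expSum p f n M B‖ ≤
        C * ((p : ℝ) ^ q.r y p κ lam * (dualLength p n w κ y / B) ^ q.k * B ^ q.l *
          Real.log (dualLength p n w κ y) ^ q.δ)

/-- `λ̃ = min(κ - ρ_p(y), λ)`. -/
noncomputable def lamTilde (p : ℕ) (y : ℚ) (κ : ℕ) (lam : ℝ) : ℝ := min ((κ : ℝ) - rhoAt p y) lam

/-- The transformation `B` of quintuples. -/
noncomputable def bTransform (q : Quintuple) : Quintuple where
  k := q.l - 1 / 2
  l := q.k + 1 / 2
  r y p κ lam := q.r y⁻¹ p κ (lamTilde p y κ lam)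
  δ := q.δ + if q.k = 0 ∧ q.l = 1 then 1 else 0
  n₀ y p κ lam := max ((κ : ℤ) + iotaP' p y + 1 + iotaP' p 12)
    (padicValRat p y + q.n₀ y⁻¹ p κ (lamTilde p y κ lam))
  u₀ y p κ lam := max (max ((κ : ℤ) - ⌊lam⌋ + iotaP' p y + 1)
    (padicValRat p y + q.u₀ y⁻¹ p κ (lamTilde p y κ lam) + ⌈lamTilde p y κ lam⌉ - ⌊lam⌋)) 1
  κ₀ y p := max (max (1 + (iotaP' p 4 : ℤ)) (q.κ₀ y⁻¹ p)) ⌈q.lam₀ y⁻¹ p + rhoAt p y⌉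
  lam₀ y p := q.lam₀ y⁻¹ p

/-- The trivial datum. -/
noncomputable def trivialDatum : Quintuple where
  k := 0
  l := 1
  r _ _ _ _ := 0
  δ := 0
  n₀ y p κ _ := (κ : ℤ) + iotaP' p y + 1
  u₀ _ _ _ _ := 1
  κ₀ _ p := 1 + (iotaP' p 2 : ℤ)
  lam₀ _ p := rhoP p

/-- The datum for the pair `(1/2, 1/2)`. -/
noncomputable def halfDatum : Quintuple where
  k := 1 / 2
  l := 1 / 2
  r _ _ _ _ := 0
  δ := 1
  n₀ y p κ _ := (κ : ℤ) + iotaP' p y + 1 + iotaP' p 12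
  u₀ y p κ lam := max ((κ : ℤ) - ⌊lam⌋ + iotaP' p y + 1) 1
  κ₀ _ p := 1 + (iotaP' p 4 : ℤ)
  lam₀ _ p := rhoP p

/-- Equality of quintuples, the function components being compared on the relevant arguments. -/
structure Quintuple.Agree (q q' : Quintuple) : Prop where
  k_eq : q.k = q'.k
  l_eq : q.l = q'.l
  δ_eq : q.δ = q'.δ
  functions_eq : ∀ (y : ℚ) (p κ : ℕ) (lam : ℝ), 0 < y → p.Prime → (κ, lam) ∈ kappaLambdaDomain p →
    q.r y p κ lam = q'.r y p κ lam ∧ q.n₀ y p κ lam = q'.n₀ y p κ lam ∧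
    q.u₀ y p κ lam = q'.u₀ y p κ lam ∧ q.κ₀ y p = q'.κ₀ y p ∧ q.lam₀ y p = q'.lam₀ y p

/-!
The `B`-process is Poisson summation followed by stationary phase, and both are exact here. Put
`K = κ + ι'(y)` and `N = n - w - K`. A phase `f` in the class `F(w, y, κ, λ, u)` is an affine function
plus `p ^ (w + K)` times an antiderivative `ψ` of the normalised derivative
`φ = ((1 + c t)^(-y) - 1) / d + E`, where `φ(0) = 0`, `φ'(0)` is a unit, and `E` is small
(`exists_normalisedDeriv`). So the sum in question is a sum of `e(ψ(m) / p ^ N)` twisted by an additive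
character `m ↦ exp(2πi θ m)`.

*Duality.* The compositional inverse `S` of `φ` obeys the same Gauss norm bounds as `φ`
(`CoeffBound.of_subst_eq_X`), and without `E` it is `((1 + d t)^(-1/y) - 1) / c`, since both sides
of the required identity solve the same differential equation (`scaledPow_inv_subst`). With `E` it
changes by an error of the size of `E`. The Legendre transform `L = ψ(S) - t S` has derivative `-S`,
so `L` and all its linear twists `L + k t` lie in the class attached to `y⁻¹`, `κ` and
`λ̃ = min(κ - ρ_p(y), λ)` (`NormalisedDeriv.exists_dual`).

*Stationary phase.* Averaging over translates by a power of `p` near `p ^ (N / 2)`, the complete sum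
of `e((ψ(x) - j x) / p ^ N)` over `x` modulo `p ^ N` localises to a neighbourhood of `S(j)`, on which
the phase is exactly quadratic with leading coefficient independent of `j`. Hence it equals
`T e(L(j) / p ^ N)` with `T` independent of `j`, and Parseval gives `|T|² = p ^ N`
(`IsQuadraticPhase.exists_stationary_phase`). For this the Taylor remainder beyond the quadratic term
has to be divisible by `2 p h²` (`NormalisedDeriv.taylor_coeff_le`), which is where the conditions at
`p = 2` and `p = 3` enter.

*Completion.* With `P = p ^ N`, Fourier inversion turns the incomplete sum into
`P⁻¹ T ∑ e(L(j) / P) D(β_j)` over `j` modulo `P`, where `D` is a geometric sum of length at most `B` and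
the frequencies `β_j = (i + τ) / P` run once through the circle. For `β_j` within about `1 / B` of an
integer the two summations are interchanged; for the others `D(β) = (e(sβ) - e(tβ)) / (e(β) - 1)`,
where `1 / (e(β) - 1)` is a constant plus a monotone cotangent, and Abel summation on dyadic blocks
applies. Either way only sums of `e((L(j) + k j) / P)` over intervals are needed, and the exponent
datum for `y⁻¹` bounds them by `P ^ k |J| ^ (ℓ - k)`. The dyadic blocks form a geometric series, unless
`ℓ - k = 1`, that is `(k, ℓ) = (0, 1)`, when they cost the additional logarithm
(`norm_sum_mul_geom_sum_le_dyadicFactor`, `exists_dyadicFactor_le`).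
-/

open PowerSeries Filter Topology Finset

/-! ### Coefficient bounds for power series over an ultrametric field -/

section CoeffBound

variable {𝕜 : Type*} [NormedField 𝕜]

/-- The series `a` has Gauss norm at most `M` on the disc of radius `R`: `‖a_n‖ R ^ n ≤ M` for all
`n`. -/
def CoeffBound (R M : ℝ) (a : PowerSeries 𝕜) : Prop := ∀ n, ‖coeff n a‖ * R ^ n ≤ M

theorem CoeffBound.nonneg {R M : ℝ} {a : PowerSeries 𝕜} (h : CoeffBound R M a) : 0 ≤ M := by
  have := h 0
  simp only [pow_zero, mul_one] at this
  exact (norm_nonneg _).trans this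

theorem CoeffBound.neg {R M : ℝ} {a : PowerSeries 𝕜} (h : CoeffBound R M a) :
    CoeffBound R M (-a) := fun n => by simpa using h n

theorem coeffBound_one {R : ℝ} : CoeffBound R 1 (1 : PowerSeries 𝕜) := fun n => by
  rw [coeff_one]
  split_ifs with h
  · simp [h]
  · simp

theorem coeffBound_X {R : ℝ} (hR : 0 ≤ R) : CoeffBound R R (X : PowerSeries 𝕜) := fun n => by
  rw [coeff_X]
  split_ifs with h
  · simp [h]
  · simpa using hR

theorem hasSubst_of_coeff_zero {g : PowerSeries 𝕜} (hg : coeff 0 g = 0) : HasSubst g :=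
  HasSubst.of_constantCoeff_zero' (by simpa using hg)

theorem coeff_pow_eq_zero_of_lt {g : PowerSeries 𝕜} (hg : coeff 0 g = 0) {n k : ℕ} (h : n < k) :
    coeff n (g ^ k) = 0 := by
  have : (X : PowerSeries 𝕜) ^ k ∣ g ^ k :=
    pow_dvd_pow_of_dvd (X_dvd_iff.2 (by simpa using hg)) k
  exact X_pow_dvd_iff.1 this n h

theorem coeff_subst_eq_sum_range (f : PowerSeries 𝕜) {g : PowerSeries 𝕜} (hg : coeff 0 g = 0)
    (n : ℕ) : coeff n (f.subst g) = ∑ k ∈ range (n + 1), coeff k f * coeff n (g ^ k) := by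
  rw [coeff_subst' (hasSubst_of_coeff_zero hg)]
  refine finsum_eq_finsetSum_of_support_subset _ fun k hk => ?_
  by_contra hkn
  simp only [coe_range, Set.mem_Iio, not_lt] at hkn
  exact hk (by simp [coeff_pow_eq_zero_of_lt hg (show n < k by omega)])

variable [IsUltrametricDist 𝕜]

theorem CoeffBound.add {R M : ℝ} (hR : 0 ≤ R) {a b : PowerSeries 𝕜} (ha : CoeffBound R M a)
    (hb : CoeffBound R M b) : CoeffBound R M (a + b) := fun n => by
  rw [map_add]
  calc ‖coeff n a + coeff n b‖ * R ^ n
      ≤ max ‖coeff n a‖ ‖coeff n b‖ * R ^ n := by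
        gcongr
        exact IsUltrametricDist.norm_add_le_max _ _
    _ ≤ M := by
        rcases max_cases ‖coeff n a‖ ‖coeff n b‖ with ⟨h, _⟩ | ⟨h, _⟩ <;> rw [h]
        exacts [ha n, hb n]

/-- A product of series is bounded by the product of bounds; only coefficients up to the index
under consideration matter. -/
theorem norm_coeff_mul_le {R M N : ℝ} (hR : 0 ≤ R) {a b : PowerSeries 𝕜} {n : ℕ}
    (ha : ∀ i ≤ n, ‖coeff i a‖ * R ^ i ≤ M) (hb : ∀ i ≤ n, ‖coeff i b‖ * R ^ i ≤ N) :
    ‖coeff n (a * b)‖ * R ^ n ≤ M * N := by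
  have hM : 0 ≤ M := (by positivity : 0 ≤ ‖coeff 0 a‖ * R ^ 0).trans (ha 0 (Nat.zero_le _))
  have hN : 0 ≤ N := (by positivity : 0 ≤ ‖coeff 0 b‖ * R ^ 0).trans (hb 0 (Nat.zero_le _))
  rw [coeff_mul]
  obtain ⟨⟨i, j⟩, hij, h⟩ := IsUltrametricDist.exists_norm_finsetSum_le_of_nonempty
    (t := antidiagonal n) ⟨(0, n), by simp⟩ (fun x => coeff x.1 a * coeff x.2 b)
  rw [HasAntidiagonal.mem_antidiagonal] at hij
  simp only at hij
  calc _ ≤ ‖coeff i a * coeff j b‖ * R ^ n := by gcongr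
    _ = (‖coeff i a‖ * R ^ i) * (‖coeff j b‖ * R ^ j) := by
        rw [norm_mul, ← hij, pow_add]; ring
    _ ≤ M * N := mul_le_mul (ha i (by omega)) (hb j (by omega)) (by positivity) hM

theorem CoeffBound.mul {R M N : ℝ} (hR : 0 ≤ R) {a b : PowerSeries 𝕜} (ha : CoeffBound R M a)
    (hb : CoeffBound R N b) : CoeffBound R (M * N) (a * b) := fun _ =>
  norm_coeff_mul_le hR (fun i _ => ha i) (fun i _ => hb i)

theorem norm_coeff_pow_le {R M : ℝ} (hR : 0 ≤ R) {a : PowerSeries 𝕜} {n : ℕ}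
    (ha : ∀ i ≤ n, ‖coeff i a‖ * R ^ i ≤ M) (k : ℕ) :
    ‖coeff n (a ^ k)‖ * R ^ n ≤ M ^ k := by
  induction k generalizing n with
  | zero => simpa using coeffBound_one (𝕜 := 𝕜) (R := R) n
  | succ k ih =>
    rw [pow_succ, pow_succ]
    exact norm_coeff_mul_le hR (fun i hi => ih fun j hj => ha j (hj.trans hi)) ha

theorem CoeffBound.pow {R M : ℝ} (hR : 0 ≤ R) {a : PowerSeries 𝕜} (ha : CoeffBound R M a) (k : ℕ) :
    CoeffBound R (M ^ k) (a ^ k) := fun _ => norm_coeff_pow_le hR (fun i _ => ha i) k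

theorem CoeffBound.subst {R M : ℝ} (hR : 0 < R) {f g : PowerSeries 𝕜} (hf : CoeffBound R M f)
    (hg0 : coeff 0 g = 0) (hg : CoeffBound R R g) : CoeffBound R M (f.subst g) := fun n => by
  rw [coeff_subst_eq_sum_range f hg0]
  obtain ⟨k, -, h⟩ := IsUltrametricDist.exists_norm_finsetSum_le_of_nonempty
    (t := range (n + 1)) ⟨0, by simp⟩ (fun k => coeff k f * coeff n (g ^ k))
  calc _ ≤ ‖coeff k f * coeff n (g ^ k)‖ * R ^ n := by gcongr
    _ = ‖coeff k f‖ * (‖coeff n (g ^ k)‖ * R ^ n) := by rw [norm_mul]; ring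
    _ ≤ ‖coeff k f‖ * R ^ k := by gcongr; exact hg.pow hR.le k n
    _ ≤ M := hf k

/-- Substitution is Lipschitz in the inner series. -/
theorem CoeffBound.subst_sub_subst {R M ε : ℝ} (hR : 0 < R) (hε : 0 ≤ ε) {f g h : PowerSeries 𝕜}
    (hf : CoeffBound R M f) (hg0 : coeff 0 g = 0) (hg : CoeffBound R R g)
    (hh0 : coeff 0 h = 0) (hh : CoeffBound R R h) (hgh : CoeffBound R (ε * R) (g - h)) :
    CoeffBound R (ε * M) (f.subst g - f.subst h) := fun n => by
  have key : ∀ k, CoeffBound R (ε * R ^ k) (g ^ k - h ^ k) := by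
    intro k
    induction k with
    | zero => intro i; simpa using hε
    | succ k ih =>
      have e : g ^ (k + 1) - h ^ (k + 1) = g ^ k * (g - h) + (g ^ k - h ^ k) * h := by ring
      rw [e]
      refine CoeffBound.add hR.le ?_ ?_
      · have := (hg.pow hR.le k).mul hR.le hgh
        rwa [show R ^ k * (ε * R) = ε * R ^ (k + 1) by ring] at this
      · have := ih.mul hR.le hh
        rwa [show ε * R ^ k * R = ε * R ^ (k + 1) by ring] at this
  rw [map_sub, coeff_subst_eq_sum_range f hg0, coeff_subst_eq_sum_range f hh0, ← sum_sub_distrib]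
  obtain ⟨k, -, h'⟩ := IsUltrametricDist.exists_norm_finsetSum_le_of_nonempty
    (t := range (n + 1)) ⟨0, by simp⟩
    (fun k => coeff k f * coeff n (g ^ k) - coeff k f * coeff n (h ^ k))
  calc _ ≤ ‖coeff k f * coeff n (g ^ k) - coeff k f * coeff n (h ^ k)‖ * R ^ n := by gcongr
    _ = ‖coeff k f‖ * (‖coeff n (g ^ k - h ^ k)‖ * R ^ n) := by
        rw [map_sub, ← mul_sub, norm_mul]; ring
    _ ≤ ‖coeff k f‖ * (ε * R ^ k) := mul_le_mul_of_nonneg_left (key k n) (norm_nonneg _)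
    _ = ε * (‖coeff k f‖ * R ^ k) := by ring
    _ ≤ ε * M := by gcongr; exact hf k

/-- The compositional inverse of a series with unit linear coefficient satisfies the same
coefficient bounds. -/
theorem CoeffBound.of_subst_eq_X {R : ℝ} (hR : 0 < R) {f g : PowerSeries 𝕜}
    (hf : CoeffBound R R f) (hf0 : coeff 0 f = 0) (hf1 : ‖coeff 1 f‖ = 1)
    (hg0 : coeff 0 g = 0) (hfg : f.subst g = X) : CoeffBound R R g := by
  suffices H : ∀ n, ∀ i ≤ n, ‖coeff i g‖ * R ^ i ≤ R from fun n => H n n le_rfl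
  intro n
  induction n with
  | zero =>
    intro i hi
    obtain rfl : i = 0 := by omega
    simpa [hg0] using hR.le
  | succ n ih =>
    intro i hi
    rcases Nat.lt_or_ge i (n + 1) with hlt | hge
    · exact ih i (by omega)
    obtain rfl : i = n + 1 := by omega
    -- in `g ^ (k + 2)` only coefficients of `g` of index at most `n` contribute
    have hpow : ∀ k, ‖coeff (n + 1) (g ^ (k + 2))‖ * R ^ (n + 1) ≤ R ^ (k + 2) := by
      intro k
      obtain ⟨g', hg'⟩ := X_dvd_iff.2 (show constantCoeff g = 0 by simpa using hg0)
      have hb : ∀ i ≤ n, ‖coeff i (g ^ (k + 1))‖ * R ^ i ≤ R ^ (k + 1) := fun i hi =>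
        norm_coeff_pow_le hR.le (fun j hj => ih j (hj.trans hi)) _
      rw [pow_succ, coeff_mul]
      obtain ⟨⟨i, j⟩, hij, h⟩ := IsUltrametricDist.exists_norm_finsetSum_le_of_nonempty
        (t := antidiagonal (n + 1)) ⟨(0, n + 1), by simp⟩
        (fun x => coeff x.1 (g ^ (k + 1)) * coeff x.2 g)
      rw [HasAntidiagonal.mem_antidiagonal] at hij
      simp only at hij
      refine (mul_le_mul_of_nonneg_right h (by positivity)).trans ?_
      rcases Nat.eq_zero_or_pos i with rfl | hi
      · rw [coeff_pow_eq_zero_of_lt hg0 (Nat.succ_pos k)]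
        simp only [zero_mul, norm_zero]; positivity
      rcases Nat.eq_zero_or_pos j with rfl | hj
      · rw [hg0]
        simp only [mul_zero, norm_zero, zero_mul]; positivity
      calc _ = (‖coeff i (g ^ (k + 1))‖ * R ^ i) * (‖coeff j g‖ * R ^ j) := by
            rw [norm_mul, ← hij, pow_add]; ring
        _ ≤ R ^ (k + 1) * R :=
            mul_le_mul (hb i (by omega)) (ih j (by omega)) (by positivity) (by positivity)
        _ = R ^ (k + 2) := by ring
    have hc := congrArg (coeff (n + 1)) hfg
    rw [coeff_subst_eq_sum_range f hg0, sum_range_succ', sum_range_succ'] at hc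
    simp only [zero_add, pow_one, hf0, zero_mul, add_zero] at hc
    have e : coeff 1 f * coeff (n + 1) g = coeff (n + 1) (X : PowerSeries 𝕜) +
        -∑ k ∈ range n, coeff (k + 1 + 1) f * coeff (n + 1) (g ^ (k + 1 + 1)) := by
      rw [← hc]; ring
    have e2 : ‖coeff (n + 1) g‖ = ‖coeff 1 f * coeff (n + 1) g‖ := by
      rw [norm_mul, hf1, one_mul]
    rw [e2, e]
    refine (mul_le_mul_of_nonneg_right (IsUltrametricDist.norm_add_le_max _ _)
      (by positivity)).trans ?_
    rw [max_mul_of_nonneg _ _ (by positivity), norm_neg]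
    refine max_le (coeffBound_X hR.le _) ?_
    rcases Nat.eq_zero_or_pos n with rfl | hn
    · simpa using hR.le
    obtain ⟨k, -, h⟩ := IsUltrametricDist.exists_norm_finsetSum_le_of_nonempty
      (t := range n) ⟨0, by simpa using hn⟩
      (fun k => coeff (k + 1 + 1) f * coeff (n + 1) (g ^ (k + 1 + 1)))
    calc _ ≤ ‖coeff (k + 2) f * coeff (n + 1) (g ^ (k + 2))‖ * R ^ (n + 1) := by gcongr
      _ = ‖coeff (k + 2) f‖ * (‖coeff (n + 1) (g ^ (k + 2))‖ * R ^ (n + 1)) := by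
          rw [norm_mul]; ring
      _ ≤ ‖coeff (k + 2) f‖ * R ^ (k + 2) := by gcongr; exact hpow k
      _ ≤ R := hf _

end CoeffBound

/-! ### Evaluation of power series on the closed unit disc -/

section Eval

variable {p : ℕ} [Fact p.Prime]

/-- The series converges on the closed unit disc; over `ℚ_p` this means that its coefficients tend
to `0`. -/
def ConvOnUnitDisc (f : PowerSeries ℚ_[p]) : Prop := Tendsto (fun k => coeff k f) atTop (𝓝 0)

theorem ConvOnUnitDisc.tendsto_term {f : PowerSeries ℚ_[p]} (hf : ConvOnUnitDisc f) {x : ℚ_[p]}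
    (hx : ‖x‖ ≤ 1) : Tendsto (fun k => coeff k f * x ^ k) atTop (𝓝 0) := by
  refine squeeze_zero_norm (fun k => ?_) (tendsto_norm_zero.comp hf)
  rw [norm_mul, norm_pow]
  exact mul_le_of_le_one_right (norm_nonneg _) (pow_le_one₀ (norm_nonneg _) hx)

theorem ConvOnUnitDisc.summable {f : PowerSeries ℚ_[p]} (hf : ConvOnUnitDisc f) {x : ℚ_[p]}
    (hx : ‖x‖ ≤ 1) : Summable (fun k => coeff k f * x ^ k) :=
  NonarchimedeanAddGroup.summable_of_tendsto_cofinite_zero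
    (by rw [Nat.cofinite_eq_atTop]; exact hf.tendsto_term hx)

theorem tendsto_geometric_linear {R : ℝ} (hR : 1 < R) (C : ℝ) :
    Tendsto (fun n : ℕ => C * ((n : ℝ) + 1) / R ^ n) atTop (𝓝 0) := by
  have h0 : |R⁻¹| < 1 := by
    rw [abs_of_pos (by positivity)]
    exact inv_lt_one_of_one_lt₀ hR
  have h1 := (tendsto_self_mul_const_pow_of_abs_lt_one h0).const_mul C
  have h2 := (tendsto_pow_atTop_nhds_zero_of_abs_lt_one h0).const_mul C
  have h3 := h1.add h2
  simp only [mul_zero, add_zero] at h3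
  refine h3.congr fun n => ?_
  rw [inv_pow]; field_simp

theorem ConvOnUnitDisc.of_norm_le {f : PowerSeries ℚ_[p]} {R C : ℝ} (hR : 1 < R)
    (hf : ∀ k, ‖coeff k f‖ * R ^ k ≤ C * ((k : ℝ) + 1)) : ConvOnUnitDisc f :=
  squeeze_zero_norm (fun k => by
    rw [le_div_iff₀ (by positivity)]; exact hf k) (tendsto_geometric_linear hR C)

theorem CoeffBound.convOnUnitDisc {f : PowerSeries ℚ_[p]} {R M : ℝ} (hR : 1 < R)
    (hf : CoeffBound R M f) : ConvOnUnitDisc f :=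
  .of_norm_le hR fun k => (hf k).trans (by have := hf.nonneg; nlinarith [k.cast_nonneg (α := ℝ)])

theorem ConvOnUnitDisc.add {f g : PowerSeries ℚ_[p]} (hf : ConvOnUnitDisc f)
    (hg : ConvOnUnitDisc g) : ConvOnUnitDisc (f + g) := by
  simpa [ConvOnUnitDisc] using Tendsto.add hf hg

theorem ConvOnUnitDisc.C_mul {f : PowerSeries ℚ_[p]} (c : ℚ_[p]) (hf : ConvOnUnitDisc f) :
    ConvOnUnitDisc (C c * f) := by
  simpa [ConvOnUnitDisc] using Tendsto.const_mul c hf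

theorem convOnUnitDisc_of_eventually_zero {f : PowerSeries ℚ_[p]} (N : ℕ)
    (h : ∀ k, N ≤ k → coeff k f = 0) : ConvOnUnitDisc f :=
  tendsto_const_nhds.congr' (by
    filter_upwards [eventually_ge_atTop N] with k hk using (h k hk).symm)

theorem convOnUnitDisc_C (c : ℚ_[p]) : ConvOnUnitDisc (C c) :=
  convOnUnitDisc_of_eventually_zero 1 fun k hk => by
    rw [coeff_C, if_neg (by omega)]

theorem convOnUnitDisc_X : ConvOnUnitDisc (X : PowerSeries ℚ_[p]) :=
  convOnUnitDisc_of_eventually_zero 2 fun k hk => by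
    rw [coeff_X, if_neg (by omega)]

theorem psEval_add {f g : PowerSeries ℚ_[p]} (hf : ConvOnUnitDisc f) (hg : ConvOnUnitDisc g)
    {x : ℚ_[p]} (hx : ‖x‖ ≤ 1) : psEval p (f + g) x = psEval p f x + psEval p g x := by
  simp only [psEval, map_add, add_mul]
  exact (hf.summable hx).tsum_add (hg.summable hx)

theorem psEval_C_mul (c : ℚ_[p]) (f : PowerSeries ℚ_[p]) (x : ℚ_[p]) :
    psEval p (C c * f) x = c * psEval p f x := by
  simp only [psEval, coeff_C_mul, mul_assoc]
  exact tsum_mul_left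

theorem psEval_C (c x : ℚ_[p]) : psEval p (C c) x = c := by
  rw [psEval, tsum_eq_single 0]
  · simp
  · intro k hk
    rw [coeff_C, if_neg hk, zero_mul]

theorem psEval_X (x : ℚ_[p]) : psEval p X x = x := by
  rw [psEval, tsum_eq_single 1]
  · simp
  · intro k hk
    rw [coeff_X, if_neg hk, zero_mul]

theorem psEval_mul {f g : PowerSeries ℚ_[p]} (hf : ConvOnUnitDisc f) (hg : ConvOnUnitDisc g)
    {x : ℚ_[p]} (hx : ‖x‖ ≤ 1) : psEval p (f * g) x = psEval p f x * psEval p g x := by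
  have : NonarchimedeanRing ℚ_[p] :=
    { is_nonarchimedean := NonarchimedeanAddGroup.is_nonarchimedean }
  have h := Summable.mul_of_nonarchimedean (hf.summable hx) (hg.summable hx)
  rw [psEval, psEval, psEval,
    Summable.tsum_mul_tsum_eq_tsum_sum_antidiagonal (hf.summable hx) (hg.summable hx) h]
  refine tsum_congr fun n => ?_
  rw [coeff_mul, sum_mul]
  refine sum_congr rfl fun ij hij => ?_
  rw [← mem_antidiagonal.1 hij, pow_add]; ring

theorem psEval_pow {f : PowerSeries ℚ_[p]} {R M : ℝ} (hR : 1 < R) (hf : CoeffBound R M f)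
    {x : ℚ_[p]} (hx : ‖x‖ ≤ 1) (k : ℕ) : psEval p (f ^ k) x = psEval p f x ^ k := by
  induction k with
  | zero => simpa using psEval_C (1 : ℚ_[p]) x
  | succ k ih =>
    rw [pow_succ, pow_succ, ← ih]
    exact psEval_mul ((hf.pow (by linarith) k).convOnUnitDisc hR) (hf.convOnUnitDisc hR) hx

/-- Evaluation is compatible with substitution, when both series converge beyond the closed unit
disc and the inner one preserves the larger disc. -/
theorem psEval_subst {f g : PowerSeries ℚ_[p]} {R C : ℝ} (hR : 1 < R)
    (hf : ∀ k, ‖coeff k f‖ * R ^ k ≤ C * ((k : ℝ) + 1)) (hg0 : coeff 0 g = 0)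
    (hg : CoeffBound R R g) {x : ℚ_[p]} (hx : ‖x‖ ≤ 1) :
    psEval p (f.subst g) x = psEval p f (psEval p g x) := by
  have hR0 : 0 < R := by linarith
  have hC : 0 ≤ C := by
    have := (norm_nonneg (coeff 0 f)).trans (by simpa using hf 0)
    exact this
  let F : ℕ → ℕ → ℚ_[p] := fun n k => coeff k f * coeff n (g ^ k) * x ^ n
  have hF0 : ∀ n k, n < k → F n k = 0 := fun n k h => by
    simp [F, coeff_pow_eq_zero_of_lt hg0 h]
  have hFle : ∀ n k, ‖F n k‖ ≤ C * ((n : ℝ) + 1) / R ^ n := by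
    intro n k
    rcases Nat.lt_or_ge n k with h | h
    · rw [hF0 n k h, norm_zero]; positivity
    rw [le_div_iff₀ (by positivity)]
    have hxn : ‖x‖ ^ n ≤ 1 := pow_le_one₀ (norm_nonneg _) hx
    calc ‖F n k‖ * R ^ n = ‖coeff k f‖ * (‖coeff n (g ^ k)‖ * R ^ n) * ‖x‖ ^ n := by
          simp only [F, norm_mul, norm_pow]; ring
      _ ≤ ‖coeff k f‖ * R ^ k * 1 := by
          gcongr
          exact hg.pow hR0.le k n
      _ ≤ C * ((k : ℝ) + 1) := by rw [mul_one]; exact hf k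
      _ ≤ C * ((n : ℝ) + 1) := by gcongr
  have hFs : Summable (Function.uncurry F) := by
    refine NonarchimedeanAddGroup.summable_of_tendsto_cofinite_zero ?_
    rw [NormedAddGroup.tendsto_nhds_zero]
    intro ε hε
    have h1 := (tendsto_geometric_linear hR C).eventually (gt_mem_nhds hε)
    obtain ⟨N, hN⟩ := eventually_atTop.1 h1
    rw [eventually_cofinite]
    refine ((Set.finite_lt_nat N).prod (Set.finite_lt_nat N)).subset ?_
    rintro ⟨n, k⟩ hnk
    simp only [Function.uncurry_apply_pair, Set.mem_ofPred_eq, not_lt] at hnk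
    have hn : n < N := by
      by_contra hc
      exact absurd ((hFle n k).trans_lt (hN n (by omega))) (not_lt.2 hnk)
    have hk : k ≤ n := by
      by_contra hc
      rw [hF0 n k (by omega), norm_zero] at hnk
      linarith
    exact ⟨hn, lt_of_le_of_lt hk hn⟩
  calc psEval p (f.subst g) x = ∑' n, ∑' k, F n k := by
        refine tsum_congr fun n => ?_
        rw [coeff_subst_eq_sum_range f hg0, sum_mul]
        refine (tsum_eq_sum fun k hk => ?_).symm
        exact hF0 n k (by simpa using hk)
    _ = ∑' k, ∑' n, F n k := hFs.tsum_comm.symm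
    _ = psEval p f (psEval p g x) := by
        refine tsum_congr fun k => ?_
        rw [← psEval_pow hR hg hx k, psEval, ← tsum_mul_left]
        exact tsum_congr fun n => by simp only [F]; ring

theorem norm_psEval_le {f : PowerSeries ℚ_[p]} {M : ℝ} (hM : 0 ≤ M)
    (hf : ∀ k, ‖coeff k f‖ ≤ M) {x : ℚ_[p]} (hx : ‖x‖ ≤ 1) : ‖psEval p f x‖ ≤ M := by
  refine IsUltrametricDist.norm_tsum_le_of_forall_le_of_nonneg hM fun k => ?_
  rw [norm_mul, norm_pow]
  exact (mul_le_of_le_one_right (norm_nonneg _) (pow_le_one₀ (norm_nonneg _) hx)).trans (hf k)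

end Eval

/-! ### Taylor expansion of an antiderivative -/

section Taylor

variable {p : ℕ} [Fact p.Prime]

/-- The formal antiderivative with vanishing constant coefficient; at `n = 0` the division by `0`
yields that coefficient. -/
noncomputable def antideriv (f : PowerSeries ℚ_[p]) : PowerSeries ℚ_[p] :=
  PowerSeries.mk fun n => coeff (n - 1) f / n

theorem coeff_zero_antideriv (f : PowerSeries ℚ_[p]) : coeff 0 (antideriv f) = 0 := by
  simp [antideriv]

theorem coeff_succ_antideriv (f : PowerSeries ℚ_[p]) (n : ℕ) :
    coeff (n + 1) (antideriv f) = coeff n f / (n + 1) := by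
  simp [antideriv]

theorem derivative_antideriv (f : PowerSeries ℚ_[p]) :
    derivative ℚ_[p] (antideriv f) = f := by
  ext n
  rw [coeff_derivative, coeff_succ_antideriv]
  have : (n + 1 : ℚ_[p]) ≠ 0 := by exact_mod_cast Nat.succ_ne_zero n
  field_simp

theorem inv_norm_natCast_le {n : ℕ} (hn : n ≠ 0) : ‖(n : ℚ_[p])‖⁻¹ ≤ n := by
  have h0 : (n : ℚ_[p]) ≠ 0 := by exact_mod_cast hn
  rw [Padic.norm_eq_zpow_neg_valuation h0, Padic.valuation_natCast, zpow_neg, inv_inv,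
    zpow_natCast]
  exact_mod_cast Nat.le_of_dvd (Nat.pos_of_ne_zero hn) pow_padicValNat_dvd

theorem norm_coeff_antideriv_le {f : PowerSeries ℚ_[p]} {R M : ℝ} (hR : 0 ≤ R)
    (hf : CoeffBound R M f) (k : ℕ) :
    ‖coeff k (antideriv f)‖ * R ^ k ≤ (M * R) * ((k : ℝ) + 1) := by
  have hM := hf.nonneg
  rcases k with _ | k
  · rw [coeff_zero_antideriv]; simp; positivity
  · rw [coeff_succ_antideriv, norm_div]
    have h1 : ‖((k : ℚ_[p]) + 1)‖⁻¹ ≤ (k : ℝ) + 1 := by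
      exact_mod_cast inv_norm_natCast_le (p := p) (Nat.succ_ne_zero k)
    calc _ = (‖coeff k f‖ * R ^ k) * R * ‖((k : ℚ_[p]) + 1)‖⁻¹ := by
          rw [div_eq_mul_inv, pow_succ]; ring
      _ ≤ M * R * ((k : ℝ) + 1) := by
          gcongr
          exact hf k
      _ ≤ _ := by
          push_cast
          gcongr
          linarith

/-- The binomial expansion of `∫ t ^ k` around `x` beyond the linear term. The quotients
`(k choose (j + 1)) / (j + 2)` carry the only denominators. -/
theorem add_pow_succ_sub_eq_sum (x h : ℚ_[p]) (k : ℕ) :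
    ((x + h) ^ (k + 1) - x ^ (k + 1)) / (k + 1) - x ^ k * h =
      h ^ 2 * ∑ j ∈ range k, ((k.choose (j + 1) : ℚ_[p]) / (j + 2)) * (x ^ (k - 1 - j) * h ^ j) := by
  have hk : (k + 1 : ℚ_[p]) ≠ 0 := by exact_mod_cast Nat.succ_ne_zero k
  rw [add_comm x h, add_pow, sum_range_succ', sum_range_succ']
  simp only [zero_add, pow_one, pow_zero, one_mul, Nat.sub_zero, Nat.choose_zero_right,
    Nat.choose_one_right, Nat.cast_one, mul_one, Nat.add_sub_cancel]
  have : ∑ j ∈ range k, h ^ (j + 1 + 1) * x ^ (k + 1 - (j + 1 + 1)) *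
        ((k + 1).choose (j + 1 + 1) : ℚ_[p]) =
      (k + 1) * (h ^ 2 * ∑ j ∈ range k,
        ((k.choose (j + 1) : ℚ_[p]) / (j + 2)) * (x ^ (k - 1 - j) * h ^ j)) := by
    rw [mul_sum, mul_sum]
    refine sum_congr rfl fun j hj => ?_
    have hj2 : (j + 2 : ℚ_[p]) ≠ 0 := by exact_mod_cast Nat.succ_ne_zero (j + 1)
    have hc : ((k + 1 : ℚ_[p])) * (k.choose (j + 1) : ℚ_[p]) =
        ((k + 1).choose (j + 1 + 1) : ℚ_[p]) * (j + 2) := by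
      have := Nat.add_one_mul_choose_eq k (j + 1)
      exact_mod_cast this
    rw [show k + 1 - (j + 1 + 1) = k - 1 - j by omega]
    field_simp
    linear_combination (-(h ^ (j + 2) * x ^ (k - 1 - j))) * hc
  rw [this]
  push_cast
  field_simp
  ring

/-- Second-order Taylor expansion of an antiderivative `ψ` of `φ`: the remainder beyond the
quadratic term `φ₁ h² / 2` is divisible by `2 p h²`. -/
theorem norm_taylor_antideriv_le {f : PowerSeries ℚ_[p]} (hf : ConvOnUnitDisc f)
    (hF : ConvOnUnitDisc (antideriv f)) {x h : ℚ_[p]} (hx : ‖x‖ ≤ 1) (hh : ‖h‖ ≤ 1)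
    (H : ∀ k j, 2 ≤ k → j < k →
      ‖coeff k f‖ * (‖(k.choose (j + 1) : ℚ_[p]) / (j + 2)‖ * ‖h‖ ^ j) ≤ ‖(2 * p : ℚ_[p])‖) :
    ‖psEval p (antideriv f) (x + h) - psEval p (antideriv f) x - psEval p f x * h
      - coeff 1 f * h ^ 2 / 2‖ ≤ ‖(2 * p : ℚ_[p])‖ * ‖h‖ ^ 2 := by
  have hxh : ‖x + h‖ ≤ 1 := (IsUltrametricDist.norm_add_le_max _ _).trans (max_le hx hh)
  have hshift : ∀ z : ℚ_[p], ‖z‖ ≤ 1 → HasSum (fun k => coeff k f / (k + 1) * z ^ (k + 1))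
      (psEval p (antideriv f) z) := by
    intro z hz
    have h1 := (hF.summable hz).hasSum
    have h2 := (hasSum_nat_add_iff' 1).2 h1
    simp only [range_one, sum_singleton, coeff_zero_antideriv, zero_mul, sub_zero,
      coeff_succ_antideriv] at h2
    exact h2
  have h3 := (((hshift _ hxh).sub (hshift _ hx)).sub ((hf.summable hx).hasSum.mul_right h)).sub
    (hasSum_ite_eq (1 : ℕ) (coeff 1 f * h ^ 2 / 2))
  rw [show psEval p f x = ∑' k, coeff k f * x ^ k from rfl, ← h3.tsum_eq]
  refine IsUltrametricDist.norm_tsum_le_of_forall_le_of_nonneg (by positivity) fun k => ?_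
  have e : coeff k f / (k + 1) * (x + h) ^ (k + 1) - coeff k f / (k + 1) * x ^ (k + 1)
      - coeff k f * x ^ k * h =
      coeff k f * (h ^ 2 * ∑ j ∈ range k,
        ((k.choose (j + 1) : ℚ_[p]) / (j + 2)) * (x ^ (k - 1 - j) * h ^ j)) := by
    rw [← add_pow_succ_sub_eq_sum]; ring
  rw [e]
  rcases Nat.lt_or_ge k 2 with hk | hk
  · interval_cases k
    · simp; positivity
    · have : (coeff 1 f * (h ^ 2 * ∑ j ∈ range 1,
          (((1 : ℕ).choose (j + 1) : ℚ_[p]) / (j + 2)) * (x ^ (1 - 1 - j) * h ^ j)) -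
          if 1 = 1 then coeff 1 f * h ^ 2 / 2 else 0) = 0 := by
        rw [sum_range_one]; norm_num; ring
      rw [this, norm_zero]; positivity
  · rw [if_neg (by omega), sub_zero, mul_left_comm, norm_mul, norm_pow, mul_comm]
    gcongr
    rw [mul_sum]
    refine IsUltrametricDist.norm_sum_le_of_forall_le_of_nonneg (norm_nonneg _) fun j hj => ?_
    refine le_trans ?_ (H k j hk (mem_range.1 hj))
    rw [norm_mul, norm_mul, norm_mul, norm_pow, norm_pow]
    gcongr
    exact mul_le_of_le_one_left (by positivity) (pow_le_one₀ (norm_nonneg _) hx)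

theorem norm_pow_sub_pow_le {x y : ℚ_[p]} (hx : ‖x‖ ≤ 1) (hy : ‖y‖ ≤ 1) (k : ℕ) :
    ‖x ^ k - y ^ k‖ ≤ ‖x - y‖ := by
  induction k with
  | zero => simp
  | succ k ih =>
    have e : x ^ (k + 1) - y ^ (k + 1) = x ^ k * (x - y) + (x ^ k - y ^ k) * y := by ring
    rw [e]
    refine (IsUltrametricDist.norm_add_le_max _ _).trans (max_le ?_ ?_)
    · rw [norm_mul, norm_pow]
      exact mul_le_of_le_one_left (norm_nonneg _) (pow_le_one₀ (norm_nonneg _) hx)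
    · rw [norm_mul]
      exact (mul_le_of_le_one_right (norm_nonneg _) hy).trans ih

/-- A series whose linear coefficient dominates the later ones is an isometry of the closed unit
disc. -/
theorem norm_psEval_sub_eq {f : PowerSeries ℚ_[p]} (hf : ConvOnUnitDisc f)
    (h1 : ‖coeff 1 f‖ = 1) (h2 : ∀ k, 2 ≤ k → ‖coeff k f‖ ≤ (p : ℝ)⁻¹)
    {x y : ℚ_[p]} (hx : ‖x‖ ≤ 1) (hy : ‖y‖ ≤ 1) :
    ‖psEval p f x - psEval p f y‖ = ‖x - y‖ := by
  have hp1 : (1 : ℝ) < p := by exact_mod_cast (Fact.out : p.Prime).one_lt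
  have hs := ((hf.summable hx).hasSum.sub (hf.summable hy).hasSum).sub
    (hasSum_ite_eq (1 : ℕ) (coeff 1 f * (x - y)))
  have hle : ‖psEval p f x - psEval p f y - coeff 1 f * (x - y)‖ ≤ (p : ℝ)⁻¹ * ‖x - y‖ := by
    rw [show psEval p f x = ∑' k, coeff k f * x ^ k from rfl,
      show psEval p f y = ∑' k, coeff k f * y ^ k from rfl, ← hs.tsum_eq]
    refine IsUltrametricDist.norm_tsum_le_of_forall_le_of_nonneg (by positivity) fun k => ?_
    rw [← mul_sub]
    rcases Nat.lt_or_ge k 2 with hk | hk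
    · interval_cases k
      · simp; positivity
      · simp; positivity
    · rw [if_neg (by omega), sub_zero, norm_mul]
      gcongr
      exacts [h2 k hk, norm_pow_sub_pow_le hx hy k]
  rcases eq_or_ne x y with rfl | hxy
  · simp
  have hpos : 0 < ‖x - y‖ := norm_pos_iff.2 (sub_ne_zero.2 hxy)
  have e : ‖coeff 1 f * (x - y)‖ = ‖x - y‖ := by rw [norm_mul, h1, one_mul]
  have hlt : (p : ℝ)⁻¹ * ‖x - y‖ < ‖x - y‖ := by
    have := inv_lt_one_of_one_lt₀ hp1
    nlinarith
  have : ‖psEval p f x - psEval p f y‖ =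
      ‖(psEval p f x - psEval p f y - coeff 1 f * (x - y)) + coeff 1 f * (x - y)‖ := by
    congr 1; ring
  rw [this, IsUltrametricDist.norm_add_eq_max_of_norm_ne_norm, e]
  · exact max_eq_right (hle.trans hlt.le)
  · rw [e]; exact (hle.trans_lt hlt).ne

end Taylor

/-! ### Binomial series -/

section Binomial

theorem succ_mul_ringChoose_succ (s : ℚ) (k : ℕ) :
    ((k : ℚ) + 1) * Ring.choose s (k + 1) = (s - k) * Ring.choose s k := by
  have h1 := Ring.descPochhammer_eq_factorial_smul_choose s k
  have h2 := Ring.descPochhammer_eq_factorial_smul_choose s (k + 1)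
  rw [descPochhammer_succ_right, Polynomial.smeval_mul, h1, Nat.factorial_succ] at h2
  have hk : (k.factorial : ℚ) ≠ 0 := by exact_mod_cast k.factorial_ne_zero
  simp only [nsmul_eq_mul, Polynomial.smeval_sub, Polynomial.smeval_X, Polynomial.smeval_natCast,
    pow_one, pow_zero, Nat.cast_mul, mul_one] at h2
  push_cast at h2
  apply mul_left_cancel₀ hk
  linear_combination -h2

theorem factorial_mul_ringChoose (s : ℚ) (k : ℕ) :
    (k.factorial : ℚ) * Ring.choose s k = ∏ i ∈ range k, (s - i) := by
  induction k with
  | zero => simp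
  | succ k ih =>
    rw [prod_range_succ, ← ih, Nat.factorial_succ]
    push_cast
    linear_combination (k.factorial : ℚ) * succ_mul_ringChoose_succ s k

variable {p : ℕ} [Fact p.Prime]

theorem coeff_onePlusPow (c : ℚ_[p]) (s : ℚ) (k : ℕ) :
    coeff k (onePlusPow p c s) = c ^ k * ((Ring.choose s k : ℚ) : ℚ_[p]) := by
  rw [onePlusPow, coeff_rescale, binomialSeries_coeff, Rat.smul_def, mul_one]

theorem coeff_zero_onePlusPow (c : ℚ_[p]) (s : ℚ) : coeff 0 (onePlusPow p c s) = 1 := by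
  simp [coeff_onePlusPow]

/-- The differential equation `(1 + c t) F' = s c F` of `F = (1 + c t) ^ s`. -/
theorem one_add_mul_derivative_onePlusPow (c : ℚ_[p]) (s : ℚ) :
    (1 + C c * X) * derivative ℚ_[p] (onePlusPow p c s) =
      C ((s : ℚ_[p]) * c) * onePlusPow p c s := by
  ext n
  have key := congrArg (fun t : ℚ => (t : ℚ_[p])) (succ_mul_ringChoose_succ s n)
  push_cast at key
  rw [add_mul, one_mul, map_add, mul_assoc, coeff_C_mul, coeff_C_mul, coeff_derivative,
    coeff_onePlusPow, coeff_onePlusPow]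
  rcases n with _ | n
  · rw [coeff_zero_X_mul]
    simp only [CharP.cast_eq_zero, zero_add] at key ⊢
    linear_combination c * key
  · rw [coeff_succ_X_mul, coeff_derivative, coeff_onePlusPow]
    push_cast at key ⊢
    linear_combination c ^ (n + 2) * key

/-- The only solution of `(1 + c t) H' = c H` with `H(0) = 1` is `1 + c t`. -/
theorem eq_one_add_of_ode {c : ℚ_[p]} {H : PowerSeries ℚ_[p]} (h0 : coeff 0 H = 1)
    (h : (1 + C c * X) * derivative ℚ_[p] H = C c * H) : H = 1 + C c * X := by
  have hrec : ∀ n, coeff n ((1 + C c * X) * derivative ℚ_[p] H) = coeff n (C c * H) :=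
    fun n => by rw [h]
  have h1 : coeff 1 H = c := by
    have := hrec 0
    rw [add_mul, one_mul, map_add, mul_assoc, coeff_C_mul, coeff_C_mul, coeff_derivative,
      coeff_zero_X_mul, h0] at this
    simpa using this
  have hge : ∀ n, coeff (n + 2) H = 0 := by
    intro n
    have hn2 : ((n : ℚ_[p]) + 1 + 1) ≠ 0 := by exact_mod_cast Nat.succ_ne_zero (n + 1)
    have := hrec (n + 1)
    rw [add_mul, one_mul, map_add, mul_assoc, coeff_C_mul, coeff_C_mul, coeff_derivative,
      coeff_succ_X_mul, coeff_derivative] at this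
    push_cast at this
    induction n with
    | zero =>
      have h2 : coeff 2 H * 2 = 0 := by
        simp only [zero_add, h1, CharP.cast_eq_zero] at this
        linear_combination this
      simpa using h2
    | succ n ih =>
      have hprev : coeff (n + 2) H = 0 := by
        refine ih (by exact_mod_cast Nat.succ_ne_zero (n + 1)) ?_
        have := hrec (n + 1)
        rw [add_mul, one_mul, map_add, mul_assoc, coeff_C_mul, coeff_C_mul, coeff_derivative,
          coeff_succ_X_mul, coeff_derivative] at this
        push_cast at this
        exact this
      rw [show n + 1 + 1 = n + 2 from rfl, hprev] at this
      have h3 : coeff (n + 1 + 2) H * ((n : ℚ_[p]) + 1 + 1 + 1) = 0 := by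
        push_cast at this
        linear_combination this
      push_cast at hn2
      exact (mul_eq_zero.1 h3).resolve_right hn2
  ext n
  rw [map_add, coeff_C_mul, coeff_one, coeff_X]
  rcases n with _ | _ | n
  · simp [h0]
  · simp [h1]
  · simp [hge n]

/-- `((1 + c t) ^ s - 1) / d`. -/
noncomputable def scaledPow (p : ℕ) [Fact p.Prime] (c d : ℚ_[p]) (s : ℚ) : PowerSeries ℚ_[p] :=
  C d⁻¹ * (onePlusPow p c s - 1)

theorem coeff_zero_scaledPow (c d : ℚ_[p]) (s : ℚ) : coeff 0 (scaledPow p c d s) = 0 := by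
  rw [scaledPow, coeff_C_mul, map_sub, coeff_zero_onePlusPow]; simp

theorem coeff_scaledPow (c d : ℚ_[p]) (s : ℚ) {k : ℕ} (hk : k ≠ 0) :
    coeff k (scaledPow p c d s) = d⁻¹ * (c ^ k * ((Ring.choose s k : ℚ) : ℚ_[p])) := by
  rw [scaledPow, coeff_C_mul, map_sub, coeff_onePlusPow, coeff_one, if_neg hk, sub_zero]

/-- The series `((1 + c t) ^ s - 1) / d` and `((1 + d t) ^ (1/s) - 1) / c` are compositional
inverses: both sides of `(1 + d φ₀) ^ (1/s) = 1 + c t` solve the same differential equation. -/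
theorem scaledPow_inv_subst {c d : ℚ_[p]} (hc : c ≠ 0) (hd : d ≠ 0) {s : ℚ} (hs : s ≠ 0) :
    (scaledPow p d c s⁻¹).subst (scaledPow p c d s) = X := by
  have hsp : (s : ℚ_[p]) ≠ 0 := by exact_mod_cast hs
  set φ := scaledPow p c d s with hφ
  have hφ0 : coeff 0 φ = 0 := coeff_zero_scaledPow c d s
  have hsub : HasSubst φ := hasSubst_of_coeff_zero hφ0
  set A := onePlusPow p c s with hA
  set B := onePlusPow p d s⁻¹ with hB
  have hCd : (C d : PowerSeries ℚ_[p]) * C d⁻¹ = 1 := by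
    rw [← map_mul, mul_inv_cancel₀ hd, map_one]
  have hCc : (C c : PowerSeries ℚ_[p]) * C c⁻¹ = 1 := by
    rw [← map_mul, mul_inv_cancel₀ hc, map_one]
  have hAφ : 1 + C d * φ = A := by
    rw [hφ, scaledPow, ← mul_assoc, hCd]; ring
  have hA0 : A ≠ 0 := fun h => by
    have := coeff_zero_onePlusPow c s
    rw [← hA, h] at this
    simp at this
  set H := B.subst φ with hH
  have hsubC : ∀ (a : ℚ_[p]) (F : PowerSeries ℚ_[p]), (C a * F).subst φ = C a * F.subst φ := by
    intro a F
    rw [subst_mul hsub, subst_C]; rfl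
  have h1 : (1 : PowerSeries ℚ_[p]).subst φ = (1 : PowerSeries ℚ_[p]) := by
    simpa using subst_C (a := φ) (1 : ℚ_[p])
  have hode : A * (derivative ℚ_[p] B).subst φ = C ((s : ℚ_[p])⁻¹ * d) * H := by
    have h := congrArg (fun F => F.subst φ) (one_add_mul_derivative_onePlusPow d s⁻¹)
    rw [subst_mul hsub, hsubC, subst_add hsub, hsubC, subst_X hsub, ← hB, ← hH] at h
    rw [h1, hAφ] at h
    rw [h]
    push_cast
    rfl
  have hA' := one_add_mul_derivative_onePlusPow c s
  rw [← hA] at hA'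
  have hφ' : derivative ℚ_[p] φ = C d⁻¹ * derivative ℚ_[p] A := by
    rw [hφ, scaledPow, Derivation.leibniz, derivative_C, map_sub, derivative_one]
    simp [hA]
  have hH' : derivative ℚ_[p] H = (derivative ℚ_[p] B).subst φ * derivative ℚ_[p] φ :=
    derivative_subst hsub
  have hfin : (1 + C c * X) * derivative ℚ_[p] H = C c * H := by
    apply mul_left_cancel₀ hA0
    calc A * ((1 + C c * X) * derivative ℚ_[p] H)
        = (A * (derivative ℚ_[p] B).subst φ) * C d⁻¹ *
            ((1 + C c * X) * derivative ℚ_[p] A) := by rw [hH', hφ']; ring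
      _ = C ((s : ℚ_[p])⁻¹ * d) * C d⁻¹ * C ((s : ℚ_[p]) * c) * (H * A) := by
          rw [hode, hA']; ring
      _ = C c * (H * A) := by
          rw [← map_mul, ← map_mul]
          congr 2
          field_simp
      _ = A * (C c * H) := by ring
  have hH0 : coeff 0 H = 1 := by
    rw [hH, coeff_subst_eq_sum_range B hφ0]
    simp [hB, coeff_zero_onePlusPow]
  have hHX := eq_one_add_of_ode hH0 hfin
  rw [scaledPow, hsubC, subst_sub hsub, h1, ← hB, ← hH, hHX]
  linear_combination X * hCc

end Binomial

/-! ### Norms of binomial coefficients -/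

section BinomialNorm

variable {p : ℕ}

theorem iotaP_inv (y : ℚ) : iotaP p y⁻¹ = iotaP' p y := by
  rw [iotaP, iotaP', inv_inv]

theorem iotaP'_inv (y : ℚ) : iotaP' p y⁻¹ = iotaP p y := rfl

variable [hp : Fact p.Prime]

theorem one_lt_natCast_prime : (1 : ℝ) < p := by exact_mod_cast hp.out.one_lt

theorem padicValRat_eq_iotaP'_sub_iotaP (y : ℚ) :
    padicValRat p y = (iotaP' p y : ℤ) - iotaP p y := by
  rw [iotaP, iotaP', padicValRat.inv]; omega

theorem rhoP_pos : 0 < rhoP p := by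
  have := one_lt_natCast_prime (p := p)
  exact one_div_pos.2 (by linarith)

theorem rhoP_mul : rhoP p * ((p : ℝ) - 1) = 1 := by
  have := one_lt_natCast_prime (p := p)
  rw [rhoP]; field_simp [show (p : ℝ) - 1 ≠ 0 by linarith]

theorem rhoAt_nonneg (y : ℚ) : 0 ≤ rhoAt p y := by
  rw [rhoAt]; split_ifs
  exacts [le_rfl, rhoP_pos.le]

theorem rhoAt_le (y : ℚ) : rhoAt p y ≤ rhoP p := by
  rw [rhoAt]; split_ifs
  exacts [rhoP_pos.le, le_rfl]

theorem rhoAt_inv (y : ℚ) : rhoAt p y⁻¹ = rhoAt p y := by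
  simp [rhoAt, padicValRat.inv]

theorem norm_ratCast_eq {y : ℚ} (hy : y ≠ 0) :
    ‖(y : ℚ_[p])‖ = (p : ℝ) ^ ((iotaP p y : ℝ) - iotaP' p y) := by
  rw [Padic.norm_eq_zpow_neg_valuation (by exact_mod_cast hy), Padic.valuation_ratCast,
    padicValRat_eq_iotaP'_sub_iotaP, ← Real.rpow_intCast]
  push_cast
  congr 1; ring

/-- Norms of `p`-adic numbers are integral powers of `p`. -/
theorem norm_le_zpow_of_le_rpow {x : ℚ_[p]} {t : ℝ} {a : ℤ} (hx : ‖x‖ ≤ (p : ℝ) ^ (-t))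
    (ha : (a : ℝ) - 1 < t) : ‖x‖ ≤ (p : ℝ) ^ (-a) := by
  rw [Padic.norm_le_pow_iff_norm_lt_pow_add_one, ← Real.rpow_intCast]
  refine hx.trans_lt (Real.rpow_lt_rpow_of_exponent_lt one_lt_natCast_prime ?_)
  push_cast
  linarith

/-- Legendre's formula gives `ord_p k! ≤ (k - 1) / (p - 1)`. -/
theorem inv_norm_factorial_le {k : ℕ} (hk : 1 ≤ k) :
    ‖((k.factorial : ℕ) : ℚ_[p])‖⁻¹ ≤ (p : ℝ) ^ (rhoP p * ((k : ℝ) - 1)) := by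
  have h0 : ((k.factorial : ℕ) : ℚ_[p]) ≠ 0 := by exact_mod_cast k.factorial_ne_zero
  rw [Padic.norm_eq_zpow_neg_valuation h0, Padic.valuation_natCast, zpow_neg, inv_inv,
    zpow_natCast, ← Real.rpow_natCast]
  refine Real.rpow_le_rpow_of_exponent_le one_lt_natCast_prime.le ?_
  have h1 := sub_one_mul_padicValNat_factorial_lt_of_ne_zero p (n := k) (by omega)
  have h2 : ((p : ℝ) - 1) * padicValNat p k.factorial ≤ (k : ℝ) - 1 := by
    have : (p - 1) * padicValNat p k.factorial + 1 ≤ k := h1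
    have h3 := (Nat.cast_le (α := ℝ)).2 this
    push_cast [Nat.cast_sub hp.out.one_lt.le] at h3
    linarith
  calc (padicValNat p k.factorial : ℝ)
      = rhoP p * (((p : ℝ) - 1) * padicValNat p k.factorial) := by
        rw [← mul_assoc, rhoP_mul, one_mul]
    _ ≤ _ := by gcongr; exact rhoP_pos.le

theorem norm_ringChoose_le_one {s : ℚ} (hs : ‖(s : ℚ_[p])‖ ≤ 1) (k : ℕ) :
    ‖((Ring.choose s k : ℚ) : ℚ_[p])‖ ≤ 1 := by
  have h1 : ((Ring.choose s k : ℚ) : ℚ_[p]) = Ring.choose (s : ℚ_[p]) k := by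
    simpa using Ring.map_choose (Rat.castHom ℚ_[p]) s k
  let z : ℤ_[p] := ⟨s, hs⟩
  have h2 : ((Ring.choose z k : ℤ_[p]) : ℚ_[p]) = Ring.choose (s : ℚ_[p]) k :=
    Ring.map_choose (PadicInt.Coe.ringHom (p := p)) z k
  rw [h1, ← h2]
  exact PadicInt.norm_le_one _

/-- Without a denominator or numerator in `y` at `p` the binomial coefficients are integral. In
general the factor `-y` of the numerator has order `ι' - ι`, the other factors have order at least
`-ι`, and the factorial costs at most `(k - 1) ρ_p`. -/
theorem norm_ringChoose_neg_le {y : ℚ} (hy : y ≠ 0) {k : ℕ} (hk : 1 ≤ k) :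
    ‖((Ring.choose (-y) k : ℚ) : ℚ_[p])‖ ≤
      (p : ℝ) ^ ((iotaP p y : ℝ) * k - iotaP' p y + rhoAt p y * ((k : ℝ) - 1)) := by
  have hp0 : (0 : ℝ) < p := by linarith [one_lt_natCast_prime (p := p)]
  have hny := norm_ratCast_eq (p := p) hy
  by_cases hv : padicValRat p y = 0
  · have hi : iotaP p y = 0 := by simp [iotaP, padicValRat.inv, hv]
    have hi' : iotaP' p y = 0 := by simp [iotaP', hv]
    rw [hi, hi'] at hny
    simp only [CharP.cast_eq_zero, sub_self, Real.rpow_zero] at hny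
    simp only [rhoAt, hv, if_true, hi, hi']
    simp only [CharP.cast_eq_zero, zero_mul, sub_zero, add_zero, Real.rpow_zero]
    exact norm_ringChoose_le_one (by push_cast; rw [norm_neg]; exact hny.le) k
  · simp only [rhoAt, hv, if_false]
    have hfac := congrArg (fun t : ℚ => ‖(t : ℚ_[p])‖) (factorial_mul_ringChoose (-y) k)
    push_cast at hfac
    rw [norm_mul, norm_prod] at hfac
    have hprod : ∏ i ∈ range k, ‖(-(y : ℚ_[p]) - i)‖ ≤
        (p : ℝ) ^ ((iotaP p y : ℝ) * k - iotaP' p y) := by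
      obtain ⟨k, rfl⟩ : ∃ m, k = m + 1 := ⟨k - 1, by omega⟩
      rw [prod_range_succ']
      have h1 : ∏ i ∈ range k, ‖(-(y : ℚ_[p]) - (i + 1 : ℕ))‖ ≤ ((p : ℝ) ^ (iotaP p y : ℝ)) ^ k := by
        rw [← card_range k, ← prod_const, card_range]
        refine prod_le_prod (fun _ _ => norm_nonneg _) fun i _ => ?_
        rw [sub_eq_add_neg]
        refine (IsUltrametricDist.norm_add_le_max _ _).trans (max_le ?_ ?_)
        · rw [norm_neg, hny]
          refine Real.rpow_le_rpow_of_exponent_le one_lt_natCast_prime.le ?_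
          linarith [(iotaP' p y).cast_nonneg (α := ℝ)]
        · rw [norm_neg]
          refine (show ‖((i + 1 : ℕ) : ℚ_[p])‖ ≤ 1 by
            simpa using Padic.norm_int_le_one (p := p) (i + 1 : ℕ)).trans ?_
          exact Real.one_le_rpow one_lt_natCast_prime.le (Nat.cast_nonneg _)
      calc _ ≤ ((p : ℝ) ^ (iotaP p y : ℝ)) ^ k * (p : ℝ) ^ ((iotaP p y : ℝ) - iotaP' p y) := by
            gcongr
            simp [hny]
        _ = _ := by
            rw [← Real.rpow_mul_natCast hp0.le, ← Real.rpow_add hp0]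
            congr 1; push_cast; ring
    have h0 : ‖((k.factorial : ℕ) : ℚ_[p])‖ ≠ 0 :=
      norm_ne_zero_iff.2 (by exact_mod_cast k.factorial_ne_zero)
    calc _ = (∏ i ∈ range k, ‖(-(y : ℚ_[p]) - i)‖) * ‖((k.factorial : ℕ) : ℚ_[p])‖⁻¹ := by
          rw [← hfac]; field_simp
      _ ≤ (p : ℝ) ^ ((iotaP p y : ℝ) * k - iotaP' p y) *
            (p : ℝ) ^ (rhoP p * ((k : ℝ) - 1)) := by
          gcongr
          exact inv_norm_factorial_le hk
      _ = _ := by rw [← Real.rpow_add hp0]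

/-- The coefficients of the normalised series `((1 + p^(ι+κ) ω t)^(-y) - 1) / (p^(ι'+κ) ω')`. -/
theorem norm_coeff_scaledPow_le {y : ℚ} (hy : y ≠ 0) {κ : ℕ} {c d : ℚ_[p]}
    (hc : ‖c‖ = (p : ℝ) ^ (-((iotaP p y : ℝ) + κ))) (hd : ‖d‖ = (p : ℝ) ^ (-((iotaP' p y : ℝ) + κ)))
    {k : ℕ} (hk : 1 ≤ k) :
    ‖coeff k (scaledPow p c d (-y))‖ ≤ (p : ℝ) ^ (-(((k : ℝ) - 1) * (κ - rhoAt p y))) := by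
  have hp0 : (0 : ℝ) < p := by linarith [one_lt_natCast_prime (p := p)]
  rw [coeff_scaledPow _ _ _ (by omega), norm_mul, norm_mul, norm_inv, norm_pow, hc, hd,
    Real.rpow_neg hp0.le, inv_inv, ← Real.rpow_mul_natCast hp0.le]
  refine (mul_le_mul_of_nonneg_left (mul_le_mul_of_nonneg_left (norm_ringChoose_neg_le hy hk)
    (by positivity)) (by positivity)).trans_eq ?_
  rw [← Real.rpow_add hp0, ← Real.rpow_add hp0]
  congr 1; ring

theorem norm_coeff_one_scaledPow {y : ℚ} (hy : y ≠ 0) {κ : ℕ} {c d : ℚ_[p]}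
    (hc : ‖c‖ = (p : ℝ) ^ (-((iotaP p y : ℝ) + κ)))
    (hd : ‖d‖ = (p : ℝ) ^ (-((iotaP' p y : ℝ) + κ))) :
    ‖coeff 1 (scaledPow p c d (-y))‖ = 1 := by
  have hp0 : (0 : ℝ) < p := by linarith [one_lt_natCast_prime (p := p)]
  rw [coeff_scaledPow _ _ _ one_ne_zero, norm_mul, norm_mul, norm_inv, norm_pow, hc, hd,
    Real.rpow_neg hp0.le, inv_inv, Ring.choose_one_right]
  push_cast
  rw [norm_neg, norm_ratCast_eq hy, pow_one, ← Real.rpow_add hp0, ← Real.rpow_add hp0]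
  convert Real.rpow_zero (p : ℝ) using 2
  ring

/-- On the disc of radius `p ^ μ` with `μ ≤ κ - ρ_p(y)` the normalised series is bounded by the
radius. -/
theorem coeffBound_scaledPow {y : ℚ} (hy : y ≠ 0) {κ : ℕ} {c d : ℚ_[p]}
    (hc : ‖c‖ = (p : ℝ) ^ (-((iotaP p y : ℝ) + κ)))
    (hd : ‖d‖ = (p : ℝ) ^ (-((iotaP' p y : ℝ) + κ))) {μ : ℝ} (hμ : μ ≤ κ - rhoAt p y) :
    CoeffBound ((p : ℝ) ^ μ) ((p : ℝ) ^ μ) (scaledPow p c d (-y)) := fun k => by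
  have hp0 : (0 : ℝ) < p := by linarith [one_lt_natCast_prime (p := p)]
  rcases Nat.eq_zero_or_pos k with rfl | hk
  · rw [coeff_zero_scaledPow]; simp; positivity
  have hk1 : (1 : ℝ) ≤ k := by exact_mod_cast hk
  refine (mul_le_mul_of_nonneg_right (norm_coeff_scaledPow_le hy hc hd hk) (by positivity)).trans ?_
  rw [← Real.rpow_mul_natCast hp0.le, ← Real.rpow_add hp0]
  refine Real.rpow_le_rpow_of_exponent_le one_lt_natCast_prime.le ?_
  nlinarith

end BinomialNorm

/-! ### The normalised derivative of a phase and its compositional inverse -/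

section Phase

variable {p : ℕ} [hp : Fact p.Prime]

/-- The shape of the normalised derivative `φ` of a phase in the class `F(w, y, κ, λ, u)`: a power
function normalised to have unit linear coefficient, plus a small perturbation `E`. -/
structure NormalisedDeriv (p : ℕ) [Fact p.Prime] (y : ℚ) (κ : ℕ) (lam : ℝ) (u : ℕ)
    (ω ω' : ℤ_[p]ˣ) (φ E : PowerSeries ℚ_[p]) : Prop where
  eq_add : φ = scaledPow p ((p : ℚ_[p]) ^ (iotaP p y + κ) * ((ω : ℤ_[p]) : ℚ_[p]))
    ((p : ℚ_[p]) ^ (iotaP' p y + κ) * (((ω'⁻¹ : ℤ_[p]ˣ) : ℤ_[p]) : ℚ_[p])) (-y) + E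
  coeff_zero : coeff 0 E = 0
  norm_le : ∀ k, 1 ≤ k →
    ‖coeff k E‖ ≤ (p : ℝ) ^ (-((u : ℤ) - κ - iotaP' p y + ⌈(k : ℝ) * lam⌉))

theorem norm_unit_coe (ω : ℤ_[p]ˣ) : ‖((ω : ℤ_[p]) : ℚ_[p])‖ = 1 := by
  rw [← PadicInt.norm_def]; exact PadicInt.norm_units ω

theorem unit_coe_ne_zero (ω : ℤ_[p]ˣ) : ((ω : ℤ_[p]) : ℚ_[p]) ≠ 0 := by
  rw [← norm_ne_zero_iff, norm_unit_coe]; exact one_ne_zero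

theorem unit_coe_mul_inv (ω : ℤ_[p]ˣ) :
    ((ω : ℤ_[p]) : ℚ_[p]) * (((ω⁻¹ : ℤ_[p]ˣ) : ℤ_[p]) : ℚ_[p]) = 1 := by
  rw [← PadicInt.coe_mul, Units.mul_inv, PadicInt.coe_one]

theorem natCast_prime_ne_zero : (p : ℚ_[p]) ≠ 0 := by exact_mod_cast hp.out.ne_zero

theorem norm_pow_mul_unit (a b : ℕ) (ω : ℤ_[p]ˣ) :
    ‖(p : ℚ_[p]) ^ (a + b) * ((ω : ℤ_[p]) : ℚ_[p])‖ = (p : ℝ) ^ (-((a : ℝ) + b)) := by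
  rw [norm_mul, norm_unit_coe, mul_one, Padic.norm_p_pow, ← Real.rpow_intCast]
  push_cast; rfl

/-- The derivative of a phase, with its constant coefficient split off, is `p^(w+κ+ι')` times a
normalised derivative. -/
theorem exists_normalisedDeriv {w : ℤ} {y : ℚ} {κ : ℕ} {lam : ℝ} {u : ℕ}
    {f : PowerSeries ℚ_[p]} (hf : f ∈ ClassF p w y κ lam u) :
    ∃ (ω ω' : ℤ_[p]ˣ) (c₀ : ℤ_[p]) (φ E : PowerSeries ℚ_[p]),
      NormalisedDeriv p y κ lam u ω ω' φ E ∧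
      derivative ℚ_[p] f = C ((p : ℚ_[p]) ^ w * (c₀ : ℚ_[p])) +
        C ((p : ℚ_[p]) ^ (w + κ + iotaP' p y)) * φ := by
  obtain ⟨-, ω, ω', γ₀, g, hg, hder⟩ := hf
  have hp0 := natCast_prime_ne_zero (p := p)
  have hpR : (0 : ℝ) < p := by linarith [one_lt_natCast_prime (p := p)]
  obtain ⟨g₀, hg₀⟩ : ∃ g₀ : ℤ_[p], (g₀ : ℚ_[p]) = coeff 0 g := ⟨⟨coeff 0 g, hg.1.1 0⟩, rfl⟩
  set c := (p : ℚ_[p]) ^ (iotaP p y + κ) * ((ω : ℤ_[p]) : ℚ_[p]) with hc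
  set d := (p : ℚ_[p]) ^ (iotaP' p y + κ) * (((ω'⁻¹ : ℤ_[p]ˣ) : ℤ_[p]) : ℚ_[p]) with hd
  set E : PowerSeries ℚ_[p] :=
    C ((p : ℚ_[p]) ^ ((u : ℤ) - κ - iotaP' p y)) * (g - C (coeff 0 g)) with hE
  refine ⟨ω, ω', (ω' : ℤ_[p]) + γ₀ + (p : ℤ_[p]) ^ u * g₀, scaledPow p c d (-y) + E, E,
    ⟨rfl, ?_, fun k hk => ?_⟩, ?_⟩
  · rw [hE, coeff_C_mul, map_sub, coeff_zero_C, sub_self, mul_zero]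
  · rw [hE, coeff_C_mul, map_sub, coeff_C, if_neg (by omega), sub_zero, norm_mul,
      Padic.norm_p_zpow, neg_add, zpow_add₀ hpR.ne']
    gcongr
    exact hg.2 k
  · have hcoe : (((ω' : ℤ_[p]) + γ₀ + (p : ℤ_[p]) ^ u * g₀ : ℤ_[p]) : ℚ_[p]) =
        ((ω' : ℤ_[p]) : ℚ_[p]) + γ₀ + (p : ℚ_[p]) ^ u * coeff 0 g := by
      push_cast; rw [hg₀]
    have h1 : (p : ℚ_[p]) ^ (w + κ + iotaP' p y) * d⁻¹ =
        (p : ℚ_[p]) ^ w * ((ω' : ℤ_[p]) : ℚ_[p]) := by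
      have e : (p : ℚ_[p]) ^ (w + κ + iotaP' p y) =
          (p : ℚ_[p]) ^ w * (p : ℚ_[p]) ^ (iotaP' p y + κ) := by
        rw [← zpow_natCast, ← zpow_add₀ hp0]; congr 1; push_cast; ring
      have hu := unit_coe_mul_inv ω'
      have hdne : d ≠ 0 := by
        rw [hd]; exact mul_ne_zero (pow_ne_zero _ hp0) (unit_coe_ne_zero _)
      rw [e, mul_inv_eq_iff_eq_mul₀ hdne, hd]
      linear_combination (-((p : ℚ_[p]) ^ w * (p : ℚ_[p]) ^ (iotaP' p y + κ))) * hu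
    have h2 : (p : ℚ_[p]) ^ (w + κ + iotaP' p y) * (p : ℚ_[p]) ^ ((u : ℤ) - κ - iotaP' p y) =
        (p : ℚ_[p]) ^ ((u : ℤ) + w) := by
      rw [← zpow_add₀ hp0]; congr 1; ring
    have h3 : (p : ℚ_[p]) ^ ((u : ℤ) + w) = (p : ℚ_[p]) ^ w * (p : ℚ_[p]) ^ u := by
      rw [add_comm, zpow_add₀ hp0, zpow_natCast]
    have e1 := congrArg (C (R := ℚ_[p])) h1
    have e2 := congrArg (C (R := ℚ_[p])) h2
    have e3 := congrArg (C (R := ℚ_[p])) h3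
    rw [map_mul, map_mul] at e1
    rw [map_mul] at e2
    rw [map_mul] at e3
    rw [hder, hcoe, hE, scaledPow]
    simp only [map_mul, map_add]
    linear_combination (1 - onePlusPow p c (-y)) * e1 + (C (coeff 0 g) - g) * e2 +
      C (coeff 0 g) * e3

variable {y : ℚ} {κ : ℕ} {lam : ℝ} {u : ℕ} {ω ω' : ℤ_[p]ˣ} {φ E : PowerSeries ℚ_[p]}

theorem rhoP_le_lamTilde_aux (hκ : 1 + iotaP' p 2 ≤ κ) : rhoP p ≤ (κ : ℝ) - rhoP p := by
  have hp1 := one_lt_natCast_prime (p := p)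
  have hr := rhoP_mul (p := p)
  have hr0 := rhoP_pos (p := p)
  rcases hp.out.eq_two_or_odd' with h2 | hodd
  · subst h2
    have : iotaP' 2 2 = 1 := by
      have := padicValRat.self (p := 2) one_lt_two
      simp only [iotaP']; norm_cast at this ⊢
    rw [this] at hκ
    have : (2 : ℝ) ≤ κ := by exact_mod_cast hκ
    push_cast at hr
    linarith
  · have h3 : (3 : ℝ) ≤ p := by
      have : 3 ≤ p := by
        have := hp.out.two_le
        rcases hodd with ⟨m, rfl⟩
        omega
      exact_mod_cast this
    have : (1 : ℝ) ≤ κ := by exact_mod_cast (by omega : 1 ≤ κ)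
    nlinarith

theorem IsRhoMultiple.rhoP_le (h : IsRhoMultiple p lam) : rhoP p ≤ lam := by
  obtain ⟨j, hj, rfl⟩ := h
  have : (1 : ℝ) ≤ j := by exact_mod_cast hj
  nlinarith [rhoP_pos (p := p)]

theorem rhoP_le_lamTilde (hκ : 1 + iotaP' p 2 ≤ κ) (hlam : rhoP p ≤ lam) :
    rhoP p ≤ lamTilde p y κ lam :=
  le_min ((rhoP_le_lamTilde_aux hκ).trans (by linarith [rhoAt_le (p := p) y])) hlam

theorem ceil_mul_sub_floor_ge (k : ℕ) (lam : ℝ) :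
    ((k : ℝ) - 1) * lam ≤ (⌈(k : ℝ) * lam⌉ - ⌊lam⌋ : ℤ) := by
  push_cast
  linarith [Int.le_ceil ((k : ℝ) * lam), Int.floor_le lam]

namespace NormalisedDeriv

variable (h : NormalisedDeriv p y κ lam u ω ω' φ E)
include h

/-- The perturbation is smaller than the power function by the factor `p^(u-κ-ι'+⌊λ⌋)`. -/
theorem coeffBound_error {μ : ℝ} (hμ : μ ≤ lam) :
    CoeffBound ((p : ℝ) ^ μ)
      ((p : ℝ) ^ (-((u : ℤ) - κ - iotaP' p y + ⌊lam⌋)) * (p : ℝ) ^ μ) E := fun k => by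
  have hpR : (0 : ℝ) < p := by linarith [one_lt_natCast_prime (p := p)]
  rcases Nat.eq_zero_or_pos k with rfl | hk
  · rw [h.coeff_zero]; simp; positivity
  have hk1 : (1 : ℝ) ≤ k := by exact_mod_cast hk
  refine (mul_le_mul_of_nonneg_right (h.norm_le k hk) (by positivity)).trans ?_
  rw [← Real.rpow_mul_natCast hpR.le, ← Real.rpow_intCast, ← Real.rpow_intCast,
    ← Real.rpow_add hpR, ← Real.rpow_add hpR]
  refine Real.rpow_le_rpow_of_exponent_le one_lt_natCast_prime.le ?_
  have := ceil_mul_sub_floor_ge k lam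
  push_cast at this ⊢
  nlinarith

theorem coeff_zero_deriv : coeff 0 φ = 0 := by
  rw [h.eq_add, map_add, coeff_zero_scaledPow, h.coeff_zero, add_zero]

theorem coeffBound (hy : y ≠ 0) {μ : ℝ} (hμ : μ ≤ lam) (hμ' : μ ≤ κ - rhoAt p y)
    (hu : (κ : ℤ) - ⌊lam⌋ + iotaP' p y + 1 ≤ u) :
    CoeffBound ((p : ℝ) ^ μ) ((p : ℝ) ^ μ) φ := by
  have hp1 := one_lt_natCast_prime (p := p)
  have hpR : (0 : ℝ) < p := by linarith
  rw [h.eq_add]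
  refine (coeffBound_scaledPow hy (norm_pow_mul_unit _ _ _) (norm_pow_mul_unit _ _ _) hμ').add
    (by positivity) fun k => (h.coeffBound_error hμ k).trans ?_
  refine mul_le_of_le_one_left (by positivity) ?_
  rw [zpow_neg]
  exact inv_le_one_of_one_le₀ (one_le_zpow₀ hp1.le (by omega))

/-- Coefficientwise bound on the normalised derivative; the two conditions on `t` come from the power
function and from the perturbation. -/
theorem norm_coeff_le (hy : y ≠ 0) (hlam : rhoP p ≤ lam)
    (hu : (κ : ℤ) - ⌊lam⌋ + iotaP' p y + 1 ≤ u) {t : ℝ} {k : ℕ} (hk : 1 ≤ k)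
    (h1 : t ≤ ((k : ℝ) - 1) * (κ - rhoP p)) (h2 : t ≤ 1 + ((k : ℝ) - 1) * rhoP p) :
    ‖coeff k φ‖ ≤ (p : ℝ) ^ (-t) := by
  have hp1 := one_lt_natCast_prime (p := p)
  have hk1 : (0 : ℝ) ≤ (k : ℝ) - 1 := by
    have : (1 : ℝ) ≤ k := by exact_mod_cast hk
    linarith
  rw [h.eq_add, map_add]
  refine (IsUltrametricDist.norm_add_le_max _ _).trans (max_le ?_ ?_)
  · refine (norm_coeff_scaledPow_le hy (norm_pow_mul_unit _ _ _) (norm_pow_mul_unit _ _ _)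
      hk).trans (Real.rpow_le_rpow_of_exponent_le hp1.le ?_)
    nlinarith [rhoAt_le (p := p) y]
  · refine (h.norm_le k hk).trans ?_
    rw [← Real.rpow_intCast]
    refine Real.rpow_le_rpow_of_exponent_le hp1.le ?_
    have h3 := ceil_mul_sub_floor_ge k lam
    have h4 : ((κ : ℝ) - ⌊lam⌋ + iotaP' p y + 1) ≤ u := by exact_mod_cast hu
    push_cast at h3 ⊢
    nlinarith

theorem norm_coeff_one (hy : y ≠ 0)
    (hu : (κ : ℤ) - ⌊lam⌋ + iotaP' p y + 1 ≤ u) : ‖coeff 1 φ‖ = 1 := by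
  have hp1 := one_lt_natCast_prime (p := p)
  have h0 := norm_coeff_one_scaledPow (p := p) hy (norm_pow_mul_unit (iotaP p y) κ ω)
    (norm_pow_mul_unit (iotaP' p y) κ ω'⁻¹)
  have h1 : ‖coeff 1 E‖ < 1 := by
    refine (h.norm_le 1 le_rfl).trans_lt (zpow_lt_one_of_neg₀ hp1 ?_)
    have : ⌊lam⌋ ≤ ⌈((1 : ℕ) : ℝ) * lam⌉ := by
      rw [Nat.cast_one, one_mul]; exact Int.floor_le_ceil lam
    omega
  rw [h.eq_add, map_add, IsUltrametricDist.norm_add_eq_max_of_norm_ne_norm, h0]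
  · exact max_eq_left h1.le
  · rw [h0]; exact h1.ne'

theorem norm_coeff_le_inv (hy : y ≠ 0) (hκ : 1 + iotaP' p 2 ≤ κ) (hlam : rhoP p ≤ lam)
    (hu : (κ : ℤ) - ⌊lam⌋ + iotaP' p y + 1 ≤ u) {k : ℕ} (hk : 2 ≤ k) :
    ‖coeff k φ‖ ≤ (p : ℝ)⁻¹ := by
  have hk1 : (1 : ℝ) ≤ (k : ℝ) - 1 := by
    have : (2 : ℝ) ≤ k := by exact_mod_cast hk
    linarith
  have hr0 := rhoP_pos (p := p)
  have hr := rhoP_le_lamTilde_aux (p := p) hκ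
  have h1 := h.norm_coeff_le hy hlam hu (by omega : 1 ≤ k) (t := rhoP p) (by nlinarith)
    (by nlinarith)
  have h2 := norm_le_zpow_of_le_rpow h1 (a := 1) (by push_cast; linarith)
  rwa [zpow_neg, zpow_one] at h2

end NormalisedDeriv

theorem norm_inv_natCast_eq {n : ℕ} (hn : n ≠ 0) :
    ‖(n : ℚ_[p])‖⁻¹ = (p : ℝ) ^ padicValNat p n := by
  have h0 : (n : ℚ_[p]) ≠ 0 := by exact_mod_cast hn
  rw [Padic.norm_eq_zpow_neg_valuation h0, Padic.valuation_natCast, zpow_neg, inv_inv, zpow_natCast]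

theorem norm_natCast_le_one (n : ℕ) : ‖(n : ℚ_[p])‖ ≤ 1 := by
  simpa using Padic.norm_int_le_one (p := p) n

theorem norm_two_of_odd (h2 : p ≠ 2) : ‖(2 : ℚ_[p])‖ = 1 := by
  have := (Padic.norm_natCast_eq_one_iff (p := p) (n := 2)).2
    ((Nat.coprime_primes hp.out Nat.prime_two).2 h2)
  exact_mod_cast this

/-- The coefficient estimate that makes the Taylor remainder of the phase beyond the quadratic
term divisible by `2 p h²`; for `p ≤ 3` it needs `p ∣ h`. -/
theorem NormalisedDeriv.taylor_coeff_le (h : NormalisedDeriv p y κ lam u ω ω' φ E) (hy : y ≠ 0)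
    (hκ1 : 1 ≤ κ) (hκ2 : p = 2 → 3 ≤ κ) (hlam : rhoP p ≤ lam)
    (hu : (κ : ℤ) - ⌊lam⌋ + iotaP' p y + 1 ≤ u) {x : ℚ_[p]} (hx1 : ‖x‖ ≤ 1)
    (hx : p = 2 ∨ p = 3 → ‖x‖ ≤ (p : ℝ)⁻¹) (k j : ℕ) (hk : 2 ≤ k) (hj : j < k) :
    ‖coeff k φ‖ * (‖(k.choose (j + 1) : ℚ_[p]) / (j + 2)‖ * ‖x‖ ^ j) ≤ ‖(2 * p : ℚ_[p])‖ := by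
  have hp1 := one_lt_natCast_prime (p := p)
  have hpR : (0 : ℝ) < p := by linarith
  have hr0 := rhoP_pos (p := p)
  have hr := rhoP_mul (p := p)
  have hkR : (2 : ℝ) ≤ k := by exact_mod_cast hk
  have hκR : (1 : ℝ) ≤ κ := by exact_mod_cast hκ1
  set a := padicValNat p (j + 2) with ha
  have hpa : p ^ a ≤ j + 2 := Nat.le_of_dvd (by omega) pow_padicValNat_dvd
  have hdiv : ‖(k.choose (j + 1) : ℚ_[p]) / (j + 2)‖ ≤ (p : ℝ) ^ a := by
    have := norm_inv_natCast_eq (p := p) (n := j + 2) (by omega)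
    push_cast at this
    rw [norm_div, div_eq_mul_inv, this]
    exact mul_le_of_le_one_left (by positivity) (norm_natCast_le_one _)
  have hxj : ‖x‖ ^ j ≤ 1 := pow_le_one₀ (norm_nonneg _) hx1
  -- for small primes the loss from the denominator `j + 2` is compensated by `x ^ j`
  have hsmall : ‖x‖ ≤ (p : ℝ)⁻¹ → a ≤ j →
      ‖(k.choose (j + 1) : ℚ_[p]) / (j + 2)‖ * ‖x‖ ^ j ≤ 1 := by
    intro hx' haj
    calc _ ≤ (p : ℝ) ^ a * ((p : ℝ)⁻¹) ^ j := by gcongr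
      _ ≤ (p : ℝ) ^ j * ((p : ℝ)⁻¹) ^ j := by gcongr; exact hp1.le
      _ = 1 := by rw [← mul_pow, mul_inv_cancel₀ hpR.ne', one_pow]
  rw [norm_mul, Padic.norm_p]
  rcases eq_or_ne p 2 with h2 | h2
  · have hx' := hx (Or.inl h2)
    have hκ3 : (3 : ℝ) ≤ κ := by exact_mod_cast hκ2 h2
    have hpe : (p : ℝ) = 2 := by exact_mod_cast h2
    have hρ : rhoP p = 1 := by rw [rhoP, hpe]; norm_num
    -- `κ ≥ 3` makes the coefficients of index `k` divisible by `2 ^ k`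
    have hφ : ‖coeff k φ‖ ≤ (p : ℝ) ^ (-(k : ℤ)) := by
      refine norm_le_zpow_of_le_rpow (h.norm_coeff_le hy hlam hu (by omega) (t := k) ?_ ?_) ?_
      · rw [hρ]; nlinarith
      · rw [hρ]; linarith
      · push_cast; linarith
    have hn2 : ‖(2 : ℚ_[p])‖ = (p : ℝ)⁻¹ := by
      have := Padic.norm_p (p := p)
      rwa [show ((p : ℕ) : ℚ_[p]) = 2 by exact_mod_cast h2] at this
    rw [hn2]
    have hz : ∀ m : ℕ, m ≤ k → (p : ℝ) ^ (-(k : ℤ)) ≤ ((p : ℝ)⁻¹) ^ m := by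
      intro m hm
      rw [zpow_neg, zpow_natCast, inv_pow]
      gcongr
      exact hp1.le
    rcases Nat.eq_zero_or_pos j with rfl | hj0
    · simp only [pow_zero, mul_one, zero_add, Nat.choose_one_right, CharP.cast_eq_zero, norm_div,
        hn2, div_inv_eq_mul]
      rcases hk.eq_or_lt with rfl | hk3
      · rw [Nat.cast_ofNat, hn2, inv_mul_cancel₀ hpR.ne', mul_one]
        calc _ ≤ _ := hφ.trans (hz 2 le_rfl)
          _ = _ := by ring
      · calc _ ≤ ((p : ℝ)⁻¹) ^ 3 * (1 * p) := by
              gcongr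
              exacts [hφ.trans (hz 3 hk3), norm_natCast_le_one _]
          _ = _ := by field_simp
    · have haj : a ≤ j := by
        have : 2 ^ a < 2 ^ (j + 1) := by
          rw [← h2]
          refine hpa.trans_lt ?_
          rw [h2]
          have h5 : j + 1 ≤ 2 ^ j := Nat.lt_two_pow_self
          have h6 : 2 ≤ 2 ^ j := Nat.le_self_pow (by omega) 2
          rcases Nat.lt_or_ge j 2 with h7 | h7
          · obtain rfl : j = 1 := by omega
            norm_num
          · rw [pow_succ]; omega
        have := (Nat.pow_lt_pow_iff_right (by norm_num : 1 < 2)).1 this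
        omega
      calc _ ≤ ((p : ℝ)⁻¹) ^ 2 * 1 := by
            gcongr
            exacts [hφ.trans (hz 2 hk), hsmall hx' haj]
        _ = _ := by ring
  rw [norm_two_of_odd h2, one_mul]
  rcases eq_or_ne p 3 with h3 | h3
  · have hx' := hx (Or.inr h3)
    have hpe : (p : ℝ) = 3 := by exact_mod_cast h3
    have hρ : rhoP p = 1 / 2 := by rw [rhoP, hpe]; norm_num
    have hi2 : iotaP' p 2 = 0 := by
      subst h3
      have : padicValRat 3 2 = 0 := by
        have := padicValNat.eq_zero_of_not_dvd (p := 3) (n := 2) (by norm_num)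
        exact_mod_cast congrArg (Nat.cast (R := ℤ)) this
      simp [iotaP', this]
    have hφ := h.norm_coeff_le_inv hy (by omega) hlam hu hk
    have haj : a ≤ j := by
      have : 3 ^ a < 3 ^ (j + 1) := by
        rw [← h3]
        refine hpa.trans_lt ?_
        rw [h3]
        have : j + 1 ≤ 3 ^ j := Nat.lt_pow_self (by norm_num)
        rw [pow_succ]; omega
      have := (Nat.pow_lt_pow_iff_right (by norm_num : 1 < 3)).1 this
      omega
    calc _ ≤ (p : ℝ)⁻¹ * 1 := by
          gcongr
          exact hsmall hx' haj
      _ = _ := mul_one _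
  · have h5 : 5 ≤ p := by
      have := hp.out.two_le
      by_contra hlt
      have : p = 4 := by omega
      have := hp.out
      rw [‹p = 4›] at this
      exact absurd this (by norm_num)
    have h5R : (5 : ℝ) ≤ p := by exact_mod_cast h5
    -- Bernoulli: `j + 2 ≥ p ^ a ≥ 1 + a (p - 1)`
    have hbern : 1 + (a : ℝ) * ((p : ℝ) - 1) ≤ (k : ℝ) + 1 := by
      have hb := one_add_mul_le_pow (a := (p : ℝ) - 1) (by linarith) a
      have hpaR : (p : ℝ) ^ a ≤ (k : ℝ) + 1 := by
        have : p ^ a ≤ k + 1 := by omega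
        exact_mod_cast this
      rw [show 1 + ((p : ℝ) - 1) = p by ring] at hb
      linarith
    have ha0 : (0 : ℝ) ≤ a := Nat.cast_nonneg a
    have hρ4 : rhoP p ≤ 1 / 4 := by nlinarith
    have hkρ : (a : ℝ) - rhoP p ≤ ((k : ℝ) - 1) * rhoP p := by
      have : ((a : ℝ) * ((p : ℝ) - 1)) * rhoP p ≤ k * rhoP p := by gcongr; linarith
      have e : ((a : ℝ) * ((p : ℝ) - 1)) * rhoP p = a := by linear_combination (a : ℝ) * hr
      linarith
    have h1a : 1 + (a : ℝ) - rhoP p > a := by linarith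
    have hka : (a : ℝ) < ((k : ℝ) - 1) * (1 - rhoP p) := by
      rcases Nat.eq_zero_or_pos a with h0 | hapos
      · rw [h0, CharP.cast_eq_zero]; nlinarith
      · have ha1 : (1 : ℝ) ≤ a := by exact_mod_cast hapos
        have hk4 : (a : ℝ) * ((p : ℝ) - 1) - 1 ≤ (k : ℝ) - 1 := by linarith
        have h6 : ((a : ℝ) * ((p : ℝ) - 1) - 1) * (1 - rhoP p) ≤ ((k : ℝ) - 1) * (1 - rhoP p) :=
          mul_le_mul_of_nonneg_right hk4 (by linarith)
        have h7 : ((a : ℝ) * ((p : ℝ) - 1) - 1) * (1 - rhoP p) =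
            a * ((p : ℝ) - 2) - (1 - rhoP p) := by linear_combination (-(a : ℝ)) * hr
        nlinarith
    set t := min (((k : ℝ) - 1) * (κ - rhoP p)) (1 + ((k : ℝ) - 1) * rhoP p) with ht
    have hat : (a : ℝ) < t := lt_min (by nlinarith) (by linarith)
    have hφ : ‖coeff k φ‖ ≤ (p : ℝ) ^ (-((a : ℤ) + 1)) := by
      refine norm_le_zpow_of_le_rpow (h.norm_coeff_le hy hlam hu (by omega) (min_le_left _ _)
        (min_le_right _ _)) ?_
      push_cast
      linarith
    calc _ ≤ (p : ℝ) ^ (-((a : ℤ) + 1)) * ((p : ℝ) ^ a * 1) := by gcongr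
      _ = _ := by
          rw [mul_one, neg_add, zpow_add₀ hpR.ne', zpow_neg, zpow_neg, zpow_natCast, zpow_one]
          field_simp

end Phase

/-! ### The dual phase -/

section Dual

variable {p : ℕ} [hp : Fact p.Prime]

/-- A series converging on the closed unit disc lies in `ℚ_p^× I₀(ℤ_p)`. -/
theorem ConvOnUnitDisc.exists_eq_C_mul {f : PowerSeries ℚ_[p]} (hf : ConvOnUnitDisc f) :
    ∃ c : ℚ_[p], c ≠ 0 ∧ ∃ a ∈ IZero p, f = C c * a := by
  have hp0 := natCast_prime_ne_zero (p := p)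
  have hp1 := one_lt_natCast_prime (p := p)
  obtain ⟨A, hA⟩ := (tendsto_norm_zero.comp hf).bddAbove_range
  obtain ⟨m, hm⟩ := pow_unbounded_of_one_lt A hp1
  refine ⟨((p : ℚ_[p]) ^ m)⁻¹, inv_ne_zero (pow_ne_zero _ hp0), C ((p : ℚ_[p]) ^ m) * f,
    ⟨fun k => ?_, ?_⟩, ?_⟩
  · rw [coeff_C_mul, norm_mul, Padic.norm_p_pow, zpow_neg, zpow_natCast,
      inv_mul_le_iff₀ (by positivity), mul_one]
    exact (hA ⟨k, rfl⟩).trans hm.le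
  · exact hf.C_mul _
  · rw [← mul_assoc, ← map_mul, inv_mul_cancel₀ (pow_ne_zero _ hp0), map_one, one_mul]

theorem eq_C_add_antideriv {f g : PowerSeries ℚ_[p]} (h : derivative ℚ_[p] f = g) :
    f = C (coeff 0 f) + antideriv g := by
  refine derivative.ext ?_ ?_
  · rw [map_add, derivative_C, derivative_antideriv, zero_add, h]
  · rw [← coeff_zero_eq_constantCoeff_apply, ← coeff_zero_eq_constantCoeff_apply, map_add,
      coeff_zero_C, coeff_zero_antideriv, add_zero]

theorem CoeffBound.convOnUnitDisc_antideriv {f : PowerSeries ℚ_[p]} {R M : ℝ} (hR : 1 < R)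
    (hf : CoeffBound R M f) : ConvOnUnitDisc (antideriv f) :=
  .of_norm_le hR (norm_coeff_antideriv_le (by linarith) hf)

variable {y : ℚ} {κ : ℕ} {lam : ℝ} {u : ℕ} {ω ω' : ℤ_[p]ˣ} {φ E : PowerSeries ℚ_[p]}

/-- The compositional inverse `S` of the normalised derivative is close to the compositional
inverse `S₀` of the unperturbed power function `φ₀`: from `φ₀(S) = t - E(S)` one gets
`S = S₀(t - E(S))`, and substitution into `S₀` is Lipschitz. -/
theorem NormalisedDeriv.coeffBound_inverse_sub (h : NormalisedDeriv p y κ lam u ω ω' φ E)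
    (hy : y ≠ 0) {μ : ℝ} (hμ : μ ≤ lam) (hμ' : μ ≤ κ - rhoAt p y) {S : PowerSeries ℚ_[p]}
    (hS0 : coeff 0 S = 0) (hSX : φ.subst S = X) (hS : CoeffBound ((p : ℝ) ^ μ) ((p : ℝ) ^ μ) S)
    (hu : (κ : ℤ) - ⌊lam⌋ + iotaP' p y + 1 ≤ u) :
    CoeffBound ((p : ℝ) ^ μ) ((p : ℝ) ^ (-((u : ℤ) - κ - iotaP' p y + ⌊lam⌋)) * (p : ℝ) ^ μ)
      (S - scaledPow p ((p : ℚ_[p]) ^ (iotaP' p y + κ) * (((ω'⁻¹ : ℤ_[p]ˣ) : ℤ_[p]) : ℚ_[p]))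
        ((p : ℚ_[p]) ^ (iotaP p y + κ) * ((ω : ℤ_[p]) : ℚ_[p])) (-y⁻¹)) := by
  have hp1 := one_lt_natCast_prime (p := p)
  have hpR : (0 : ℝ) < p := by linarith
  have hp0 := natCast_prime_ne_zero (p := p)
  have hadd := h.eq_add
  set c := (p : ℚ_[p]) ^ (iotaP p y + κ) * ((ω : ℤ_[p]) : ℚ_[p]) with hc
  set d := (p : ℚ_[p]) ^ (iotaP' p y + κ) * (((ω'⁻¹ : ℤ_[p]ˣ) : ℤ_[p]) : ℚ_[p]) with hd
  have hR : (0 : ℝ) < (p : ℝ) ^ μ := by positivity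
  set R := (p : ℝ) ^ μ with hRdef
  set ε := (p : ℝ) ^ (-((u : ℤ) - κ - iotaP' p y + ⌊lam⌋)) with hε
  have hε0 : 0 ≤ ε := by positivity
  have hε1 : ε ≤ 1 := by
    rw [hε, zpow_neg]
    exact inv_le_one_of_one_le₀ (one_le_zpow₀ hp1.le (by omega))
  have hcne : c ≠ 0 := mul_ne_zero (pow_ne_zero _ hp0) (unit_coe_ne_zero _)
  have hdne : d ≠ 0 := mul_ne_zero (pow_ne_zero _ hp0) (unit_coe_ne_zero _)
  set φ₀ := scaledPow p c d (-y) with hφ₀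
  set S₀ := scaledPow p d c (-y⁻¹) with hS₀
  have hinv : S₀.subst φ₀ = X := by
    have := scaledPow_inv_subst hcne hdne (neg_ne_zero.2 hy)
    rwa [inv_neg] at this
  have hsubS := hasSubst_of_coeff_zero hS0
  have hφ₀0 : coeff 0 φ₀ = 0 := coeff_zero_scaledPow _ _ _
  set D := E.subst S with hD
  have hED : CoeffBound R (ε * R) D := (h.coeffBound_error hμ).subst hR hS0 hS
  have hD0 : coeff 0 D = 0 := by
    rw [hD, coeff_subst_eq_sum_range E hS0]; simp [h.coeff_zero]
  have hφS : φ₀.subst S = X - D := by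
    rw [← hSX, hadd, subst_add hsubS, add_sub_cancel_right]
  have hSeq : S = S₀.subst (X - D) := by
    have := subst_comp_subst_apply (hasSubst_of_coeff_zero hφ₀0) hsubS S₀
    rw [hinv, subst_X hsubS, hφS] at this
    exact this
  have hXD : CoeffBound R R (X - D) := by
    rw [sub_eq_add_neg]
    exact (coeffBound_X hR.le).add hR.le fun n =>
      (hED.neg n).trans (mul_le_of_le_one_left hR.le hε1)
  have hS₀b : CoeffBound R R S₀ :=
    coeffBound_scaledPow (inv_ne_zero hy) (by rw [iotaP_inv]; exact norm_pow_mul_unit _ _ _)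
      (by rw [iotaP'_inv]; exact norm_pow_mul_unit _ _ _) (by rwa [rhoAt_inv])
  have key := hS₀b.subst_sub_subst hR hε0 (g := X - D) (h := X)
    (by rw [map_sub, hD0, coeff_zero_X, sub_zero]) hXD
    (by simp) (coeffBound_X hR.le)
    (by rw [sub_sub_cancel_left]; exact hED.neg)
  rwa [X_subst, ← hSeq] at key

theorem mem_IZeroDecay_of_coeffBound {g : PowerSeries ℚ_[p]} {μ : ℝ} (hμ : 0 < μ)
    (hg : CoeffBound ((p : ℝ) ^ μ) 1 g) : g ∈ IZeroDecay p μ := by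
  have hp1 := one_lt_natCast_prime (p := p)
  have hpR : (0 : ℝ) < p := by linarith
  have hR : 1 < (p : ℝ) ^ μ := Real.one_lt_rpow hp1 hμ
  have h1 : ∀ k : ℕ, ‖coeff k g‖ ≤ (p : ℝ) ^ (-((k : ℝ) * μ)) := by
    intro k
    have := hg k
    rw [← Real.rpow_mul_natCast hpR.le] at this
    rw [Real.rpow_neg hpR.le, mul_comm (k : ℝ) μ, ← one_div, le_div_iff₀ (by positivity)]
    exact this
  refine ⟨⟨fun k => (h1 k).trans ?_, hg.convOnUnitDisc hR⟩, fun k => ?_⟩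
  · exact Real.rpow_le_one_of_one_le_of_nonpos hp1.le (by simp; positivity)
  · refine norm_le_zpow_of_le_rpow (h1 k) ?_
    linarith [Int.ceil_lt_add_one ((k : ℝ) * μ)]

/-- The dual phase: the Legendre transform `L(t) = ψ(S(t)) - t S(t)` of the antiderivative `ψ` of
`φ`, where `S` is the compositional inverse of `φ`. Up to linear twists, which only change `γ₀`,
it lies in the class attached to `y⁻¹`. -/
theorem NormalisedDeriv.exists_dual (h : NormalisedDeriv p y κ lam u ω ω' φ E)
    (hy : y ≠ 0) (hκ : 1 + iotaP' p 2 ≤ κ) (hlam : rhoP p ≤ lam)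
    (hu : (κ : ℤ) - ⌊lam⌋ + iotaP' p y + 1 ≤ u) {v : ℕ}
    (hv : (v : ℤ) = u - padicValRat p y - ⌈lamTilde p y κ lam⌉ + ⌊lam⌋) :
    ∃ S L : PowerSeries ℚ_[p],
      (∀ x : ℚ_[p], ‖x‖ ≤ 1 → ‖psEval p S x‖ ≤ 1 ∧ psEval p φ (psEval p S x) = x ∧
        psEval p L x = psEval p (antideriv φ) (psEval p S x) - x * psEval p S x) ∧
      ConvOnUnitDisc L ∧
      ∀ m : ℤ, L + C (m : ℚ_[p]) * X ∈
        ClassF p (-((iotaP p y : ℤ) + κ)) y⁻¹ κ (lamTilde p y κ lam) v := by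
  have hp1 := one_lt_natCast_prime (p := p)
  have hpR : (0 : ℝ) < p := by linarith
  have hp0 := natCast_prime_ne_zero (p := p)
  set μ := lamTilde p y κ lam with hμdef
  have hμ1 : μ ≤ lam := min_le_right _ _
  have hμ2 : μ ≤ κ - rhoAt p y := min_le_left _ _
  have hμ0 : 0 < μ := rhoP_pos.trans_le (rhoP_le_lamTilde hκ hlam)
  have hR1 : 1 < (p : ℝ) ^ μ := Real.one_lt_rpow hp1 hμ0
  have hR0 : 0 < (p : ℝ) ^ μ := by linarith
  have hφ := h.coeffBound hy hμ1 hμ2 hu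
  have hφ0 := h.coeff_zero_deriv
  have hφ1 := h.norm_coeff_one hy hu
  have hunit : IsUnit (coeff 1 φ) := by
    rw [isUnit_iff_ne_zero, ← norm_ne_zero_iff, hφ1]; exact one_ne_zero
  have hφc : constantCoeff φ = 0 := by simpa using hφ0
  set S := substInvOfIsUnit φ hunit with hSdef
  have hS0 : coeff 0 S = 0 := by simp [hSdef]
  have hSX : φ.subst S = X := subst_substInvOfIsUnit_right φ hφc hunit
  have hS : CoeffBound ((p : ℝ) ^ μ) ((p : ℝ) ^ μ) S := hφ.of_subst_eq_X hR0 hφ0 hφ1 hS0 hSX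
  have hsubS := hasSubst_of_coeff_zero hS0
  set L := (antideriv φ).subst S - X * S with hL
  have hLder : derivative ℚ_[p] L = -S := by
    rw [hL, map_sub, derivative_subst hsubS, derivative_antideriv, hSX, Derivation.leibniz,
      derivative_X]
    simp only [smul_eq_mul]
    ring
  have hLconv : ConvOnUnitDisc L := by
    rw [eq_C_add_antideriv hLder]
    exact (convOnUnitDisc_C _).add (hS.neg.convOnUnitDisc_antideriv hR1)
  have hSconv := hS.convOnUnitDisc hR1
  have hXS : ConvOnUnitDisc (X * S) :=
    ((coeffBound_X hR0.le).mul hR0.le hS).convOnUnitDisc hR1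
  refine ⟨S, L, fun x hx => ⟨?_, ?_, ?_⟩, hLconv, fun m => ⟨?_, ?_⟩⟩
  · refine norm_psEval_le zero_le_one (fun k => ?_) hx
    rcases k with _ | k
    · rw [hS0, norm_zero]; exact zero_le_one
    · have h1 := hS (k + 1)
      have h2 : (p : ℝ) ^ μ ≤ ((p : ℝ) ^ μ) ^ (k + 1) := le_self_pow₀ hR1.le (Nat.succ_ne_zero k)
      nlinarith [norm_nonneg (coeff (k + 1) S)]
  · rw [← psEval_subst hR1 (C := (p : ℝ) ^ μ) (fun k => (hφ k).trans ?_) hS0 hS hx, hSX, psEval_X]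
    nlinarith [k.cast_nonneg (α := ℝ)]
  · have h1 := psEval_subst hR1 (norm_coeff_antideriv_le hR0.le hφ) hS0 hS hx
    have h2 : (antideriv φ).subst S = L + X * S := by rw [hL]; ring
    rw [h2, psEval_add hLconv hXS hx, psEval_mul convOnUnitDisc_X hSconv hx, psEval_X] at h1
    rw [← h1]; ring
  · exact (hLconv.add (convOnUnitDisc_X.C_mul _)).exists_eq_C_mul
  · have hdiff := h.coeffBound_inverse_sub hy hμ1 hμ2 hS0 hSX hS hu
    set c := (p : ℚ_[p]) ^ (iotaP p y + κ) * ((ω : ℤ_[p]) : ℚ_[p]) with hc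
    set d := (p : ℚ_[p]) ^ (iotaP' p y + κ) * (((ω'⁻¹ : ℤ_[p]ˣ) : ℤ_[p]) : ℚ_[p]) with hd
    set S₀ := scaledPow p d c (-y⁻¹) with hS₀
    set t : ℤ := (v : ℤ) + -((iotaP p y : ℤ) + κ) with ht
    have hcinv : c⁻¹ = (p : ℚ_[p]) ^ (-((iotaP p y : ℤ) + κ)) *
        (((ω⁻¹ : ℤ_[p]ˣ) : ℤ_[p]) : ℚ_[p]) := by
      have hcne : c ≠ 0 := mul_ne_zero (pow_ne_zero _ hp0) (unit_coe_ne_zero _)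
      have e : (p : ℚ_[p]) ^ (-((iotaP p y : ℤ) + κ)) * (p : ℚ_[p]) ^ (iotaP p y + κ) = 1 := by
        rw [← zpow_natCast, ← zpow_add₀ hp0]
        convert zpow_zero (p : ℚ_[p]) using 2
        push_cast; ring
      refine inv_eq_of_mul_eq_one_left ?_
      rw [hc]
      linear_combination e * (((ω : ℤ_[p]) : ℚ_[p]) * (((ω⁻¹ : ℤ_[p]ˣ) : ℤ_[p]) : ℚ_[p])) +
        unit_coe_mul_inv ω
    -- `-S₀ = c⁻¹ - c⁻¹ (1 + d t)^(-1/y)` supplies the power function of the dual class, and the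
    -- perturbation is `-(S - S₀)`
    refine ⟨ω'⁻¹, -ω⁻¹, ((ω⁻¹ : ℤ_[p]ˣ) : ℤ_[p]) + (p : ℤ_[p]) ^ (iotaP p y + κ) * (m : ℤ_[p]),
      C (-((p : ℚ_[p]) ^ (-t))) * (S - S₀), ?_, ?_⟩
    · refine mem_IZeroDecay_of_coeffBound hμ0 fun k => ?_
      rw [coeff_C_mul, norm_mul, norm_neg, Padic.norm_p_zpow, neg_neg, mul_assoc]
      refine (mul_le_mul_of_nonneg_left (hdiff k) (by positivity)).trans ?_
      rw [← mul_assoc, ← zpow_add₀ hpR.ne', ← Real.rpow_intCast, ← Real.rpow_add hpR]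
      refine Real.rpow_le_one_of_one_le_of_nonpos hp1.le ?_
      have hval := padicValRat_eq_iotaP'_sub_iotaP (p := p) y
      have : t + -((u : ℤ) - κ - iotaP' p y + ⌊lam⌋) = -⌈μ⌉ := by
        rw [ht, hv, hval]; ring
      rw [this]
      push_cast
      linarith [Int.le_ceil μ]
    · have hpt : (C ((p : ℚ_[p]) ^ t) : PowerSeries ℚ_[p]) * C (-((p : ℚ_[p]) ^ (-t))) = -1 := by
        rw [← map_mul, mul_neg, ← zpow_add₀ hp0, add_neg_cancel, zpow_zero, map_neg, map_one]
      have hγ : (p : ℚ_[p]) ^ (-((iotaP p y : ℤ) + κ)) *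
          ((((ω⁻¹ : ℤ_[p]ˣ) : ℤ_[p]) + (p : ℤ_[p]) ^ (iotaP p y + κ) * (m : ℤ_[p]) : ℤ_[p]) : ℚ_[p])
          = c⁻¹ + m := by
        have e : (p : ℚ_[p]) ^ (-((iotaP p y : ℤ) + κ)) * (p : ℚ_[p]) ^ (iotaP p y + κ) = 1 := by
          rw [← zpow_natCast, ← zpow_add₀ hp0]
          convert zpow_zero (p : ℚ_[p]) using 2
          push_cast; ring
        rw [hcinv]
        push_cast
        linear_combination (m : ℚ_[p]) * e
      have hω : (p : ℚ_[p]) ^ (-((iotaP p y : ℤ) + κ)) * (((-ω⁻¹ : ℤ_[p]ˣ) : ℤ_[p]) : ℚ_[p]) =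
          -c⁻¹ := by
        rw [hcinv, Units.val_neg, PadicInt.coe_neg, mul_neg]
      have hder : derivative ℚ_[p] (L + C (m : ℚ_[p]) * X) = -S + C (m : ℚ_[p]) := by
        rw [map_add, hLder, Derivation.leibniz, derivative_C, derivative_X]
        simp
      rw [hder, iotaP_inv, ← hd, hω, hγ, ← mul_assoc, hpt, hS₀, scaledPow, map_neg, map_add]
      ring

end Dual

/-! ### Stationary phase for complete exponential sums -/

section StationaryPhase

variable {p : ℕ} [hp : Fact p.Prime]

theorem padicE_add (x y : ℚ_[p]) : padicE p (x + y) = padicE p x * padicE p y := by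
  obtain ⟨q, ⟨a, k, ha⟩, hq⟩ := exists_padicFrac p x
  obtain ⟨r, ⟨b, l, hb⟩, hr⟩ := exists_padicFrac p y
  have hp0 : (p : ℚ) ≠ 0 := by exact_mod_cast hp.out.ne_zero
  rw [padicE_eq p x q ⟨a, k, ha⟩ hq, padicE_eq p y r ⟨b, l, hb⟩ hr,
    padicE_eq p (x + y) (q + r) ⟨a * p ^ l + b * p ^ k, k + l, ?_⟩ ?_, ← Complex.exp_add]
  · push_cast; congr 1; ring
  · rw [ha, hb]; push_cast; field_simp; ring
  · have : x + y - ((q + r : ℚ) : ℚ_[p]) = (x - q) + (y - r) := by push_cast; ring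
    rw [this]
    exact (IsUltrametricDist.norm_add_le_max _ _).trans (max_le hq hr)

theorem padicE_eq_one {x : ℚ_[p]} (hx : ‖x‖ ≤ 1) : padicE p x = 1 := by
  rw [padicE_eq p x 0 ⟨0, 0, by simp⟩ (by simpa using hx)]
  simp

theorem padicE_intCast_div (a : ℤ) (k : ℕ) :
    padicE p ((a : ℚ_[p]) / (p : ℚ_[p]) ^ k) =
      Complex.exp (2 * Real.pi * Complex.I * ((a : ℂ) / (p : ℂ) ^ k)) := by
  rw [padicE_eq p _ ((a : ℚ) / (p : ℚ) ^ k) ⟨a, k, rfl⟩]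
  · push_cast; rfl
  · push_cast; simp

theorem norm_padicE (x : ℚ_[p]) : ‖padicE p x‖ = 1 := by
  rw [padicE, show (2 * Real.pi * Complex.I * ((exists_padicFrac p x).choose : ℂ)) =
    ((2 * Real.pi * ((exists_padicFrac p x).choose : ℝ) : ℝ) : ℂ) * Complex.I by push_cast; ring]
  exact Complex.norm_exp_ofReal_mul_I _

/-- The character `x ↦ e(x / p^N)`. -/
noncomputable def levelE (p : ℕ) [Fact p.Prime] (N : ℕ) (x : ℚ_[p]) : ℂ :=
  padicE p (x / (p : ℚ_[p]) ^ N)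

theorem levelE_add (N : ℕ) (x y : ℚ_[p]) : levelE p N (x + y) = levelE p N x * levelE p N y := by
  rw [levelE, add_div, padicE_add]; rfl

theorem norm_levelE (N : ℕ) (x : ℚ_[p]) : ‖levelE p N x‖ = 1 := norm_padicE _

theorem levelE_congr {N : ℕ} {x y : ℚ_[p]} (h : ‖x - y‖ ≤ (p : ℝ) ^ (-(N : ℤ))) :
    levelE p N x = levelE p N y := by
  have e : x = y + (x - y) := by ring
  rw [e, levelE_add, levelE, levelE, padicE_eq_one (x := (x - y) / _), mul_one]
  rw [norm_div, Padic.norm_p_pow]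
  exact div_le_one_of_le₀ h (by positivity)

instance neZero_prime_pow (N : ℕ) : NeZero (p ^ N) := ⟨pow_ne_zero _ hp.out.ne_zero⟩

theorem levelE_intCast (N : ℕ) (a : ℤ) :
    levelE p N a = ZMod.stdAddChar (a : ZMod (p ^ N)) := by
  rw [levelE, padicE_intCast_div, ZMod.stdAddChar_coe]
  push_cast
  congr 1; ring

theorem intCast_zmod_eq_zero_iff_norm (N : ℕ) (a : ℤ) :
    (a : ZMod (p ^ N)) = 0 ↔ ‖(a : ℚ_[p])‖ ≤ (p : ℝ) ^ (-(N : ℤ)) := by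
  rw [Padic.norm_int_le_pow_iff_dvd, ZMod.intCast_zmod_eq_zero_iff_dvd]
  push_cast; rfl

theorem exists_int_norm_sub_le (N : ℕ) {x : ℚ_[p]} (hx : ‖x‖ ≤ 1) :
    ∃ a : ℤ, ‖x - a‖ ≤ (p : ℝ) ^ (-(N : ℤ)) := by
  let z : ℤ_[p] := ⟨x, hx⟩
  have hs := (PadicInt.norm_le_pow_iff_mem_span_pow _ N).2 (PadicInt.appr_spec N z)
  refine ⟨(z.appr N : ℤ), ?_⟩
  rw [PadicInt.norm_def] at hs
  push_cast at hs ⊢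
  exact hs

theorem norm_le_iff_of_norm_sub_le {x y : ℚ_[p]} {ε : ℝ} (h : ‖x - y‖ ≤ ε) :
    ‖x‖ ≤ ε ↔ ‖y‖ ≤ ε := by
  constructor
  · intro hx
    have e : y = x + -(x - y) := by ring
    rw [e]
    exact (IsUltrametricDist.norm_add_le_max _ _).trans (max_le hx (by rwa [norm_neg]))
  · intro hy
    have e : x = (x - y) + y := by ring
    rw [e]
    exact (IsUltrametricDist.norm_add_le_max _ _).trans (max_le h hy)

/-- Averaging over translates: if translation by `g b` multiplies `t(v)` by a character of `b`, then
only the `v` for which this character is trivial contribute to the sum of `t`. -/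
theorem sum_eq_sum_ite_of_translate {n : ℕ} [NeZero n] (t : ZMod n → ℂ) (c : ZMod n → ZMod n)
    (g : ZMod n) (h : ∀ v b, t (v + g * b) = t v * ZMod.stdAddChar (b * (c v * g))) :
    ∑ v, t v = ∑ v, if c v * g = 0 then t v else 0 := by
  have hcard : ((Fintype.card (ZMod n) : ℕ) : ℂ) ≠ 0 := by
    rw [ZMod.card]; exact_mod_cast NeZero.ne n
  have htr : ∀ b : ZMod n, ∑ v, t (v + g * b) = ∑ v, t v := fun b =>
    Equiv.sum_comp (Equiv.addRight (g * b)) t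
  apply mul_left_cancel₀ hcard
  calc ((Fintype.card (ZMod n) : ℕ) : ℂ) * ∑ v, t v
      = ∑ b : ZMod n, ∑ v, t (v + g * b) := by
        simp_rw [htr]
        rw [sum_const, nsmul_eq_mul, card_univ]
    _ = ∑ v, t v * ∑ b : ZMod n, ZMod.stdAddChar (b * (c v * g)) := by
        rw [sum_comm]
        refine sum_congr rfl fun v _ => ?_
        rw [mul_sum]
        exact sum_congr rfl fun b _ => h v b
    _ = _ := by
        rw [mul_sum]
        refine sum_congr rfl fun v _ => ?_
        rw [AddChar.sum_mulShift _ (ZMod.isPrimitive_stdAddChar _)]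
        split_ifs <;> simp [mul_comm]

/-- A phase `ψ` on `ℤ_p` with derivative `φ` and second derivative `α` up to small errors, together
with a right inverse `s` of `φ`. The functions are defined on `ℚ_p`, but only their values on `ℤ_p`
matter. For `p ≤ 3` the quadratic approximation is only required for increments in `p ℤ_p`. -/
structure IsQuadraticPhase (p : ℕ) [Fact p.Prime] (ψ φ s : ℚ_[p] → ℚ_[p]) (α : ℚ_[p]) : Prop where
  norm_α : ‖α‖ ≤ 1
  norm_φ : ∀ x, ‖x‖ ≤ 1 → ‖φ x‖ ≤ 1
  isometry : ∀ x y, ‖x‖ ≤ 1 → ‖y‖ ≤ 1 → ‖φ x - φ y‖ = ‖x - y‖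
  norm_s : ∀ x, ‖x‖ ≤ 1 → ‖s x‖ ≤ 1
  φ_s : ∀ x, ‖x‖ ≤ 1 → φ (s x) = x
  taylor : ∀ x h, ‖x‖ ≤ 1 → ‖h‖ ≤ 1 → (p = 2 ∨ p = 3 → ‖h‖ ≤ (p : ℝ)⁻¹) →
    ‖ψ (x + h) - ψ x - φ x * h - α * h ^ 2 / 2‖ ≤ ‖(2 * p : ℚ_[p])‖ * ‖h‖ ^ 2

/-- `1` if `p = 2` and `0` otherwise: the order of `2` at `p`. -/
def ordTwo (p : ℕ) : ℕ := if p = 2 then 1 else 0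

theorem norm_two_eq : ‖(2 : ℚ_[p])‖ = (p : ℝ) ^ (-(ordTwo p : ℤ)) := by
  rw [ordTwo]
  split_ifs with h
  · have := Padic.norm_p (p := p)
    rw [show ((p : ℕ) : ℚ_[p]) = 2 by exact_mod_cast h] at this
    rw [this]; simp
  · rw [norm_two_of_odd h]; simp

theorem norm_intCast_le_one (a : ℤ) : ‖(a : ℚ_[p])‖ ≤ 1 := Padic.norm_int_le_one a

namespace IsQuadraticPhase

variable {ψ φ s : ℚ_[p] → ℚ_[p]} {α : ℚ_[p]} (H : IsQuadraticPhase p ψ φ s α)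
include H

/-- For `h` divisible by a high enough power of `p` the phase is linear to level `N`. -/
theorem levelE_add_of_linear {N m : ℕ} (hm : 1 ≤ m) (hmN : N + ordTwo p ≤ 2 * m) {x h : ℚ_[p]}
    (hx : ‖x‖ ≤ 1) (hh : ‖h‖ ≤ (p : ℝ) ^ (-(m : ℤ))) :
    levelE p N (ψ (x + h)) = levelE p N (ψ x) * levelE p N (φ x * h) := by
  have hp1 := one_lt_natCast_prime (p := p)
  have hpR : (0 : ℝ) < p := by linarith
  have hh1 : ‖h‖ ≤ (p : ℝ)⁻¹ := by
    refine hh.trans ?_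
    rw [← zpow_neg_one]
    exact zpow_le_zpow_right₀ hp1.le (by omega)
  have hh2 : ‖h‖ ≤ 1 := hh1.trans (inv_le_one_of_one_le₀ hp1.le)
  have hsq : ‖h‖ ^ 2 ≤ (p : ℝ) ^ (-(2 * m : ℤ)) := by
    calc ‖h‖ ^ 2 ≤ ((p : ℝ) ^ (-(m : ℤ))) ^ 2 := by gcongr
      _ = _ := by rw [← zpow_natCast, ← zpow_mul]; congr 1; push_cast; ring
  rw [← levelE_add]
  refine levelE_congr ?_
  have e : ψ (x + h) - (ψ x + φ x * h) =
      (ψ (x + h) - ψ x - φ x * h - α * h ^ 2 / 2) + α * h ^ 2 / 2 := by ring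
  rw [e]
  refine (IsUltrametricDist.norm_add_le_max _ _).trans (max_le ?_ ?_)
  · refine (H.taylor x h hx hh2 fun _ => hh1).trans ?_
    have h2p : ‖(2 * p : ℚ_[p])‖ ≤ 1 := by
      have := norm_natCast_le_one (p := p) (2 * p)
      exact_mod_cast this
    calc _ ≤ 1 * (p : ℝ) ^ (-(2 * m : ℤ)) := by gcongr
      _ ≤ _ := by
          rw [one_mul]
          exact zpow_le_zpow_right₀ hp1.le (by omega)
  · rw [norm_div, norm_mul, norm_pow, norm_two_eq, div_le_iff₀ (by positivity),
      ← zpow_add₀ hpR.ne']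
    calc _ ≤ 1 * (p : ℝ) ^ (-(2 * m : ℤ)) := by gcongr; exact H.norm_α
      _ ≤ _ := by
          rw [one_mul]
          exact zpow_le_zpow_right₀ hp1.le (by omega)

/-- Modulo `p ^ N` the phase only depends on the class of its argument. -/
theorem periodic {N : ℕ} (hN : 1 ≤ N) (m : ℤ) :
    levelE p N (ψ ((m : ZMod (p ^ N)).val : ℤ)) = levelE p N (ψ m) := by
  set a : ℤ := ((m : ZMod (p ^ N)).val : ℤ) with ha
  have h0 : ((m - a : ℤ) : ZMod (p ^ N)) = 0 := by
    rw [ha]; push_cast; simp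
  have hn := (intCast_zmod_eq_zero_iff_norm N (m - a)).1 h0
  have h2 : N + ordTwo p ≤ 2 * N := by rw [ordTwo]; split_ifs <;> omega
  have key := H.levelE_add_of_linear hN h2 (norm_intCast_le_one a) hn
  have e : (a : ℚ_[p]) + ((m - a : ℤ) : ℚ_[p]) = m := by push_cast; ring
  have h1 : levelE p N (φ a * ((m - a : ℤ) : ℚ_[p])) = 1 := by
    refine padicE_eq_one ?_
    rw [norm_div, norm_mul, Padic.norm_p_pow]
    refine div_le_one_of_le₀ ?_ (by positivity)
    exact (mul_le_of_le_one_left (norm_nonneg _) (H.norm_φ _ (norm_intCast_le_one a))).trans hn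
  rw [e, h1, mul_one] at key
  exact key.symm

/-- The complete sum of `e((ψ(x) - j x) / p^N)` is concentrated at the stationary point `s(j)`, and
its local factor does not depend on `j`. -/
theorem exists_local_factor {N : ℕ} (hN : 1 ≤ N) (hN2 : p = 2 → 3 ≤ N) (hN3 : p = 3 → 2 ≤ N) :
    ∃ T : ℂ, ∀ j : ℤ, ∑ x : ZMod (p ^ N), levelE p N (ψ ((x.val : ℤ) : ℚ_[p])) *
        ZMod.stdAddChar (-((j : ZMod (p ^ N)) * x)) =
      T * levelE p N (ψ (s j) - j * s j) := by
  have hp1 := one_lt_natCast_prime (p := p)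
  have hpR : (0 : ℝ) < p := by linarith
  have hε : ordTwo p ≤ 1 ∧ (p ≠ 2 → ordTwo p = 0) := by
    rw [ordTwo]; split_ifs with h <;> simp [h]
  -- translations by `p ^ m` are used for averaging: `m` is large enough for the phase to be linear
  -- along them, and `N - m` is large enough for the Taylor remainder to vanish on the surviving terms
  obtain ⟨m, hm1, hmN, hm2, hm3, hm4⟩ : ∃ m, 1 ≤ m ∧ m ≤ N ∧ N + ordTwo p ≤ 2 * m ∧
      N ≤ ordTwo p + 1 + 2 * (N - m) ∧ (p = 2 ∨ p = 3 → 1 ≤ N - m) := by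
    refine ⟨(N + ordTwo p + 1) / 2, ?_⟩
    rcases eq_or_ne p 2 with h2 | h2
    · have := hN2 h2
      refine ⟨?_, ?_, ?_, ?_, ?_⟩ <;> omega
    · have := hε.2 h2
      refine ⟨?_, ?_, ?_, ?_, ?_⟩ <;> omega
  have hpN : (p : ℝ) ^ (-(N : ℤ)) ≤ 1 := zpow_le_one_of_nonpos₀ hp1.le (by omega)
  refine ⟨∑ v : ZMod (p ^ N), if v * (p : ZMod (p ^ N)) ^ m = 0
    then levelE p N (α * ((v.val : ℤ) : ℚ_[p]) ^ 2 / 2) else 0, fun j => ?_⟩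
  -- an integer close to the stationary point, and integers close to the derivative of the phase
  obtain ⟨a, ha⟩ := exists_int_norm_sub_le N (H.norm_s j (norm_intCast_le_one j))
  choose! c hc using fun x : ℤ =>
    exists_int_norm_sub_le N (H.norm_φ (x : ℚ_[p]) (norm_intCast_le_one x))
  have hφa : ∀ x : ℤ, ‖φ x - j‖ = ‖(x : ℚ_[p]) - s j‖ := fun x => by
    conv_lhs => rw [← H.φ_s (j : ℚ_[p]) (norm_intCast_le_one j)]
    exact H.isometry _ _ (norm_intCast_le_one x) (H.norm_s j (norm_intCast_le_one j))
  set f : ZMod (p ^ N) → ℂ := fun x => levelE p N (ψ ((x.val : ℤ) : ℚ_[p])) with hf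
  have hfint : ∀ k : ℤ, f k = levelE p N (ψ k) := fun k => H.periodic hN k
  set t : ZMod (p ^ N) → ℂ := fun v => f ((a : ZMod (p ^ N)) + v) *
    ZMod.stdAddChar (-((j : ZMod (p ^ N)) * ((a : ZMod (p ^ N)) + v))) with ht
  set cz : ZMod (p ^ N) → ZMod (p ^ N) := fun v =>
    ((c (a + v.val) - j : ℤ) : ZMod (p ^ N)) with hcz
  have hval : ∀ v : ZMod (p ^ N), ((v.val : ℤ) : ZMod (p ^ N)) = v := fun v => by simp
  have hstep : ∀ v b : ZMod (p ^ N),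
      t (v + (p : ZMod (p ^ N)) ^ m * b) =
        t v * ZMod.stdAddChar (b * (cz v * (p : ZMod (p ^ N)) ^ m)) := by
    intro v b
    set x : ℤ := a + v.val with hx
    set h : ℤ := (p : ℤ) ^ m * b.val with hh
    have hxz : (x : ZMod (p ^ N)) = (a : ZMod (p ^ N)) + v := by rw [hx]; push_cast; simp
    have hhz : (h : ZMod (p ^ N)) = (p : ZMod (p ^ N)) ^ m * b := by rw [hh]; push_cast; simp
    have hhn : ‖(h : ℚ_[p])‖ ≤ (p : ℝ) ^ (-(m : ℤ)) :=
      (Padic.norm_int_le_pow_iff_dvd h m).2 ⟨_, hh⟩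
    have h1 : f ((a : ZMod (p ^ N)) + (v + (p : ZMod (p ^ N)) ^ m * b)) =
        f ((a : ZMod (p ^ N)) + v) *
          ZMod.stdAddChar ((c x : ZMod (p ^ N)) * (h : ZMod (p ^ N))) := by
      rw [← add_assoc, ← hhz, ← hxz, ← Int.cast_add, hfint, hfint]
      push_cast
      rw [H.levelE_add_of_linear hm1 hm2 (norm_intCast_le_one x) hhn]
      congr 1
      rw [← Int.cast_mul, ← levelE_intCast]
      refine levelE_congr ?_
      push_cast
      rw [← sub_mul, norm_mul]
      exact (mul_le_of_le_one_right (norm_nonneg _) (norm_intCast_le_one h)).trans (hc x)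
    simp only [ht]
    rw [h1, mul_assoc, mul_assoc, ← AddChar.map_add_eq_mul, ← AddChar.map_add_eq_mul]
    congr 2
    simp only [hcz]
    rw [hhz]
    push_cast
    ring
  -- the surviving terms are those near the stationary point, where the phase is exactly quadratic
  have havg := sum_eq_sum_ite_of_translate t cz _ hstep
  have hiff : ∀ v : ZMod (p ^ N), cz v * (p : ZMod (p ^ N)) ^ m = 0 ↔
      v * (p : ZMod (p ^ N)) ^ m = 0 := by
    intro v
    set x : ℤ := a + v.val with hx
    have e1 : cz v * (p : ZMod (p ^ N)) ^ m = (((c x - j) * p ^ m : ℤ) : ZMod (p ^ N)) := by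
      simp only [hcz]; push_cast; ring
    have e2 : v * (p : ZMod (p ^ N)) ^ m = (((v.val : ℤ) * p ^ m : ℤ) : ZMod (p ^ N)) := by
      push_cast; simp
    have hpm : ‖((p : ℚ_[p]) ^ m)‖ ≤ 1 := by
      simpa using norm_natCast_le_one (p := p) (p ^ m)
    rw [e1, e2, intCast_zmod_eq_zero_iff_norm, intCast_zmod_eq_zero_iff_norm]
    push_cast
    have h1 : ‖((c x : ℚ_[p]) - j) * p ^ m - (φ x - j) * p ^ m‖ ≤ (p : ℝ) ^ (-(N : ℤ)) := by
      rw [← sub_mul, sub_sub_sub_cancel_right, norm_mul, norm_sub_rev]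
      exact (mul_le_of_le_one_right (norm_nonneg _) hpm).trans (hc x)
    have h2 : ‖((x : ℚ_[p]) - s j) * p ^ m - (v.val : ℚ_[p]) * p ^ m‖ ≤ (p : ℝ) ^ (-(N : ℤ)) := by
      rw [← sub_mul, norm_mul]
      refine (mul_le_of_le_one_right (norm_nonneg _) hpm).trans ?_
      have : (x : ℚ_[p]) - s j - (v.val : ℚ_[p]) = -(s j - a) := by
        rw [hx]; push_cast; ring
      rw [this, norm_neg]
      exact ha
    rw [norm_le_iff_of_norm_sub_le h1, norm_mul, hφa, ← norm_mul, norm_le_iff_of_norm_sub_le h2]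
  have ha1 : ‖φ a - j‖ ≤ (p : ℝ) ^ (-(N : ℤ)) := by rw [hφa, norm_sub_rev]; exact ha
  have hquad : ∀ v : ZMod (p ^ N), v * (p : ZMod (p ^ N)) ^ m = 0 →
      t v = levelE p N (ψ a - j * a) * levelE p N (α * ((v.val : ℤ) : ℚ_[p]) ^ 2 / 2) := by
    intro v hv
    set h : ℤ := (v.val : ℤ) with hh
    have e2 : v * (p : ZMod (p ^ N)) ^ m = ((h * p ^ m : ℤ) : ZMod (p ^ N)) := by
      rw [hh]; push_cast; simp
    rw [e2, intCast_zmod_eq_zero_iff_norm] at hv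
    push_cast at hv
    rw [norm_mul, Padic.norm_p_pow] at hv
    have hhn : ‖(h : ℚ_[p])‖ ≤ (p : ℝ) ^ (-((N - m : ℕ) : ℤ)) := by
      rw [← le_div_iff₀ (by positivity), ← zpow_sub₀ hpR.ne'] at hv
      refine hv.trans_eq ?_
      congr 1; omega
    have hsmall : p = 2 ∨ p = 3 → ‖(h : ℚ_[p])‖ ≤ (p : ℝ)⁻¹ := fun h23 => by
      refine hhn.trans ?_
      rw [← zpow_neg_one]
      exact zpow_le_zpow_right₀ hp1.le (by have := hm4 h23; omega)
    have hkey : f ((a : ZMod (p ^ N)) + v) *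
        ZMod.stdAddChar (-((j : ZMod (p ^ N)) * ((a : ZMod (p ^ N)) + v))) =
        levelE p N (ψ (a + h) - j * (a + h)) := by
      have e3 : (a : ZMod (p ^ N)) + v = ((a + h : ℤ) : ZMod (p ^ N)) := by
        rw [hh]; push_cast; simp
      rw [e3, hfint, ← Int.cast_mul, ← Int.cast_neg, ← levelE_intCast, ← levelE_add]
      push_cast
      congr 1; ring
    simp only [ht]
    rw [hkey, ← levelE_add]
    refine levelE_congr ?_
    have e : ψ (a + h) - j * (a + h) - (ψ a - j * a + α * (h : ℚ_[p]) ^ 2 / 2) =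
        (ψ (a + h) - ψ a - φ a * h - α * (h : ℚ_[p]) ^ 2 / 2) + (φ a - j) * h := by ring
    rw [e]
    refine (IsUltrametricDist.norm_add_le_max _ _).trans (max_le ?_ ?_)
    · refine (H.taylor a h (norm_intCast_le_one a) (norm_intCast_le_one h) hsmall).trans ?_
      rw [norm_mul, norm_two_eq, Padic.norm_p, ← zpow_neg_one, ← zpow_add₀ hpR.ne']
      calc _ ≤ (p : ℝ) ^ (-(ordTwo p : ℤ) + -1) * ((p : ℝ) ^ (-((N - m : ℕ) : ℤ))) ^ 2 := by gcongr
        _ = (p : ℝ) ^ (-(ordTwo p : ℤ) + -1 + -(2 * (N - m : ℕ) : ℤ)) := by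
            rw [← zpow_natCast, ← zpow_mul, ← zpow_add₀ hpR.ne']
            congr 1; push_cast; ring
        _ ≤ _ := zpow_le_zpow_right₀ hp1.le (by omega)
    · rw [norm_mul]
      exact (mul_le_of_le_one_right (norm_nonneg _) (norm_intCast_le_one h)).trans ha1
  have hdual : levelE p N (ψ (s j) - j * s j) = levelE p N (ψ a - j * a) := by
    have h2 : N + ordTwo p ≤ 2 * N := by omega
    have key := H.levelE_add_of_linear hN h2 (norm_intCast_le_one a) ha
    rw [add_sub_cancel] at key
    rw [sub_eq_add_neg, levelE_add, key, ← levelE_add, ← levelE_add]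
    refine levelE_congr ?_
    have e : ψ a + φ a * (s j - a) + -(j * s j) - (ψ a - j * a) = (φ a - j) * (s j - a) := by ring
    rw [e, norm_mul]
    exact (mul_le_of_le_one_right (norm_nonneg _) (ha.trans hpN)).trans ha1
  calc ∑ x : ZMod (p ^ N), f x * ZMod.stdAddChar (-((j : ZMod (p ^ N)) * x))
      = ∑ v, t v := by
        exact (Equiv.sum_comp (Equiv.addLeft (a : ZMod (p ^ N)))
          fun x => f x * ZMod.stdAddChar (-((j : ZMod (p ^ N)) * x))).symm
    _ = _ := by
        rw [havg, hdual, sum_mul]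
        refine sum_congr rfl fun v _ => ?_
        by_cases hv : v * (p : ZMod (p ^ N)) ^ m = 0
        · rw [if_pos ((hiff v).2 hv), if_pos hv, hquad v hv, mul_comm]
        · rw [if_neg (fun h => hv ((hiff v).1 h)), if_neg hv, zero_mul]

end IsQuadraticPhase

/-- Parseval's identity on `ZMod n` for unimodular functions. -/
theorem sum_normSq_dft_of_unimodular {n : ℕ} [NeZero n] {f : ZMod n → ℂ} (hf : ∀ x, ‖f x‖ = 1) :
    ∑ j : ZMod n, ‖∑ x : ZMod n, f x * ZMod.stdAddChar (-(j * x))‖ ^ 2 = (n : ℝ) ^ 2 := by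
  have hconj : ∀ z : ZMod n, (starRingEnd ℂ) (ZMod.stdAddChar z) = ZMod.stdAddChar (-z) :=
    fun z => (AddChar.map_neg_eq_conj _ z).symm
  have key : ∑ j : ZMod n, ((‖∑ x : ZMod n, f x * ZMod.stdAddChar (-(j * x))‖ ^ 2 : ℝ) : ℂ) =
      (n : ℂ) ^ 2 := by
    calc _ = ∑ j : ZMod n, ∑ x : ZMod n, ∑ y : ZMod n,
          f x * (starRingEnd ℂ) (f y) * ZMod.stdAddChar (j * (y - x)) := by
          refine sum_congr rfl fun j _ => ?_
          push_cast
          rw [← Complex.mul_conj', map_sum, sum_mul_sum]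
          refine sum_congr rfl fun x _ => sum_congr rfl fun y _ => ?_
          rw [map_mul, hconj, neg_neg, mul_sub, sub_eq_add_neg, AddChar.map_add_eq_mul]
          ring
      _ = ∑ x : ZMod n, ∑ y : ZMod n, f x * (starRingEnd ℂ) (f y) *
            ∑ j : ZMod n, ZMod.stdAddChar (j * (y - x)) := by
          rw [sum_comm]
          refine sum_congr rfl fun x _ => ?_
          rw [sum_comm]
          refine sum_congr rfl fun y _ => ?_
          rw [mul_sum]
      _ = ∑ x : ZMod n, (n : ℂ) := by
          refine sum_congr rfl fun x _ => ?_
          rw [sum_eq_single x]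
          · rw [AddChar.sum_mulShift _ (ZMod.isPrimitive_stdAddChar _), sub_self, if_pos rfl,
              Complex.mul_conj', hf, ZMod.card]
            simp
          · intro y _ hy
            rw [AddChar.sum_mulShift _ (ZMod.isPrimitive_stdAddChar _),
              if_neg (sub_ne_zero.2 hy), Nat.cast_zero, mul_zero]
          · simp
      _ = _ := by
          rw [sum_const, card_univ, ZMod.card, nsmul_eq_mul]; ring
  exact_mod_cast key

/-- The complete sums have modulus exactly `p ^ (N / 2)`, by Parseval. -/
theorem IsQuadraticPhase.exists_stationary_phase {ψ φ s : ℚ_[p] → ℚ_[p]} {α : ℚ_[p]}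
    (H : IsQuadraticPhase p ψ φ s α) {N : ℕ} (hN : 1 ≤ N) (hN2 : p = 2 → 3 ≤ N)
    (hN3 : p = 3 → 2 ≤ N) :
    ∃ T : ℂ, ‖T‖ ^ 2 = (p : ℝ) ^ N ∧
      ∀ j : ℤ, ∑ x : ZMod (p ^ N), levelE p N (ψ ((x.val : ℤ) : ℚ_[p])) *
        ZMod.stdAddChar (-((j : ZMod (p ^ N)) * x)) =
      T * levelE p N (ψ (s j) - j * s j) := by
  obtain ⟨T, hT⟩ := H.exists_local_factor hN hN2 hN3
  refine ⟨T, ?_, hT⟩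
  have h1 := sum_normSq_dft_of_unimodular (n := p ^ N)
    (f := fun x => levelE p N (ψ ((x.val : ℤ) : ℚ_[p]))) (fun x => norm_levelE _ _)
  have h2 : ∀ j : ZMod (p ^ N), ‖∑ x : ZMod (p ^ N), levelE p N (ψ ((x.val : ℤ) : ℚ_[p])) *
      ZMod.stdAddChar (-(j * x))‖ ^ 2 = ‖T‖ ^ 2 := by
    intro j
    have := hT (j.val : ℤ)
    rw [show (((j.val : ℤ)) : ZMod (p ^ N)) = j by simp] at this
    rw [this, norm_mul, norm_levelE, mul_one]
  rw [sum_congr rfl fun j _ => h2 j, sum_const, card_univ, ZMod.card, nsmul_eq_mul,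
    sq ((p ^ N : ℕ) : ℝ)] at h1
  have hne : ((p ^ N : ℕ) : ℝ) ≠ 0 := by exact_mod_cast pow_ne_zero _ hp.out.ne_zero
  have := mul_left_cancel₀ hne h1
  rw [this]; push_cast; rfl

end StationaryPhase

/-! ### Summation against a geometric sum -/

section DyadicSum

/-- `exp(2πix)`. -/
noncomputable def cexpTwoPi (x : ℝ) : ℂ := Complex.exp (2 * Real.pi * Complex.I * x)

theorem cexpTwoPi_add (x y : ℝ) : cexpTwoPi (x + y) = cexpTwoPi x * cexpTwoPi y := by
  rw [cexpTwoPi, cexpTwoPi, cexpTwoPi, ← Complex.exp_add]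
  push_cast
  congr 1; ring

theorem norm_cexpTwoPi (x : ℝ) : ‖cexpTwoPi x‖ = 1 := by
  rw [cexpTwoPi, show (2 * Real.pi * Complex.I * (x : ℂ)) =
    ((2 * Real.pi * x : ℝ) : ℂ) * Complex.I by push_cast; ring]
  exact Complex.norm_exp_ofReal_mul_I _

theorem geom_sum_cexpTwoPi (M : ℤ) (b : ℕ) (β : ℝ) :
    (∑ m ∈ Ioc M (M + b), cexpTwoPi (m * β)) * (cexpTwoPi β - 1) =
      cexpTwoPi ((M + b + 1 : ℤ) * β) - cexpTwoPi ((M + 1 : ℤ) * β) := by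
  induction b with
  | zero => simp
  | succ b ih =>
    have hI : Ioc M (M + (b + 1 : ℕ)) = insert (M + b + 1) (Ioc M (M + b)) := by
      ext x; simp only [mem_Ioc, mem_insert]; omega
    rw [hI, sum_insert (by simp), add_mul, ih, mul_sub, ← cexpTwoPi_add]
    have : ((M + b + 1 : ℤ) : ℝ) * β + β = ((M + (b + 1 : ℕ) + 1 : ℤ) : ℝ) * β := by
      push_cast; ring
    rw [this]; ring

theorem sin_pi_mul_ge {β m : ℝ} (hm : 0 ≤ m) (h1 : m ≤ β) (h2 : β ≤ 1 - m) :
    2 * m ≤ Real.sin (Real.pi * β) := by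
  have hpi := Real.pi_pos
  rcases le_total β (1 / 2) with h | h
  · have := Real.mul_le_sin (x := Real.pi * β) (by nlinarith) (by nlinarith)
    calc 2 * m ≤ 2 * β := by linarith
      _ = 2 / Real.pi * (Real.pi * β) := by field_simp
      _ ≤ _ := this
  · have := Real.mul_le_sin (x := Real.pi * (1 - β)) (by nlinarith) (by nlinarith)
    calc 2 * m ≤ 2 * (1 - β) := by linarith
      _ = 2 / Real.pi * (Real.pi * (1 - β)) := by field_simp
      _ ≤ Real.sin (Real.pi * (1 - β)) := this
      _ = Real.sin (Real.pi * β) := by rw [mul_sub, mul_one, Real.sin_pi_sub]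

/-- The real part of `1 / (e(β) - 1)` is constant, and its imaginary part is `-cot(πβ) / 2`. -/
theorem inv_cexpTwoPi_sub_one {β : ℝ} (hs : Real.sin (Real.pi * β) ≠ 0) :
    (-1 / 2 - Complex.I / 2 *
      ((Real.cos (Real.pi * β) / Real.sin (Real.pi * β) : ℝ) : ℂ)) * (cexpTwoPi β - 1) = 1 := by
  have hexp : cexpTwoPi β = ((Real.cos (Real.pi * β) : ℂ) +
      (Real.sin (Real.pi * β) : ℂ) * Complex.I) ^ 2 := by
    rw [Complex.ofReal_cos, Complex.ofReal_sin, ← Complex.exp_mul_I, ← Complex.exp_nat_mul,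
      cexpTwoPi]
    push_cast; congr 1; ring
  have hsq : (Real.sin (Real.pi * β) : ℂ) ^ 2 + (Real.cos (Real.pi * β) : ℂ) ^ 2 = 1 := by
    exact_mod_cast Real.sin_sq_add_cos_sq (Real.pi * β)
  have hs' : (Real.sin (Real.pi * β) : ℂ) ≠ 0 := by exact_mod_cast hs
  rw [hexp]
  push_cast [-Complex.ofReal_sin, -Complex.ofReal_cos]
  set s : ℂ := (Real.sin (Real.pi * β) : ℂ)
  set c : ℂ := (Real.cos (Real.pi * β) : ℂ)
  have hI : Complex.I ^ 2 = -1 := Complex.I_sq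
  field_simp
  have h1 : (c + Complex.I * s) ^ 2 - 1 = 2 * s * Complex.I * (c + s * Complex.I) := by
    linear_combination hsq - s ^ 2 * hI
  rw [h1]
  linear_combination (2 * s) * hsq + (-2 * s * c ^ 2 - 2 * s ^ 2 * c * Complex.I - 2 * s ^ 3) * hI

theorem cot_antitone_aux {x y : ℝ} (hx : 0 < x) (hxy : x ≤ y) (hy : y < Real.pi) :
    Real.cos y / Real.sin y ≤ Real.cos x / Real.sin x := by
  have hsx := Real.sin_pos_of_pos_of_lt_pi hx (by linarith)
  have hsy := Real.sin_pos_of_pos_of_lt_pi (by linarith : 0 < y) hy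
  rw [div_le_div_iff₀ hsy hsx]
  have := Real.sin_nonneg_of_nonneg_of_le_pi (x := y - x) (by linarith) (by linarith)
  rw [Real.sin_sub] at this
  linarith

/-- Abel summation against a bounded antitone weight. -/
theorem norm_sum_mul_antitone_le {L : ℕ} {c : ℕ → ℝ} {z : ℕ → ℂ} {W Z : ℝ}
    (hW0 : 0 ≤ W) (hc : ∀ i j, i ≤ j → j < L → c j ≤ c i) (hW : ∀ i < L, |c i| ≤ W)
    (hZ : ∀ n ≤ L, ‖∑ i ∈ range n, z i‖ ≤ Z) :
    ‖∑ i ∈ range L, (c i : ℂ) * z i‖ ≤ 3 * (W * Z) := by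
  have hZ0 : 0 ≤ Z := (norm_nonneg _).trans (hZ 0 (Nat.zero_le _))
  rcases Nat.eq_zero_or_pos L with rfl | hL
  · simp; positivity
  have hparts := sum_range_by_parts (fun i => (c i : ℂ)) z L
  simp only [smul_eq_mul] at hparts
  rw [hparts]
  have h1 : ‖(c (L - 1) : ℂ) * ∑ i ∈ range L, z i‖ ≤ W * Z := by
    rw [norm_mul, Complex.norm_real]
    gcongr
    exacts [hW _ (by omega), hZ L le_rfl]
  have h2 : ‖∑ i ∈ range (L - 1), ((c (i + 1) : ℂ) - c i) * ∑ i ∈ range (i + 1), z i‖ ≤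
      2 * (W * Z) := by
    calc _ ≤ ∑ i ∈ range (L - 1), (c i - c (i + 1)) * Z := by
          refine norm_sum_le_of_le _ fun i hi => ?_
          rw [mem_range] at hi
          rw [norm_mul, ← Complex.ofReal_sub, Complex.norm_real, norm_sub_rev, Real.norm_eq_abs,
            abs_of_nonneg (sub_nonneg.2 (hc i (i + 1) (by omega) (by omega)))]
          gcongr
          · exact sub_nonneg.2 (hc i (i + 1) (by omega) (by omega))
          · exact hZ _ (by omega)
      _ = (c 0 - c (L - 1)) * Z := by rw [← sum_mul, sum_range_sub']
      _ ≤ (W + W) * Z := by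
          gcongr
          have h3 := abs_le.1 (hW 0 hL)
          have h4 := abs_le.1 (hW (L - 1) (by omega))
          linarith
      _ = _ := by ring
  calc _ ≤ _ := norm_sub_le _ _
    _ ≤ W * Z + 2 * (W * Z) := add_le_add h1 h2
    _ = _ := by ring

/-- On a block where `β` stays at distance at least `m` from the integers, the geometric sum with
frequency `β` acts on sequences with small twisted partial sums as a weight of size `1 / m`. -/
theorem norm_sum_mul_geom_sum_le {L b : ℕ} {M : ℤ} {β : ℕ → ℝ} {z : ℕ → ℂ} {m Z : ℝ} (hm : 0 < m)
    (hβ : ∀ i j, i ≤ j → j < L → β i ≤ β j) (h1 : ∀ i < L, m ≤ β i) (h2 : ∀ i < L, β i ≤ 1 - m)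
    (hZ : ∀ k : ℤ, ∀ n ≤ L, ‖∑ i ∈ range n, z i * cexpTwoPi (k * β i)‖ ≤ Z) :
    ‖∑ i ∈ range L, z i * ∑ k ∈ Ioc M (M + b), cexpTwoPi (k * β i)‖ ≤ 2 * (Z / m) := by
  have hpi := Real.pi_pos
  have hZ0 : 0 ≤ Z := (norm_nonneg _).trans (hZ 0 0 (Nat.zero_le _))
  rcases Nat.eq_zero_or_pos L with rfl | hL
  · simp; positivity
  have hm2 : m ≤ 1 / 2 := by linarith [h1 0 hL, h2 0 hL]
  set c : ℕ → ℝ := fun i => Real.cos (Real.pi * β i) / Real.sin (Real.pi * β i) / 2 with hc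
  have hs : ∀ i < L, 2 * m ≤ Real.sin (Real.pi * β i) := fun i hi =>
    sin_pi_mul_ge hm.le (h1 i hi) (h2 i hi)
  -- one end point of the geometric sum
  have hone : ∀ k : ℤ, ‖∑ i ∈ range L, (-1 / 2 - Complex.I * (c i : ℂ)) *
      (z i * cexpTwoPi (k * β i))‖ ≤ Z / m := by
    intro k
    have hcot : ‖∑ i ∈ range L, (c i : ℂ) * (z i * cexpTwoPi (k * β i))‖ ≤
        3 * ((1 / (4 * m)) * Z) := by
      refine norm_sum_mul_antitone_le (by positivity) (fun i j hij hj => ?_) (fun i hi => ?_) (hZ k)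
      · simp only [hc]
        gcongr ?_ / 2
        have e1 := h1 i (by omega)
        have e2 := h2 j hj
        refine cot_antitone_aux (by nlinarith) ?_ (by nlinarith)
        exact mul_le_mul_of_nonneg_left (hβ i j hij hj) hpi.le
      · have hsi := hs i hi
        simp only [hc]
        rw [abs_div, abs_div, abs_of_pos (by linarith : 0 < Real.sin (Real.pi * β i)), abs_two,
          div_div, div_le_div_iff₀ (by linarith) (by positivity)]
        have := Real.abs_cos_le_one (Real.pi * β i)
        nlinarith
    have e : ∑ i ∈ range L, (-1 / 2 - Complex.I * (c i : ℂ)) * (z i * cexpTwoPi (k * β i)) =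
        (-1 / 2) * ∑ i ∈ range L, z i * cexpTwoPi (k * β i) -
          Complex.I * ∑ i ∈ range L, (c i : ℂ) * (z i * cexpTwoPi (k * β i)) := by
      rw [mul_sum, mul_sum, ← sum_sub_distrib]
      exact sum_congr rfl fun i _ => by ring
    rw [e]
    refine (norm_sub_le _ _).trans ?_
    rw [norm_mul, norm_mul, Complex.norm_I, one_mul]
    have h12 : ‖(-1 / 2 : ℂ)‖ = 1 / 2 := by norm_num
    rw [h12]
    calc _ ≤ 1 / 2 * Z + 3 * (1 / (4 * m) * Z) := add_le_add (by gcongr; exact hZ k L le_rfl) hcot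
      _ ≤ 1 / (4 * m) * Z + 3 * (1 / (4 * m) * Z) := by
          gcongr
          linarith
      _ = _ := by field_simp; ring
  have e : ∑ i ∈ range L, z i * ∑ k ∈ Ioc M (M + b), cexpTwoPi (k * β i) =
      ∑ i ∈ range L, (-1 / 2 - Complex.I * (c i : ℂ)) *
        (z i * cexpTwoPi ((M + b + 1 : ℤ) * β i)) -
      ∑ i ∈ range L, (-1 / 2 - Complex.I * (c i : ℂ)) * (z i * cexpTwoPi ((M + 1 : ℤ) * β i)) := by
    rw [← sum_sub_distrib]
    refine sum_congr rfl fun i hi => ?_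
    have hsi : Real.sin (Real.pi * β i) ≠ 0 := by
      have := hs i (mem_range.1 hi)
      intro h0
      rw [h0] at this
      linarith
    have hinv := inv_cexpTwoPi_sub_one hsi
    have hgeo := geom_sum_cexpTwoPi M b (β i)
    have hci : (c i : ℂ) = ((Real.cos (Real.pi * β i) / Real.sin (Real.pi * β i) : ℝ) : ℂ) / 2 := by
      simp only [hc]; push_cast; rfl
    rw [hci]
    linear_combination (-(z i * ∑ k ∈ Ioc M (M + b), cexpTwoPi (k * β i))) * hinv +
      (-1 / 2 - Complex.I / 2 *
        ((Real.cos (Real.pi * β i) / Real.sin (Real.pi * β i) : ℝ) : ℂ)) * z i * hgeo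
  rw [e]
  refine (norm_sub_le _ _).trans ?_
  calc _ ≤ Z / m + Z / m := add_le_add (hone _) (hone _)
    _ = _ := by ring

/-- Dyadic decomposition of an interval starting at `0`. -/
theorem norm_sum_dyadic_le {H a R : ℕ} (ha : 1 ≤ a) (hR : H ≤ 2 ^ R) {z : ℕ → ℂ} {Y : ℝ}
    {G : ℕ → ℝ} (hY : ‖∑ i ∈ range (min a H), z i‖ ≤ Y) (hG0 : ∀ r, 0 ≤ G r)
    (hG : ∀ r L, a * 2 ^ r + L ≤ H → L ≤ a * 2 ^ r →
      ‖∑ i ∈ range L, z (a * 2 ^ r + i)‖ ≤ G r) :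
    ‖∑ i ∈ range H, z i‖ ≤ Y + ∑ r ∈ range R, G r := by
  have key : ∀ r, ‖∑ i ∈ range (min (a * 2 ^ r) H), z i‖ ≤ Y + ∑ s ∈ range r, G s := by
    intro r
    induction r with
    | zero => simpa using hY
    | succ r ih =>
      rw [sum_range_succ, ← add_assoc]
      rcases le_total H (a * 2 ^ r) with h | h
      · rw [min_eq_right h] at ih
        rw [min_eq_right (h.trans (by gcongr <;> omega))]
        linarith [hG0 r]
      · rw [min_eq_left h] at ih
        have hle : a * 2 ^ r ≤ a * 2 ^ (r + 1) := by gcongr <;> omega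
        obtain ⟨L, hL⟩ := Nat.exists_eq_add_of_le (le_min hle h)
        rw [hL, sum_range_add]
        refine (norm_add_le _ _).trans (add_le_add ih (hG r L ?_ ?_))
        · have := min_le_right (a * 2 ^ (r + 1)) H; omega
        · have := min_le_left (a * 2 ^ (r + 1)) H
          have e : a * 2 ^ (r + 1) = a * 2 ^ r * 2 := by ring
          omega
  have h := key R
  rwa [min_eq_right] at h
  calc H ≤ 2 ^ R := hR
    _ = 1 * 2 ^ R := (one_mul _).symm
    _ ≤ a * 2 ^ R := by gcongr

/-- The sum of a sequence with small twisted partial sums against geometric sums whose frequencies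
`(i + τ) / P` run once through the circle. The frequencies within `a / P` of the integers form the
central blocks; the others are divided into dyadic blocks according to their distance from the
integers. -/
theorem norm_sum_mul_geom_sum_circle_le {P b a R : ℕ} {M : ℤ} {τ K σ : ℝ} (hP : 1 ≤ P)
    (hτ0 : 0 ≤ τ) (hτ1 : τ ≤ 1) (hK : 0 ≤ K) (hσ : 0 ≤ σ) (ha : 1 ≤ a) (hR : P ≤ 2 ^ R)
    {z : ℕ → ℂ}
    (hz : ∀ (k : ℤ) (i₀ L : ℕ), i₀ + L ≤ P →
      ‖∑ i ∈ range L, z (i₀ + i) * cexpTwoPi (k * (((i₀ + i : ℕ) + τ) / P))‖ ≤ K * (L : ℝ) ^ σ) :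
    ‖∑ i ∈ range P, z i * ∑ k ∈ Ioc M (M + b), cexpTwoPi (k * ((i + τ) / P))‖ ≤
      2 * (b * (K * (a : ℝ) ^ σ) + ∑ r ∈ range R,
        2 * (K * ((a * 2 ^ r : ℕ) : ℝ) ^ σ / ((a * 2 ^ r : ℕ) / P))) := by
  have hPR : (0 : ℝ) < P := by exact_mod_cast hP
  set g : ℕ → ℂ := fun i => z i * ∑ k ∈ Ioc M (M + b), cexpTwoPi (k * ((i + τ) / P)) with hg
  -- short blocks, by interchanging the summations
  have hshort : ∀ i₀ L, i₀ + L ≤ P → L ≤ a →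
      ‖∑ i ∈ range L, g (i₀ + i)‖ ≤ b * (K * (a : ℝ) ^ σ) := by
    intro i₀ L hL hLa
    have e : ∑ i ∈ range L, g (i₀ + i) = ∑ k ∈ Ioc M (M + b), ∑ i ∈ range L,
        z (i₀ + i) * cexpTwoPi (k * (((i₀ + i : ℕ) + τ) / P)) := by
      simp only [hg, mul_sum]
      rw [sum_comm]
    rw [e]
    calc _ ≤ ∑ k ∈ Ioc M (M + b), ‖∑ i ∈ range L,
          z (i₀ + i) * cexpTwoPi (k * (((i₀ + i : ℕ) + τ) / P))‖ := norm_sum_le _ _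
      _ ≤ ∑ k ∈ Ioc M (M + b), K * (a : ℝ) ^ σ :=
          sum_le_sum fun k _ => (hz k i₀ L hL).trans (by gcongr)
      _ = _ := by
          rw [sum_const, Int.card_Ioc, nsmul_eq_mul]
          congr 2
          omega
  -- blocks at distance at least `A / P` from the integers
  have hfar : ∀ i₀ L A, 1 ≤ A → L ≤ A → A ≤ i₀ → i₀ + L + A ≤ P →
      ‖∑ i ∈ range L, g (i₀ + i)‖ ≤ 2 * (K * (A : ℝ) ^ σ / ((A : ℝ) / P)) := by
    intro i₀ L A hA hLA hAi hP'
    have hAR : (0 : ℝ) < A := by exact_mod_cast hA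
    refine norm_sum_mul_geom_sum_le (β := fun i => (((i₀ + i : ℕ) : ℝ) + τ) / P)
      (z := fun i => z (i₀ + i)) (by positivity) (fun i j hij _ => ?_) (fun i hi => ?_)
      (fun i hi => ?_) (fun k n hn => (hz k i₀ n (by omega)).trans ?_)
    · gcongr
    · gcongr
      have : (A : ℝ) ≤ ((i₀ + i : ℕ) : ℝ) := by exact_mod_cast (by omega : A ≤ i₀ + i)
      linarith
    · rw [div_le_iff₀ hPR, sub_mul, div_mul_cancel₀ _ hPR.ne', one_mul]
      have : (((i₀ + i + 1 + A : ℕ)) : ℝ) ≤ P := by exact_mod_cast (by omega : i₀ + i + 1 + A ≤ P)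
      push_cast at this ⊢
      linarith
    · gcongr
      exact_mod_cast hn.trans hLA
  set H := (P + 1) / 2 with hH
  -- the upper half of the circle is summed downwards from `P - 1`
  have hrefl : ∀ i₀ L, i₀ + L ≤ P - H → ∑ i ∈ range L, g (P - 1 - (i₀ + i)) =
      ∑ i ∈ range L, g ((P - i₀ - L) + i) := by
    intro i₀ L h
    rw [← sum_range_reflect]
    refine sum_congr rfl fun i hi => ?_
    rw [mem_range] at hi
    congr 1
    omega
  have hpow : ∀ r, 1 ≤ a * 2 ^ r := fun r => Nat.mul_pos ha (by positivity)
  have hlow : ‖∑ i ∈ range H, g i‖ ≤ b * (K * (a : ℝ) ^ σ) + ∑ r ∈ range R,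
      2 * (K * ((a * 2 ^ r : ℕ) : ℝ) ^ σ / ((a * 2 ^ r : ℕ) / P)) := by
    refine norm_sum_dyadic_le ha (by omega) ?_ (fun r => by positivity) fun r L h1 h2 => ?_
    · have := hshort 0 (min a H) (by omega) (min_le_left _ _)
      simpa using this
    · rcases Nat.eq_zero_or_pos L with rfl | hL
      · simp; positivity
      · exact hfar _ L _ (hpow r) h2 le_rfl (by omega)
  have hhigh : ‖∑ i ∈ range (P - H), g (P - 1 - i)‖ ≤ b * (K * (a : ℝ) ^ σ) + ∑ r ∈ range R,
      2 * (K * ((a * 2 ^ r : ℕ) : ℝ) ^ σ / ((a * 2 ^ r : ℕ) / P)) := by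
    refine norm_sum_dyadic_le ha (by omega) ?_ (fun r => by positivity) fun r L h1 h2 => ?_
    · have h0 := hrefl 0 (min a (P - H)) (by omega)
      simp only [zero_add] at h0
      rw [h0]
      exact hshort _ _ (by omega) (min_le_left _ _)
    · rcases Nat.eq_zero_or_pos L with rfl | hL
      · simp; positivity
      · rw [hrefl _ L h1]
        exact hfar _ L _ (hpow r) h2 (by omega) (by omega)
  have hsplit : ∑ i ∈ range P, g i = ∑ i ∈ range H, g i + ∑ i ∈ range (P - H), g (P - 1 - i) := by
    have hPH : P = H + (P - H) := by omega
    conv_lhs => rw [hPH, sum_range_add]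
    congr 1
    have h0 := hrefl 0 (P - H) (by omega)
    simp only [zero_add] at h0
    rw [h0]
    refine sum_congr rfl fun i hi => ?_
    congr 1
    omega
  rw [hsplit]
  refine (norm_add_le _ _).trans ?_
  linarith

/-- The sum over dyadic scales `2 ^ r`, `r < R`, of `(2 ^ r) ^ (σ - 1)`, plus one for the central
block. -/
noncomputable def dyadicFactor (σ : ℝ) (R : ℕ) : ℝ := 1 + ∑ r ∈ range R, ((2 : ℝ) ^ (σ - 1)) ^ r

theorem norm_sum_mul_geom_sum_le_dyadicFactor {P b R : ℕ} {M : ℤ} {τ K σ B : ℝ} (hP : 1 ≤ P)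
    (hτ0 : 0 ≤ τ) (hτ1 : τ ≤ 1) (hK : 0 ≤ K) (hσ : 0 ≤ σ) (hσ1 : σ ≤ 1) (hR : P ≤ 2 ^ R)
    (hB : 0 < B) (hBP : B ≤ P) (hb : b ≤ B) {z : ℕ → ℂ}
    (hz : ∀ (k : ℤ) (i₀ L : ℕ), i₀ + L ≤ P →
      ‖∑ i ∈ range L, z (i₀ + i) * cexpTwoPi (k * (((i₀ + i : ℕ) + τ) / P))‖ ≤ K * (L : ℝ) ^ σ) :
    ‖∑ i ∈ range P, z i * ∑ k ∈ Ioc M (M + b), cexpTwoPi (k * ((i + τ) / P))‖ ≤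
      4 * (K * P * ((P : ℝ) / B) ^ (σ - 1) * dyadicFactor σ R) := by
  have hPR : (0 : ℝ) < P := by exact_mod_cast hP
  set x := (P : ℝ) / B with hx
  have hx1 : 1 ≤ x := (one_le_div hB).2 hBP
  have hx0 : 0 < x := by linarith
  -- this width makes the bounds for the central and for the first dyadic block comparable
  set a := ⌈x⌉₊ with ha
  have hax : x ≤ a := Nat.le_ceil x
  have ha0 : (0 : ℝ) < a := by linarith
  have ha2 : (a : ℝ) ≤ 2 * x := by
    have := Nat.ceil_lt_add_one hx0.le
    linarith
  have ha1 : 1 ≤ a := Nat.one_le_iff_ne_zero.2 fun h => by rw [h] at ha0; simp at ha0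
  refine (norm_sum_mul_geom_sum_circle_le hP hτ0 hτ1 hK hσ ha1 hR hz).trans ?_
  have hcentral : b * (K * (a : ℝ) ^ σ) ≤ 2 * (K * P * x ^ (σ - 1)) := by
    have h1 : (a : ℝ) ^ σ ≤ 2 * x ^ σ := by
      calc (a : ℝ) ^ σ ≤ (2 * x) ^ σ := by gcongr
        _ = 2 ^ σ * x ^ σ := Real.mul_rpow (by norm_num) hx0.le
        _ ≤ 2 ^ (1 : ℝ) * x ^ σ := by
            gcongr
            norm_num
        _ = _ := by rw [Real.rpow_one]
    calc b * (K * (a : ℝ) ^ σ) ≤ B * (K * (2 * x ^ σ)) := by gcongr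
      _ = 2 * (K * P * x ^ (σ - 1)) := by
          rw [Real.rpow_sub hx0, Real.rpow_one, hx]; field_simp
  have houter : ∀ r, K * ((a * 2 ^ r : ℕ) : ℝ) ^ σ / ((a * 2 ^ r : ℕ) / P) ≤
      K * P * x ^ (σ - 1) * ((2 : ℝ) ^ (σ - 1)) ^ r := by
    intro r
    push_cast
    have h2 : (0 : ℝ) < 2 ^ r := by positivity
    calc K * ((a : ℝ) * 2 ^ r) ^ σ / ((a : ℝ) * 2 ^ r / P)
        = K * P * ((a : ℝ) * 2 ^ r) ^ (σ - 1) := by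
          rw [Real.rpow_sub (by positivity), Real.rpow_one]; field_simp
      _ = K * P * ((a : ℝ) ^ (σ - 1) * ((2 : ℝ) ^ (σ - 1)) ^ r) := by
          rw [Real.mul_rpow ha0.le h2.le, ← Real.rpow_natCast, ← Real.rpow_mul (by norm_num),
            ← Real.rpow_mul_natCast (by norm_num), mul_comm (r : ℝ)]
      _ ≤ K * P * (x ^ (σ - 1) * ((2 : ℝ) ^ (σ - 1)) ^ r) := by
          gcongr ?_ * (?_ * _)
          exact Real.rpow_le_rpow_of_nonpos hx0 hax (by linarith)
      _ = _ := by ring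
  calc _ ≤ 2 * (2 * (K * P * x ^ (σ - 1)) +
        ∑ r ∈ range R, 2 * (K * P * x ^ (σ - 1) * ((2 : ℝ) ^ (σ - 1)) ^ r)) := by
        gcongr with r
        exact houter r
    _ = _ := by rw [dyadicFactor, ← mul_sum, ← mul_sum]; ring

theorem dyadicFactor_le_of_lt_one {σ : ℝ} (hσ : σ < 1) (R : ℕ) :
    dyadicFactor σ R ≤ 1 + (1 - (2 : ℝ) ^ (σ - 1))⁻¹ := by
  rw [dyadicFactor]
  gcongr
  have h1 : (2 : ℝ) ^ (σ - 1) < 1 := Real.rpow_lt_one_of_one_lt_of_neg (by norm_num) (by linarith)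
  have h0 : (0 : ℝ) ≤ (2 : ℝ) ^ (σ - 1) := by positivity
  rw [← tsum_geometric_of_lt_one h0 h1]
  exact (summable_geometric_of_lt_one h0 h1).sum_le_tsum _ fun _ _ => by positivity

theorem dyadicFactor_one (R : ℕ) : dyadicFactor 1 R = 1 + R := by
  simp [dyadicFactor]

theorem one_add_clog_le {P : ℕ} (hP : 2 ≤ P) :
    1 + (Nat.clog 2 P : ℝ) ≤ 3 / Real.log 2 * Real.log P := by
  have hlog2 : 0 < Real.log 2 := Real.log_pos (by norm_num)
  have hle : Real.log 2 ≤ Real.log P := Real.log_le_log (by norm_num) (by exact_mod_cast hP)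
  have h1 : 2 ^ (Nat.clog 2 P).pred < P := Nat.pow_pred_clog_lt_self (by norm_num) hP
  have hpos : 0 < Nat.clog 2 P := Nat.clog_pos (by norm_num) hP
  have h2 : ((Nat.clog 2 P : ℝ) - 1) * Real.log 2 ≤ Real.log P := by
    have h3 : Real.log ((2 : ℝ) ^ (Nat.clog 2 P).pred) ≤ Real.log P := by
      refine Real.log_le_log (by positivity) ?_
      exact_mod_cast h1.le
    rw [Real.log_pow] at h3
    have h4 : ((Nat.clog 2 P).pred : ℝ) = (Nat.clog 2 P : ℝ) - 1 := by
      rw [Nat.pred_eq_sub_one, Nat.cast_sub hpos]; simp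
    rwa [h4] at h3
  rw [div_mul_eq_mul_div, le_div_iff₀ hlog2]
  linarith

end DyadicSum

/-! ### Poisson summation -/

section Poisson

variable {p : ℕ} [hp : Fact p.Prime]

theorem sum_zmod_eq_sum_range {n : ℕ} [NeZero n] (F : ZMod n → ℂ) (j₀ : ℤ) :
    ∑ j, F j = ∑ i ∈ range n, F ((j₀ + i : ℤ) : ZMod n) := by
  rw [← Equiv.sum_comp (Equiv.addLeft ((j₀ : ℤ) : ZMod n)) F]
  symm
  refine sum_bij (fun i _ => (i : ZMod n)) (fun _ _ => mem_univ _) (fun a ha b hb hab => ?_)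
    (fun x _ => ⟨x.val, mem_range.2 x.val_lt, by simp⟩) (fun i _ => by simp)
  rw [mem_range] at ha hb
  simpa [Nat.mod_eq_of_lt ha, Nat.mod_eq_of_lt hb] using congrArg ZMod.val hab

theorem dft_inversion {n : ℕ} [NeZero n] (f : ZMod n → ℂ) (m : ZMod n) :
    ∑ j : ZMod n, (∑ x : ZMod n, f x * ZMod.stdAddChar (-(j * x))) * ZMod.stdAddChar (j * m) =
      n * f m := by
  calc _ = ∑ x : ZMod n, f x * ∑ j : ZMod n, ZMod.stdAddChar (j * (m - x)) := by
        simp only [sum_mul, mul_sum]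
        rw [sum_comm]
        refine sum_congr rfl fun x _ => sum_congr rfl fun j _ => ?_
        rw [mul_assoc, ← AddChar.map_add_eq_mul]
        congr 2; ring
    _ = ∑ x : ZMod n, f x * if x = m then (n : ℂ) else 0 := by
        refine sum_congr rfl fun x _ => ?_
        rw [AddChar.sum_mulShift _ (ZMod.isPrimitive_stdAddChar n), ZMod.card]
        simp only [sub_eq_zero, eq_comm (a := m)]
        split_ifs <;> simp
    _ = n * f m := by simp [mul_comm]

theorem stdAddChar_intCast_mul (n : ℕ) [NeZero n] (a b : ℤ) :
    ZMod.stdAddChar ((a : ZMod n) * (b : ZMod n)) = cexpTwoPi (b * (a / n)) := by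
  rw [← Int.cast_mul, ZMod.stdAddChar_coe, cexpTwoPi]
  push_cast
  congr 1; ring

theorem levelE_intCast_mul (N : ℕ) (a b : ℤ) :
    levelE p N ((a : ℚ_[p]) * b) = cexpTwoPi (b * (a / ((p ^ N : ℕ) : ℝ))) := by
  rw [← Int.cast_mul, levelE_intCast, Int.cast_mul, stdAddChar_intCast_mul]

/-- Completion of a sum twisted by `e(θ m)`: the frequencies `j / p ^ N`, shifted by `θ`, become
`(i + τ) / p ^ N` with `0 ≤ i < p ^ N` and `0 ≤ τ < 1`, and stationary phase turns the Fourier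
coefficients into values of the dual phase. The hypothesis on all linear twists of the dual sum
controls its partial sums against each exponential occurring in the geometric sums. -/
theorem IsQuadraticPhase.norm_sum_le {ψ φ s : ℚ_[p] → ℚ_[p]} {α : ℚ_[p]}
    (H : IsQuadraticPhase p ψ φ s α) {N : ℕ} (hN : 1 ≤ N) (hN2 : p = 2 → 3 ≤ N)
    (hN3 : p = 3 → 2 ≤ N) {K σ B θ : ℝ} (hK : 0 ≤ K) (hσ : 0 ≤ σ) (hσ1 : σ ≤ 1)
    (hB : 0 < B) (hBP : B ≤ (p : ℝ) ^ N) {M : ℤ} {b : ℕ} (hb : b ≤ B)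
    (hdual : ∀ (k M' : ℤ) (L : ℕ), 1 ≤ L → L ≤ p ^ N →
      ‖∑ m ∈ Ioc M' (M' + L), levelE p N (ψ (s m) - m * s m + k * m)‖ ≤ K * (L : ℝ) ^ σ) :
    ‖∑ m ∈ Ioc M (M + b), cexpTwoPi (m * θ) * levelE p N (ψ m)‖ ≤
      4 * (K * √((p : ℝ) ^ N) * ((p : ℝ) ^ N / B) ^ (σ - 1) *
        dyadicFactor σ (Nat.clog 2 (p ^ N))) := by
  obtain ⟨T, hT, hG⟩ := H.exists_stationary_phase hN hN2 hN3
  have hP1 : 1 ≤ p ^ N := Nat.one_le_pow _ _ hp.out.pos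
  have hPR : (0 : ℝ) < (p : ℝ) ^ N := by exact_mod_cast hP1
  have hPC : (((p ^ N : ℕ) : ℕ) : ℂ) ≠ 0 := by exact_mod_cast (by omega : p ^ N ≠ 0)
  have hTn : ‖T‖ = √((p : ℝ) ^ N) := by rw [← hT, Real.sqrt_sq (norm_nonneg _)]
  set P : ℕ := p ^ N with hPdef
  have hPcast : (P : ℝ) = (p : ℝ) ^ N := by rw [hPdef]; push_cast; rfl
  set j₀ : ℤ := -⌊θ * P⌋ with hj₀
  set τ : ℝ := Int.fract (θ * P) with hτ
  have hθ : θ = (τ - j₀) / P := by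
    rw [eq_div_iff (by rw [hPcast]; exact hPR.ne'), hτ, hj₀, Int.fract]
    push_cast; ring
  set z : ℕ → ℂ := fun i => levelE p N (ψ (s ((j₀ + i : ℤ) : ℚ_[p])) -
    ((j₀ + i : ℤ) : ℚ_[p]) * s ((j₀ + i : ℤ) : ℚ_[p])) with hz
  have hinv : ∀ m : ℤ, levelE p N (ψ m) =
      (P : ℂ)⁻¹ * (T * ∑ i ∈ range P, z i * cexpTwoPi (m * (((j₀ + i : ℤ) : ℝ) / P))) := by
    intro m
    have h1 := dft_inversion (fun x : ZMod P => levelE p N (ψ ((x.val : ℤ) : ℚ_[p]))) (m : ZMod P)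
    rw [sum_zmod_eq_sum_range _ j₀, H.periodic hN] at h1
    rw [eq_inv_mul_iff_mul_eq₀ hPC, ← h1, mul_sum]
    refine sum_congr rfl fun i _ => ?_
    rw [hG, stdAddChar_intCast_mul, mul_assoc]
  have hsum : ∑ m ∈ Ioc M (M + b), cexpTwoPi (m * θ) * levelE p N (ψ m) =
      (P : ℂ)⁻¹ * (T * ∑ i ∈ range P, z i *
        ∑ k ∈ Ioc M (M + b), cexpTwoPi (k * ((i + τ) / P))) := by
    simp only [hinv, mul_sum]
    rw [sum_comm]
    refine sum_congr rfl fun i _ => sum_congr rfl fun m _ => ?_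
    have e : cexpTwoPi (m * ((i + τ) / P)) =
        cexpTwoPi (m * θ) * cexpTwoPi (m * (((j₀ + i : ℤ) : ℝ) / P)) := by
      rw [← cexpTwoPi_add, hθ]
      congr 1
      push_cast; ring
    rw [e]; ring
  have hpartial : ∀ (k : ℤ) (i₀ L : ℕ), i₀ + L ≤ P →
      ‖∑ i ∈ range L, z (i₀ + i) * cexpTwoPi (k * (((i₀ + i : ℕ) + τ) / P))‖ ≤
        K * (L : ℝ) ^ σ := by
    intro k i₀ L hL
    rcases Nat.eq_zero_or_pos L with rfl | hL0
    · simp; positivity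
    refine le_trans (le_of_eq ?_) (hdual k (j₀ + i₀ - 1) L hL0 (by omega))
    have e : ∑ m ∈ Ioc (j₀ + i₀ - 1) (j₀ + i₀ - 1 + L),
        levelE p N (ψ (s m) - m * s m + k * m) =
        ∑ i ∈ range L, z (i₀ + i) * cexpTwoPi (k * (((j₀ + (i₀ + i : ℕ) : ℤ) : ℝ) / P)) := by
      symm
      refine sum_bij (fun i _ => j₀ + (i₀ + i : ℕ)) (fun i hi => ?_) (fun i _ j _ h => ?_)
        (fun m hm => ?_) (fun i _ => ?_)
      · rw [mem_range] at hi; rw [mem_Ioc]; push_cast; omega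
      · omega
      · rw [mem_Ioc] at hm
        exact ⟨(m - j₀ - i₀).toNat, mem_range.2 (by omega), by omega⟩
      · rw [levelE_add, mul_comm (k : ℚ_[p]), levelE_intCast_mul]
    have e2 : ∀ i : ℕ, z (i₀ + i) * cexpTwoPi (k * (((i₀ + i : ℕ) + τ) / P)) =
        cexpTwoPi (k * ((τ - j₀) / P)) *
          (z (i₀ + i) * cexpTwoPi (k * (((j₀ + (i₀ + i : ℕ) : ℤ) : ℝ) / P))) := by
      intro i
      have : cexpTwoPi (k * (((i₀ + i : ℕ) + τ) / P)) = cexpTwoPi (k * ((τ - j₀) / P)) *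
          cexpTwoPi (k * (((j₀ + (i₀ + i : ℕ) : ℤ) : ℝ) / P)) := by
        rw [← cexpTwoPi_add]
        congr 1
        push_cast; ring
      rw [this]; ring
    simp only [e2]
    rw [e, ← mul_sum, norm_mul, norm_cexpTwoPi, one_mul]
  have hmain := norm_sum_mul_geom_sum_le_dyadicFactor (M := M) (b := b) hP1 (Int.fract_nonneg _)
    (Int.fract_lt_one _).le hK hσ hσ1 (Nat.le_pow_clog one_lt_two P) hB (by rwa [hPcast]) hb
    hpartial
  rw [hsum, norm_mul, norm_mul, norm_inv, Complex.norm_natCast, hTn]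
  refine (mul_le_mul_of_nonneg_left (mul_le_mul_of_nonneg_left hmain (by positivity))
    (by positivity)).trans_eq ?_
  rw [hPcast]
  field_simp

end Poisson

/-! ### The sum over a phase and the sums over its dual phases -/

section Dual

variable {p : ℕ} [hp : Fact p.Prime]

theorem iotaP'_four : iotaP' p 4 = 2 * iotaP' p 2 := by
  have h : padicValRat p 4 = padicValRat p 2 + padicValRat p 2 := by
    rw [← padicValRat.mul two_ne_zero two_ne_zero]; norm_num
  rw [iotaP', iotaP', h]; omega

theorem iotaP'_twelve : iotaP' p 12 = 2 * iotaP' p 2 + iotaP' p 3 := by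
  have h : padicValRat p 12 = padicValRat p 2 + padicValRat p 2 + padicValRat p 3 := by
    rw [← padicValRat.mul two_ne_zero two_ne_zero, ← padicValRat.mul (by norm_num) (by norm_num)]
    norm_num
  have h2 : 0 ≤ padicValRat p 2 := by
    rw [show (2 : ℚ) = (2 : ℕ) by norm_num, padicValRat.of_nat]; exact Int.natCast_nonneg _
  have h3 : 0 ≤ padicValRat p 3 := by
    rw [show (3 : ℚ) = (3 : ℕ) by norm_num, padicValRat.of_nat]; exact Int.natCast_nonneg _
  rw [iotaP', iotaP', iotaP', h]; omega

theorem iotaP'_self : iotaP' p p = 1 := by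
  rw [iotaP', padicValRat.self hp.out.one_lt]; rfl

theorem NormalisedDeriv.isQuadraticPhase {y : ℚ} {κ : ℕ} {lam : ℝ} {u : ℕ} {ω ω' : ℤ_[p]ˣ}
    {φ E S : PowerSeries ℚ_[p]} (h : NormalisedDeriv p y κ lam u ω ω' φ E) (hy : y ≠ 0)
    (hκ : 1 + iotaP' p 4 ≤ κ) (hlam : rhoP p ≤ lam)
    (hu : (κ : ℤ) - ⌊lam⌋ + iotaP' p y + 1 ≤ u)
    (hS : ∀ x : ℚ_[p], ‖x‖ ≤ 1 → ‖psEval p S x‖ ≤ 1 ∧ psEval p φ (psEval p S x) = x) :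
    ConvOnUnitDisc (antideriv φ) ∧
      IsQuadraticPhase p (psEval p (antideriv φ)) (psEval p φ) (psEval p S) (coeff 1 φ) := by
  have hp1 := one_lt_natCast_prime (p := p)
  have hκ' : 1 + iotaP' p 2 ≤ κ := by rw [iotaP'_four] at hκ; omega
  have hκ2 : p = 2 → 3 ≤ κ := by
    rintro rfl
    have := iotaP'_self (p := 2)
    rw [iotaP'_four] at hκ
    push_cast at this
    omega
  have hμ := rhoP_le_lamTilde (y := y) hκ' hlam
  have hR : 1 < (p : ℝ) ^ lamTilde p y κ lam :=
    Real.one_lt_rpow hp1 (rhoP_pos.trans_le hμ)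
  have hφb := h.coeffBound hy (min_le_right _ _) (min_le_left _ _) hu
  have hφ : ConvOnUnitDisc φ := hφb.convOnUnitDisc hR
  have hΦ : ConvOnUnitDisc (antideriv φ) := hφb.convOnUnitDisc_antideriv hR
  have h1 := h.norm_coeff_one hy hu
  have h2 : ∀ k, 2 ≤ k → ‖coeff k φ‖ ≤ (p : ℝ)⁻¹ := fun k hk =>
    h.norm_coeff_le_inv hy hκ' hlam hu hk
  refine ⟨hΦ, h1.le, fun x hx => norm_psEval_le zero_le_one (fun k => ?_) hx,
    fun x z hx hz => norm_psEval_sub_eq hφ h1 h2 hx hz, fun x hx => (hS x hx).1,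
    fun x hx => (hS x hx).2, fun x t hx ht ht' => norm_taylor_antideriv_le hφ hΦ hx ht
      (h.taylor_coeff_le hy (by omega) hκ2 hlam hu ht ht')⟩
  rcases k with _ | _ | k
  · rw [h.coeff_zero_deriv, norm_zero]; exact zero_le_one
  · exact h1.le
  · exact (h2 _ (by omega)).trans (inv_le_one_of_one_le₀ hp1.le)

/-- Estimates for the dual sums at level `N = n - w - κ - ι'`, uniform in the dual class, give an
estimate for the sum itself. -/
theorem norm_expSum_le_of_dual {w : ℤ} {y : ℚ} {κ n u v N : ℕ} {lam : ℝ}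
    {f : PowerSeries ℚ_[p]} (hf : f ∈ ClassF p w y κ lam u) (hy : y ≠ 0)
    (hκ : 1 + iotaP' p 4 ≤ κ) (hlam : rhoP p ≤ lam)
    (hu : (κ : ℤ) - ⌊lam⌋ + iotaP' p y + 1 ≤ u)
    (hv : (v : ℤ) = u - padicValRat p y - ⌈lamTilde p y κ lam⌉ + ⌊lam⌋)
    (hN : (N : ℤ) = n - w - κ - iotaP' p y) (hN12 : 1 + iotaP' p 12 ≤ N)
    {K σ B : ℝ} (hK : 0 ≤ K) (hσ : 0 ≤ σ) (hσ1 : σ ≤ 1) (hB : 0 < B) (hBP : B ≤ (p : ℝ) ^ N)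
    (hdual : ∀ g ∈ ClassF p (-((iotaP p y : ℤ) + κ)) y⁻¹ κ (lamTilde p y κ lam) v,
      ∀ (M' : ℤ) (L : ℕ), 1 ≤ L → L ≤ p ^ N → ‖expSum p g N M' L‖ ≤ K * (L : ℝ) ^ σ) (M : ℤ) :
    ‖expSum p f n M B‖ ≤ 4 * (K * √((p : ℝ) ^ N) * ((p : ℝ) ^ N / B) ^ (σ - 1) *
        dyadicFactor σ (Nat.clog 2 (p ^ N))) := by
  have hp0 := natCast_prime_ne_zero (p := p)
  have hκ' : 1 + iotaP' p 2 ≤ κ := by rw [iotaP'_four] at hκ; omega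
  obtain ⟨ω, ω', c₀, φ, E, h, hder⟩ := exists_normalisedDeriv hf
  obtain ⟨S, L, hSL, hL, hclass⟩ := h.exists_dual hy hκ' hlam hu hv
  obtain ⟨hΦ, H⟩ := h.isQuadraticPhase hy hκ hlam hu fun x hx => ⟨(hSL x hx).1, (hSL x hx).2.1⟩
  rw [iotaP'_twelve] at hN12
  have hN2 : p = 2 → 3 ≤ N := by
    rintro rfl
    have := iotaP'_self (p := 2)
    push_cast at this
    omega
  have hN3 : p = 3 → 2 ≤ N := by
    rintro rfl
    have := iotaP'_self (p := 3)
    push_cast at this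
    omega
  -- the phase is an affine function plus `p ^ (n - N)` times the quadratic phase
  have hfeq : f = C (coeff 0 f) + (C ((p : ℚ_[p]) ^ w * (c₀ : ℚ_[p])) * X +
      C ((p : ℚ_[p]) ^ (w + κ + iotaP' p y)) * antideriv φ) := by
    refine derivative.ext ?_ ?_
    · rw [hder]
      simp [derivative_antideriv, Derivation.leibniz]
    · simp [← coeff_zero_eq_constantCoeff_apply, coeff_zero_antideriv, coeff_zero_mul_X,
        -coeff_zero_eq_constantCoeff]
  have heval : ∀ m : ℤ, psEval p f m = coeff 0 f + ((p : ℚ_[p]) ^ w * (c₀ : ℚ_[p]) * m +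
      (p : ℚ_[p]) ^ (w + κ + iotaP' p y) * psEval p (antideriv φ) m) := by
    intro m
    have hm := norm_intCast_le_one (p := p) m
    conv_lhs => rw [hfeq]
    rw [psEval_add (convOnUnitDisc_C _) ((convOnUnitDisc_X.C_mul _).add (hΦ.C_mul _)) hm,
      psEval_add (convOnUnitDisc_X.C_mul _) (hΦ.C_mul _) hm, psEval_C, psEval_C_mul, psEval_C_mul,
      psEval_X]
  set D : ℕ := N + κ + iotaP' p y with hD
  have hDn : (D : ℤ) = n - w := by rw [hD]; push_cast; omega
  obtain ⟨a, ha⟩ := exists_int_norm_sub_le D (x := (c₀ : ℚ_[p])) c₀.2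
  have hterm : ∀ m : ℤ, padicE p (psEval p f m / (p : ℚ_[p]) ^ n) =
      padicE p (coeff 0 f / (p : ℚ_[p]) ^ n) *
        (cexpTwoPi (m * (a / ((p ^ D : ℕ) : ℝ))) * levelE p N (psEval p (antideriv φ) m)) := by
    intro m
    rw [heval, add_div, padicE_add, add_div, padicE_add]
    congr 2
    · rw [← levelE_intCast_mul, ← levelE_congr (x := (c₀ : ℚ_[p]) * (m : ℚ_[p])), levelE]
      · congr 1
        rw [div_eq_div_iff (pow_ne_zero _ hp0) (pow_ne_zero _ hp0)]
        have : (p : ℚ_[p]) ^ w * (p : ℚ_[p]) ^ D = (p : ℚ_[p]) ^ n := by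
          rw [← zpow_natCast, hDn, ← zpow_add₀ hp0, ← zpow_natCast]
          congr 1; ring
        rw [← this]; ring
      · rw [← sub_mul, norm_mul]
        exact (mul_le_of_le_one_right (norm_nonneg _) (norm_intCast_le_one m)).trans ha
    · rw [levelE]
      congr 1
      rw [div_eq_div_iff (pow_ne_zero _ hp0) (pow_ne_zero _ hp0)]
      have : (p : ℚ_[p]) ^ (w + κ + iotaP' p y) * (p : ℚ_[p]) ^ N = (p : ℚ_[p]) ^ n := by
        rw [← zpow_natCast, hN, ← zpow_add₀ hp0, ← zpow_natCast]
        congr 1; ring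
      rw [← this]; ring
  obtain ⟨b, hb⟩ := Int.eq_ofNat_of_zero_le (Int.floor_nonneg.2 hB.le)
  have hbB : (b : ℝ) ≤ B := by
    have := Int.floor_le B
    rw [hb] at this
    exact_mod_cast this
  rw [expSum, hb]
  simp only [hterm]
  rw [← mul_sum, norm_mul, norm_padicE, one_mul]
  refine H.norm_sum_le (by omega) hN2 hN3 hK hσ hσ1 hB hBP hbB fun k M' l hl hlP => ?_
  refine le_trans (le_of_eq ?_) (hdual _ (hclass k) M' l hl hlP)
  rw [expSum, Int.floor_natCast]
  congr 1
  refine sum_congr rfl fun m _ => ?_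
  have hm := norm_intCast_le_one (p := p) m
  rw [levelE, psEval_add hL (convOnUnitDisc_X.C_mul _) hm, psEval_C_mul, psEval_X, (hSL m hm).2.2]

end Dual

/-! ### Generic independence of `y` -/

section Generic

variable {X Y Z : Type*} {D : ℕ → Set X}

theorem MemJ.congr {g h : ℚ → ℕ → X → Y} (hg : MemJ D g)
    (hgh : ∀ y p, 0 < y → p.Prime → ∀ x ∈ D p, g y p x = h y p x) : MemJ D h := by
  obtain ⟨g₀, hg₀⟩ := hg
  refine ⟨g₀, fun y hy => ?_⟩
  obtain ⟨P₀, hP₀⟩ := hg₀ y hy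
  exact ⟨P₀, fun p hp hpP x hx => (hgh y p hy hp x hx).symm.trans (hP₀ p hp hpP x hx)⟩

theorem MemJ.map {g : ℚ → ℕ → X → Y} (hg : MemJ D g) (F : ℕ → X → Y → Z) :
    MemJ D fun y p x => F p x (g y p x) := by
  obtain ⟨g₀, hg₀⟩ := hg
  refine ⟨fun p x => F p x (g₀ p x), fun y hy => ?_⟩
  obtain ⟨P₀, hP₀⟩ := hg₀ y hy
  exact ⟨P₀, fun p hp hpP x hx => congrArg (F p x) (hP₀ p hp hpP x hx)⟩

theorem MemJ.prodMk {g : ℚ → ℕ → X → Y} {h : ℚ → ℕ → X → Z} (hg : MemJ D g) (hh : MemJ D h) :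
    MemJ D fun y p x => (g y p x, h y p x) := by
  obtain ⟨g₀, hg₀⟩ := hg
  obtain ⟨h₀, hh₀⟩ := hh
  refine ⟨fun p x => (g₀ p x, h₀ p x), fun y hy => ?_⟩
  obtain ⟨P, hP⟩ := hg₀ y hy
  obtain ⟨Q, hQ⟩ := hh₀ y hy
  refine ⟨P ∪ Q, fun p hp hpP x hx => ?_⟩
  rw [mem_union, not_or] at hpP
  exact Prod.ext (hP p hp hpP.1 x hx) (hQ p hp hpP.2 x hx)

/-- Substituting `y⁻¹` for `y` and a generically constant function for `x`. -/
theorem MemJ.comp_inv {g : ℚ → ℕ → X → Y} (hg : MemJ D g) {T : ℚ → ℕ → X → X} (hT : MemJ D T)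
    (hTD : ∀ y p, 0 < y → p.Prime → ∀ x ∈ D p, T y p x ∈ D p) :
    MemJ D fun y p x => g y⁻¹ p (T y p x) := by
  obtain ⟨g₀, hg₀⟩ := hg
  obtain ⟨T₀, hT₀⟩ := hT
  refine ⟨fun p x => g₀ p (T₀ p x), fun y hy => ?_⟩
  obtain ⟨P, hP⟩ := hg₀ y⁻¹ (inv_pos.2 hy)
  obtain ⟨Q, hQ⟩ := hT₀ y hy
  refine ⟨P ∪ Q, fun p hp hpP x hx => ?_⟩
  rw [mem_union, not_or] at hpP
  exact (hP p hp hpP.1 _ (hTD y p hy hp x hx)).trans (congrArg (g₀ p) (hQ p hp hpP.2 x hx))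

theorem memJ_const (g : ℕ → X → Y) : MemJ D fun _ p x => g p x :=
  ⟨g, fun _ _ => ⟨∅, fun _ _ _ _ _ => rfl⟩⟩

/-- The `p`-adic valuation of `y` is zero for all but finitely many `p`. -/
theorem memJ_padicValRat : MemJ D fun y p (_ : X) => padicValRat p y := by
  refine ⟨fun _ _ => 0, fun y hy =>
    ⟨y.num.natAbs.primeFactors ∪ y.den.primeFactors, fun p hp hpP x _ => ?_⟩⟩
  have hnum : y.num.natAbs ≠ 0 := Int.natAbs_ne_zero.2 (Rat.num_pos.2 hy).ne'
  rw [mem_union, not_or, Nat.mem_primeFactors_of_ne_zero hnum,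
    Nat.mem_primeFactors_of_ne_zero y.den_nz] at hpP
  change padicValRat p y = 0
  rw [padicValRat, padicValInt, padicValNat.eq_zero_of_not_dvd fun h => hpP.1 ⟨hp, h⟩,
    padicValNat.eq_zero_of_not_dvd fun h => hpP.2 ⟨hp, h⟩]
  simp

end Generic

/-! ### Admissibility -/

section Admissibility

theorem isRhoMultiple_lamTilde {p κ : ℕ} [hp : Fact p.Prime] {lam : ℝ} (y : ℚ)
    (hκ : 1 + iotaP' p 2 ≤ κ) (hlam : IsRhoMultiple p lam) :
    IsRhoMultiple p (lamTilde p y κ lam) := by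
  have hr := rhoP_mul (p := p)
  have hpos : 1 ≤ κ * (p - 1) := Nat.mul_pos (by omega) (by have := hp.out.one_lt; omega)
  have hcast : (κ : ℝ) = (κ * (p - 1) : ℕ) * rhoP p := by
    rw [Nat.cast_mul, Nat.cast_sub hp.out.one_lt.le, mul_assoc, Nat.cast_one, mul_comm _ (rhoP p),
      hr, mul_one]
  rcases min_choice ((κ : ℝ) - rhoAt p y) lam with h | h
  · rw [lamTilde, h, rhoAt]
    split_ifs with hv
    · exact ⟨κ * (p - 1), hpos, by rw [sub_zero, ← hcast]⟩
    · have e : (κ : ℝ) - rhoP p = (κ * (p - 1) - 1 : ℕ) * rhoP p := by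
        rw [Nat.cast_sub hpos, sub_mul, ← hcast, Nat.cast_one, one_mul]
      refine ⟨κ * (p - 1) - 1, ?_, e⟩
      have h1 := rhoP_le_lamTilde_aux (p := p) hκ
      rw [e] at h1
      rw [← Nat.cast_le (α := ℝ), Nat.cast_one]
      exact le_of_mul_le_mul_right (by linarith) (rhoP_pos (p := p))
  · rwa [lamTilde, h]

theorem lamTilde_mem_kappaLambdaDomain {y : ℚ} {p : ℕ} (hp : p.Prime) {x : ℕ × ℝ}
    (hx : x ∈ kappaLambdaDomain p) : (x.1, lamTilde p y x.1 x.2) ∈ kappaLambdaDomain p :=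
  have := Fact.mk hp
  ⟨hx.1, isRhoMultiple_lamTilde y hx.1 hx.2⟩

theorem memJ_lamTilde :
    MemJ kappaLambdaDomain fun y p x => (x.1, lamTilde p y x.1 x.2) :=
  memJ_padicValRat.map fun p (x : ℕ × ℝ) v =>
    (x.1, min ((x.1 : ℝ) - if v = 0 then 0 else rhoP p) x.2)

theorem MemJ.bTransform {Y : Type*} {g : ℚ → ℕ → ℕ → ℝ → Y}
    (hg : MemJ kappaLambdaDomain fun y p x => g y p x.1 x.2) :
    MemJ kappaLambdaDomain fun y p x => g y⁻¹ p x.1 (lamTilde p y x.1 x.2) :=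
  hg.comp_inv memJ_lamTilde fun _ _ _ hp _ hx => lamTilde_mem_kappaLambdaDomain hp hx

theorem Quintuple.Admissible.bTransform {q : Quintuple} (hq : q.Admissible) :
    (bTransform q).Admissible where
  k_nonneg := by have := hq.le_l; simp only [_root_.bTransform]; linarith
  k_le := by have := hq.l_le; simp only [_root_.bTransform]; linarith
  le_l := by have := hq.k_nonneg; simp only [_root_.bTransform]; linarith
  l_le := by have := hq.k_le; simp only [_root_.bTransform]; linarith
  δ_nonneg := by
    have := hq.δ_nonneg
    simp only [_root_.bTransform]
    split_ifs <;> linarith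
  r_mem := hq.r_mem.bTransform
  n₀_mem := (memJ_padicValRat.prodMk hq.n₀_mem.bTransform).map fun p x v =>
    max ((x.1 : ℤ) + v.1.toNat + 1 + iotaP' p 12) (v.1 + v.2)
  u₀_mem := ((memJ_padicValRat.prodMk memJ_lamTilde).prodMk hq.u₀_mem.bTransform).map fun _ x v =>
    max (max ((x.1 : ℤ) - ⌊x.2⌋ + v.1.1.toNat + 1) (v.1.1 + v.2 + ⌈v.1.2.2⌉ - ⌊x.2⌋)) 1
  κ₀_mem := ((memJ_padicValRat.prodMk
      (hq.κ₀_mem.comp_inv (memJ_const fun _ x => x) fun _ _ _ _ _ _ => trivial)).prodMk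
      (hq.lam₀_mem.comp_inv (memJ_const fun _ x => x) fun _ _ _ _ _ _ => trivial)).map
    fun p _ v => max (max (1 + (iotaP' p 4 : ℤ)) v.1.2) ⌈v.2 + if v.1.1 = 0 then 0 else rhoP p⌉
  lam₀_mem := hq.lam₀_mem.comp_inv (memJ_const fun _ x => x) fun _ _ _ _ _ _ => trivial
  n₀_gt y p κ lam _ _ _ := lt_max_of_lt_left (by omega)
  u₀_pos _ _ _ _ _ _ _ := le_max_right _ _
  κ₀_pos _ _ _ _ := le_max_of_le_left (le_max_of_le_left (by omega))
  lam₀_nonneg y p hy hp := hq.lam₀_nonneg y⁻¹ p (inv_pos.2 hy) hp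

theorem trivialDatum_admissible : trivialDatum.Admissible where
  k_nonneg := le_rfl
  k_le := by norm_num [trivialDatum]
  le_l := by norm_num [trivialDatum]
  l_le := le_rfl
  δ_nonneg := le_rfl
  r_mem := memJ_const _
  n₀_mem := memJ_padicValRat.map fun _ (x : ℕ × ℝ) v => (x.1 : ℤ) + v.toNat + 1
  u₀_mem := memJ_const _
  κ₀_mem := memJ_const fun p _ => 1 + (iotaP' p 2 : ℤ)
  lam₀_mem := memJ_const fun p _ => rhoP p
  n₀_gt _ _ _ _ _ _ _ := by simp only [trivialDatum]; omega
  u₀_pos _ _ _ _ _ _ _ := le_rfl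
  κ₀_pos _ _ _ _ := by simp only [trivialDatum]; omega
  lam₀_nonneg _ _ _ hp := have := Fact.mk hp; rhoP_pos.le

theorem rhoP_mem_kappaLambdaDomain (p : ℕ) : (1 + iotaP' p 2, rhoP p) ∈ kappaLambdaDomain p :=
  ⟨le_rfl, 1, le_rfl, by simp⟩

theorem IsExponentDatum.of_agree {q q' : Quintuple} (hq : IsExponentDatum q) (h : q.Agree q') :
    IsExponentDatum q' := by
  obtain ⟨ha, C, hC⟩ := hq
  obtain ⟨hk, hl, hδ, hf⟩ := h
  have hf' := fun y p hy hp => hf y p _ _ hy hp (rhoP_mem_kappaLambdaDomain p)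
  refine ⟨⟨hk ▸ ha.k_nonneg, hk ▸ ha.k_le, hl ▸ ha.le_l, hl ▸ ha.l_le, hδ ▸ ha.δ_nonneg,
    ha.r_mem.congr fun y p hy hp x hx => (hf y p _ _ hy hp hx).1,
    ha.n₀_mem.congr fun y p hy hp x hx => (hf y p _ _ hy hp hx).2.1,
    ha.u₀_mem.congr fun y p hy hp x hx => (hf y p _ _ hy hp hx).2.2.1,
    ha.κ₀_mem.congr fun y p hy hp _ _ => (hf' y p hy hp).2.2.2.1,
    ha.lam₀_mem.congr fun y p hy hp _ _ => (hf' y p hy hp).2.2.2.2,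
    fun y p κ lam hy hp hx => ?_, fun y p κ lam hy hp hx => ?_,
    fun y p hy hp => ?_, fun y p hy hp => ?_⟩, C, ?_⟩
  · rw [← (hf y p κ lam hy hp hx).2.1]; exact ha.n₀_gt y p κ lam hy hp hx
  · rw [← (hf y p κ lam hy hp hx).2.2.1]; exact ha.u₀_pos y p κ lam hy hp hx
  · rw [← (hf' y p hy hp).2.2.2.1]; exact ha.κ₀_pos y p hy hp
  · rw [← (hf' y p hy hp).2.2.2.2]; exact ha.lam₀_nonneg y p hy hp
  · intro p hp y w κ lam n u hy hκ hlam
    obtain ⟨e1, e2, e3, e4, e5⟩ := hf y p κ lam hy hp.out ⟨hκ, hlam⟩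
    rw [← e1, ← e2, ← e3, ← e4, ← e5, ← hk, ← hl, ← hδ]
    exact hC p y w κ lam n u hy hκ hlam

end Admissibility

/-! ### The `B`-process -/

section BTransform

theorem trivialDatum_isExponentDatum : IsExponentDatum trivialDatum := by
  refine ⟨trivialDatum_admissible, 1, fun p hp y w κ lam n u _ _ _ _ _ _ _ _ _ f _ M B hB _ => ?_⟩
  have h0 : 0 ≤ ⌊B⌋ := Int.floor_nonneg.2 hB.le
  simp only [trivialDatum, Real.rpow_zero, Real.rpow_one, one_mul, mul_one]
  calc ‖expSum p f n M B‖ ≤ ∑ m ∈ Ioc M (M + ⌊B⌋), (1 : ℝ) :=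
        norm_sum_le_of_le _ fun m _ => (norm_padicE _).le
    _ = (⌊B⌋ : ℝ) := by
        rw [sum_const, Int.card_Ioc, nsmul_eq_mul, mul_one, add_sub_cancel_left]
        exact_mod_cast Int.toNat_of_nonneg h0
    _ ≤ B := Int.floor_le B

theorem bTransform_trivialDatum_agree : (bTransform trivialDatum).Agree halfDatum := by
  refine ⟨by norm_num [bTransform, trivialDatum, halfDatum],
    by norm_num [bTransform, trivialDatum, halfDatum],
    by simp [bTransform, trivialDatum, halfDatum], fun y p κ lam hy hp hx => ?_⟩
  have := Fact.mk hp
  have hv := padicValRat_eq_iotaP'_sub_iotaP (p := p) y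
  have hi := iotaP'_inv (p := p) y
  refine ⟨rfl, ?_, ?_, ?_, rfl⟩
  · simp only [bTransform, trivialDatum, halfDatum, hi]
    omega
  · have hc : ⌈lamTilde p y κ lam⌉ ≤ (κ : ℤ) := by
      rw [Int.ceil_le]
      have : lamTilde p y κ lam ≤ κ - rhoAt p y := min_le_left _ _
      have := rhoAt_nonneg (p := p) y
      push_cast; linarith
    simp only [bTransform, trivialDatum, halfDatum]
    omega
  · have hc : ⌈rhoP p + rhoAt p y⌉ ≤ 1 + (iotaP' p 2 : ℤ) := by
      rw [Int.ceil_le]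
      have h1 := rhoP_le_lamTilde_aux (p := p) le_rfl
      have h2 := rhoAt_le (p := p) y
      push_cast at h1 ⊢; linarith
    have h4 := iotaP'_four (p := p)
    simp only [bTransform, trivialDatum, halfDatum]
    omega

/-- The dyadic factor is bounded, except that it may be logarithmic when `(k, ℓ) = (0, 1)`. -/
theorem exists_dyadicFactor_le {k l : ℝ} (hk : 0 ≤ k) (hl : l ≤ 1) :
    ∃ D : ℝ, 0 ≤ D ∧ ∀ P : ℕ, 2 ≤ P → dyadicFactor (l - k) (Nat.clog 2 P) ≤
      D * Real.log P ^ (if k = 0 ∧ l = 1 then (1 : ℝ) else 0) := by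
  have hlog2 : 0 < Real.log 2 := Real.log_pos (by norm_num)
  by_cases h : k = 0 ∧ l = 1
  · refine ⟨3 / Real.log 2, by positivity, fun P hP => ?_⟩
    rw [if_pos h, h.1, h.2, sub_zero, dyadicFactor_one, Real.rpow_one]
    exact one_add_clog_le hP
  · have hσ : l - k < 1 := by
      rcases hk.lt_or_eq with h0 | h0
      · linarith
      · rcases hl.lt_or_eq with h1 | h1
        · linarith
        · exact absurd ⟨h0.symm, h1⟩ h
    have h2 : (2 : ℝ) ^ (l - k - 1) < 1 :=
      Real.rpow_lt_one_of_one_lt_of_neg (by norm_num) (by linarith)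
    refine ⟨1 + (1 - (2 : ℝ) ^ (l - k - 1))⁻¹, ?_, fun P _ => ?_⟩
    · have : 0 < 1 - (2 : ℝ) ^ (l - k - 1) := by linarith
      positivity
    · rw [if_neg h, Real.rpow_zero, mul_one]
      exact dyadicFactor_le_of_lt_one hσ _

theorem bTransform_isExponentDatum {q : Quintuple} (hq : IsExponentDatum q) :
    IsExponentDatum (bTransform q) := by
  obtain ⟨ha, C, hC⟩ := hq
  obtain ⟨D, hD0, hD⟩ := exists_dyadicFactor_le ha.k_nonneg ha.l_le
  refine ⟨ha.bTransform, 4 * max C 0 * D, ?_⟩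
  intro p hp y w κ lam n u hy hκ hlam _ _ hκ₀ hlam₀ hn hu f hf M B hB hBP
  simp only [bTransform, max_le_iff] at hκ₀ hlam₀ hn hu
  set μ := lamTilde p y κ lam with hμ
  have hp1 := one_lt_natCast_prime (p := p)
  have hpR : (0 : ℝ) < p := by linarith
  have hv := padicValRat_eq_iotaP'_sub_iotaP (p := p) y
  have hμR := isRhoMultiple_lamTilde y hκ hlam
  have hy' : (0 : ℚ) < y⁻¹ := inv_pos.2 hy
  have hu₀ := ha.u₀_pos y⁻¹ p κ μ hy' hp.out ⟨hκ, hμR⟩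
  have hn1 := le_max_left ((κ : ℤ) + iotaP' p y + 1 + iotaP' p 12)
    (padicValRat p y + q.n₀ y⁻¹ p κ μ)
  have hn2 := le_max_right ((κ : ℤ) + iotaP' p y + 1 + iotaP' p 12)
    (padicValRat p y + q.n₀ y⁻¹ p κ μ)
  obtain ⟨N, hN⟩ := Int.eq_ofNat_of_zero_le (a := (n : ℤ) - w - κ - iotaP' p y) (by omega)
  obtain ⟨v, hvu⟩ := Int.eq_ofNat_of_zero_le
    (a := (u : ℤ) - padicValRat p y - ⌈μ⌉ + ⌊lam⌋) (by omega)
  have hlen : dualLength p n w κ y = (p : ℝ) ^ N := by rw [dualLength, hN, zpow_natCast]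
  have hlen' : dualLength p N (-((iotaP p y : ℤ) + κ)) κ y⁻¹ = (p : ℝ) ^ N := by
    rw [dualLength, iotaP'_inv, ← zpow_natCast]
    congr 1; ring
  rw [hlen] at hBP ⊢
  set P : ℝ := (p : ℝ) ^ N with hP
  have hP2 : 2 ≤ p ^ N := hp.out.two_le.trans (Nat.le_self_pow (by omega) p)
  have hP0 : 0 < P := by positivity
  have hlogP : 0 < Real.log P := by
    refine Real.log_pos ?_
    rw [hP]
    exact_mod_cast (by omega : 1 < p ^ N)
  have hdual : ∀ g ∈ ClassF p (-((iotaP p y : ℤ) + κ)) y⁻¹ κ μ v,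
      ∀ (M' : ℤ) (L : ℕ), 1 ≤ L → L ≤ p ^ N → ‖expSum p g N M' L‖ ≤
        (max C 0 * ((p : ℝ) ^ q.r y⁻¹ p κ μ * P ^ q.k * Real.log P ^ q.δ)) *
          (L : ℝ) ^ (q.l - q.k) := by
    intro g hg M' L hL hLP
    have hL0 : (0 : ℝ) < L := by exact_mod_cast hL
    have h1 := hC p y⁻¹ (-((iotaP p y : ℤ) + κ)) κ μ N v hy' hκ hμR (by omega) (by omega)
      hκ₀.1.2 (le_min ?_ hlam₀) (by omega) (by omega) g hg M' L hL0
      (by rw [hlen', hP]; exact_mod_cast hLP)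
    · rw [hlen'] at h1
      refine h1.trans ((mul_le_mul_of_nonneg_right (le_max_left C 0) (by positivity)).trans_eq ?_)
      rw [Real.div_rpow hP0.le hL0.le, Real.rpow_sub hL0]
      ring
    · have := Int.ceil_le.1 hκ₀.2
      push_cast at this
      linarith
  have hσ : 0 ≤ q.l - q.k := by linarith [ha.k_le, ha.le_l]
  have hσ1 : q.l - q.k ≤ 1 := by linarith [ha.k_nonneg, ha.l_le]
  have key := norm_expSum_le_of_dual hf hy.ne' (by omega) hlam.rhoP_le hu.1.1 hvu.symm hN.symm
    (by omega) (by positivity) hσ hσ1 hB hBP hdual M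
  refine key.trans ?_
  -- the exponents of `P / B` and `B`
  have hexp : P ^ q.k * √P * (P / B) ^ (q.l - q.k - 1) =
      (P / B) ^ (q.l - 1 / 2) * B ^ (q.k + 1 / 2) := by
    have hPB : P = P / B * B := by field_simp
    rw [Real.sqrt_eq_rpow, ← Real.rpow_add hP0]
    conv_lhs => rw [show P ^ (q.k + 1 / 2) = (P / B * B) ^ (q.k + 1 / 2) by rw [← hPB]]
    rw [Real.mul_rpow (by positivity) hB.le, mul_right_comm, ← Real.rpow_add (by positivity)]
    congr 2; ring
  have hfac := hD (p ^ N) hP2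
  rw [Nat.cast_pow] at hfac
  simp only [bTransform]
  rw [Real.rpow_add hlogP]
  calc _ ≤ 4 * (max C 0 * ((p : ℝ) ^ q.r y⁻¹ p κ μ * P ^ q.k * Real.log P ^ q.δ) * √P *
        (P / B) ^ (q.l - q.k - 1) *
        (D * Real.log P ^ (if q.k = 0 ∧ q.l = 1 then (1 : ℝ) else 0))) := by gcongr
    _ = 4 * max C 0 * D * ((p : ℝ) ^ q.r y⁻¹ p κ μ *
        (P ^ q.k * √P * (P / B) ^ (q.l - q.k - 1)) *
        (Real.log P ^ q.δ * Real.log P ^ (if q.k = 0 ∧ q.l = 1 then (1 : ℝ) else 0))) := by ring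
    _ = _ := by rw [hexp]; ring

end BTransform

theorem mainTheorem4 :
    (∀ q : Quintuple, IsExponentDatum q → IsExponentDatum (bTransform q)) ∧
    IsExponentDatum trivialDatum ∧
    (bTransform trivialDatum).Agree halfDatum ∧
    IsExponentDatum halfDatum :=
  ⟨fun _ => bTransform_isExponentDatum, trivialDatum_isExponentDatum,
    bTransform_trivialDatum_agree,
    (bTransform_isExponentDatum trivialDatum_isExponentDatum).of_agree
      bTransform_trivialDatum_agree⟩
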